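/- Conventions. A 2-ring is a presentable monoidal category whose tensor product is cocontinuous in each variable; it is commutative if it is equipped with a symmetry, and cartesian if its tensor product is the categorical product. A 1-morphism of commutative 2-rings is a cocontinuous (strong) symmetric monoidal functor, and a 2-morphism is a monoidal natural transformation. A cartesian 2-ring is good if its coproducts are disjoint (for $a=\coprod_{i\in I} a_i$ with $I$ a set, the maps $a_i\to a$ are monomorphisms and $a_i\times_a a_j$ is initial for $i\neq j$) and stable (for every $b\to a=\coprod_{i\in I} a_i$, the maps $b\times_a a_i\to b$ exhibit $b$ as $\coprod_{i\in I} b\times_a a_i$). A commutative 2-ring is good if its category of cocommutative coalgebras is a good cartesian 2-ring. $\mathbf{Good2AfSch}$ is the 2-category of good commutative 2-rings with the direction of its 1-morphisms reversed. For a small groupoid $G$, the category of right $G$-representations in $A$ is $A^G=\mathrm{Fun}(G^{\mathrm{op}},A)$. A right $G$-torsor in $A$ is a cocommutative coalgebra $x$ in $A^G$ such that (i) for all objects $t,s$ of $G$ in the same connected component the map $\coprod_{g:s\to t}x(t)\to x(t)\otimes x(s)$, given on the summand indexed by $g$ by $(\mathrm{id}\otimes x(g))\circ\Delta_{x(t)}$,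 is an isomorphism, and (ii) the counit of $x$, regarded as a cocone from $x:G^{\mathrm{op}}\to A$ to the unit $1_A$, is a colimit cocone. $\mathrm{Tors}(G,A)$ is the category of right $G$-torsors in $A$ with the maps of coalgebras in $A^G$ as morphisms. For a functor $\varphi:G\to H$ of small groupoids and $x\in A^G$, let $x\boxtimes_\varphi H\in A^H$ be $s\mapsto\int^{t\in G}x(t)\cdot \mathrm{Hom}_H(s,\varphi(t))$, where $\cdot$ denotes the copower. Let $K,G,H$ be small groupoids, let $\varphi,\psi:G\to H$ be functors, and let $\xi:K\to G$ with $p:\varphi\xi\cong\psi\xi$ be an equalizer of $\varphi$ and $\psi$ in the 2-category $\mathbf{Gpd}$ of small groupoids: for every small groupoid $L$, composition with $(\xi,p)$ is an equivalence from $\mathrm{Hom}(L,K)$ to the category of pairs $(f:L\to G,\ \varphi f\cong\psi f)$. (1) Let $A$ be a good cartesian 2-ring. Then for every functor $\chi:G'\to H'$ of small groupoids and every right $G'$-torsor $x$ in $A$, $x\boxtimes_\chi H'$ is a right $H'$-torsor. Let $\mathrm{Tors}(G,A;\varphi,\psi)$ be the category of pairs $(x,q)$ of a right $G$-torsor $x$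 in $A$ and a morphism $q:x\boxtimes_\varphi H\to x\boxtimes_\psi H$ in $\mathrm{Tors}(H,A)$, whose morphisms are the morphisms of $G$-torsors that commute with the maps $q$. Then the functor \[T:\mathrm{Tors}(K,A)\to\mathrm{Tors}(G,A;\varphi,\psi)\] that sends $y$ to $y\boxtimes_\xi G$ together with \[(y\boxtimes_\xi G)\boxtimes_\varphi H\;\cong\; y\boxtimes_{\varphi\xi}H\xrightarrow{\ \mathrm{id}_y\boxtimes p\ } y\boxtimes_{\psi\xi}H\;\cong\;(y\boxtimes_\xi G)\boxtimes_\psi H\] is an equivalence of categories. (2) The 2-functor $G\mapsto{}^G\mathbf{Set}=\mathrm{Fun}(G,\mathbf{Set})$, with the pointwise product as tensor product, with $\varphi\mapsto\varphi^*$ on functors and with $p\mapsto p^*$ on natural transformations, from $\mathbf{Gpd}$ to $\mathbf{Good2AfSch}$ preserves equalizers. That is, ${}^K\mathbf{Set}$, ${}^G\mathbf{Set}$ and ${}^H\mathbf{Set}$ are good commutative 2-rings, and for every good commutative 2-ring $A$ the functor $\beta\mapsto(\beta\xi^*,\beta p^*)$ is an equivalence from the category of 1-morphisms ${}^K\mathbf{Set}\to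 A$ to the category of pairs $(\alpha,q)$ of a 1-morphism $\alpha:{}^G\mathbf{Set}\to A$ and an invertible 2-morphism $q:\alpha\varphi^*\cong\alpha\psi^*$, whose morphisms are the 2-morphisms $\alpha\to\alpha'$ that commute with $q$ and $q'$. -/

import Mathlib

open CategoryTheory MonoidalCategory CartesianMonoidalCategory Limits Opposite ComonObj

universe u v v'

noncomputable section

namespace TwoRing

/-! ### Equalizers of categories -/

section Inserters

universe v₁ v₂ v₃ u₁ u₂ u₃

variable {C : Type u₁} [Category.{v₁} C] {D : Type u₂} [Category.{v₂} D]

/-- The objects `(c, q)` with `q : F c ⟶ G c`; the morphisms are the maps `c ⟶ c'` that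
commute with `q` and `q'`. -/
structure Inserter (F G : C ⥤ D) where
  base : C
  arrow : F.obj base ⟶ G.obj base

namespace Inserter

variable {F G : C ⥤ D}

@[ext]
structure Hom (X Y : Inserter F G) where
  base : X.base ⟶ Y.base
  comm : F.map base ≫ Y.arrow = X.arrow ≫ G.map base

attribute [simp] Hom.comm

@[simps]
instance : Category (Inserter F G) where
  Hom X Y := Hom X Y
  id X := ⟨𝟙 _, by simp⟩
  comp f g := ⟨f.base ≫ g.base, by
    rw [F.map_comp, G.map_comp, Category.assoc, g.comm, ← Category.assoc, f.comm,
      Category.assoc]⟩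

@[ext]
theorem hom_ext {X Y : Inserter F G} {f g : X ⟶ Y} (h : f.base = g.base) : f = g :=
  Hom.ext h

/-- A functor `P` with a natural transformation `P ⋙ F ⟶ P ⋙ G` gives a functor to the
inserter. -/
@[simps]
def lift {B : Type u₃} [Category.{v₃} B] (P : B ⥤ C) (θ : P ⋙ F ⟶ P ⋙ G) :
    B ⥤ Inserter F G where
  obj b := ⟨P.obj b, θ.app b⟩
  map f := ⟨P.map f, θ.naturality f⟩

end Inserter

/-- The (bicategorical) equalizer of two functors: the objects `(c, q)` with
`q : F c ≅ G c`; the morphisms are the maps `c ⟶ c'` that commute with `q` and `q'`. -/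
structure IsoInserter (F G : C ⥤ D) where
  base : C
  iso : F.obj base ≅ G.obj base

namespace IsoInserter

variable {F G : C ⥤ D}

@[ext]
structure Hom (X Y : IsoInserter F G) where
  base : X.base ⟶ Y.base
  comm : F.map base ≫ Y.iso.hom = X.iso.hom ≫ G.map base

attribute [simp] Hom.comm

@[simps]
instance : Category (IsoInserter F G) where
  Hom X Y := Hom X Y
  id X := ⟨𝟙 _, by simp⟩
  comp f g := ⟨f.base ≫ g.base, by
    rw [F.map_comp, G.map_comp, Category.assoc, g.comm, ← Category.assoc, f.comm,
      Category.assoc]⟩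

@[ext]
theorem hom_ext {X Y : IsoInserter F G} {f g : X ⟶ Y} (h : f.base = g.base) : f = g :=
  Hom.ext h

/-- A functor `P` with a natural isomorphism `P ⋙ F ≅ P ⋙ G` gives a functor to the
equalizer. -/
@[simps]
def lift {B : Type u₃} [Category.{v₃} B] (P : B ⥤ C) (θ : P ⋙ F ≅ P ⋙ G) :
    B ⥤ IsoInserter F G where
  obj b := ⟨P.obj b, θ.app b⟩
  map f := ⟨P.map f, θ.hom.naturality f⟩

end IsoInserter

end Inserters

/-- `ξ : K ⥤ G` with `p : ξ ⋙ φ ≅ ξ ⋙ ψ` is an equalizer of `φ, ψ : G ⥤ H` in the 2-category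
of small groupoids: for every small groupoid `L`, composition with `(ξ, p)` is an equivalence
from `Hom(L, K)` to the equalizer of the functors `Hom(L, G) ⥤ Hom(L, H)` given by
composition with `φ` and with `ψ`. -/
def IsGroupoidEqualizer {K G H : Type u} [Groupoid.{u} K] [Groupoid.{u} G] [Groupoid.{u} H]
    (ξ : K ⥤ G) (φ ψ : G ⥤ H) (p : ξ ⋙ φ ≅ ξ ⋙ ψ) : Prop :=
  ∀ (L : Type u) [Groupoid.{u} L],
    (IsoInserter.lift (F := (Functor.whiskeringRight L G H).obj φ)
      (G := (Functor.whiskeringRight L G H).obj ψ)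
      ((Functor.whiskeringRight L K G).obj ξ)
      ((Functor.whiskeringRight L K H).mapIso p)).IsEquivalence

/-! ### 2-rings -/

/-- A 2-ring: a presentable monoidal category whose tensor product is cocontinuous in each
variable. -/
class IsTwoRing (A : Type v) [Category.{u} A] [MonoidalCategory A] : Prop where
  presentable : IsLocallyPresentable.{u} A
  tensorLeft_cocontinuous (a : A) : PreservesColimitsOfSize.{u, u} (tensorLeft a)
  tensorRight_cocontinuous (a : A) : PreservesColimitsOfSize.{u, u} (tensorRight a)

instance {A : Type v} [Category.{u} A] [MonoidalCategory A] [IsTwoRing.{u} A] :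
    HasColimitsOfSize.{u, u} A := by
  have := IsTwoRing.presentable (A := A)
  obtain ⟨κ, _, _⟩ := IsLocallyPresentable.exists_cardinal.{u} A
  infer_instance

/-- Coproducts are disjoint and stable (under pullback). -/
structure HasDisjointStableCoproducts (C : Type v) [Category.{u} C] : Prop where
  mono_inj {I : Type u} {a : I → C} (c : Cofan a) (hc : IsColimit c) (i : I) : Mono (c.inj i)
  disjoint {I : Type u} {a : I → C} (c : Cofan a) (hc : IsColimit c) (i j : I) (hij : i ≠ j) :
    ∃ (z : C) (f : z ⟶ a i) (g : z ⟶ a j),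
      IsPullback f g (c.inj i) (c.inj j) ∧ Nonempty (IsInitial z)
  stable {I : Type u} {a : I → C} (c : Cofan a) (hc : IsColimit c) {b : C} (f : b ⟶ c.pt) :
    ∃ (b' : I → C) (g : ∀ i, b' i ⟶ b) (f' : ∀ i, b' i ⟶ a i),
      (∀ i, IsPullback (g i) (f' i) f (c.inj i)) ∧ Nonempty (IsColimit (Cofan.mk b g))

/-- A cartesian 2-ring (a 2-ring whose tensor product is the categorical product) is good if
its coproducts are disjoint and stable. -/
class IsGoodCartesianTwoRing (A : Type v) [Category.{u} A] [CartesianMonoidalCategory A] : Prop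
    extends IsTwoRing.{u} A where
  good : HasDisjointStableCoproducts.{u} A

/-- A commutative 2-ring `A` is good if coproducts are disjoint and stable in its category of
cocommutative coalgebras. -/
class IsGoodTwoRing (A : Type v) [Category.{u} A] [MonoidalCategory A] [SymmetricCategory A] :
    Prop extends IsTwoRing.{u} A where
  good : HasDisjointStableCoproducts.{u} (CommComon A)

/-! ### Tensor products of functors -/

section Boxtimes

universe w

variable {A : Type v} [Category.{w} A] [HasColimitsOfSize.{u, u} A]
variable {D : Type u} [Category.{u} D]

/-- The bifunctor `(d, d') ↦ x(d) · y(d')`, the copower of `x(d)` by the set `y(d')`. -/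
@[simps]
def copower (x : Dᵒᵖ ⥤ A) (y : D ⥤ Type u) : Dᵒᵖ ⥤ D ⥤ A where
  obj d :=
    { obj := fun d' => ∐ fun _ : y.obj d' => x.obj d
      map := fun f => Sigma.desc fun a => Sigma.ι (fun _ => x.obj d) (y.map f a) }
  map g := { app := fun d' => Sigma.desc fun a => x.map g ≫ Sigma.ι (fun _ => x.obj _) a }

/-- The tensor product `x ⊠_D y` of functors: the coend of `x(d) · y(d)` over `d ∈ D`. -/
def boxtimesObj (x : Dᵒᵖ ⥤ A) (y : D ⥤ Type u) : A := coend (copower x y)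

/-- The canonical map from the copy of `x(d)` indexed by `a ∈ y(d)` to `x ⊠_D y`. -/
def boxtimesι (x : Dᵒᵖ ⥤ A) (y : D ⥤ Type u) (d : D) (a : y.obj d) :
    x.obj (op d) ⟶ boxtimesObj x y :=
  Sigma.ι (fun _ : y.obj d => x.obj (op d)) a ≫ coend.ι (copower x y) d

theorem boxtimesι_condition (x : Dᵒᵖ ⥤ A) (y : D ⥤ Type u) {d d' : D} (f : d ⟶ d')
    (a : y.obj d) :
    x.map f.op ≫ boxtimesι x y d a = boxtimesι x y d' (y.map f a) := by
  have h := Sigma.ι (fun _ : y.obj d => x.obj (op d')) a ≫= coend.condition (copower x y) f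
  have h₁ := Sigma.ι_desc (fun a : y.obj d => x.map f.op ≫ Sigma.ι (fun _ => x.obj (op d)) a) a =≫
    coend.ι (copower x y) d
  have h₂ := Sigma.ι_desc (fun a : y.obj d => Sigma.ι (fun _ => x.obj (op d')) (y.map f a)) a =≫
    coend.ι (copower x y) d'
  refine Eq.trans ?_ (((h₁.symm.trans (Category.assoc _ _ _)).trans h).trans
    ((Category.assoc _ _ _).symm.trans h₂))
  exact (Category.assoc _ _ _).symm

theorem boxtimes_hom_ext {x : Dᵒᵖ ⥤ A} {y : D ⥤ Type u} {z : A} {f g : boxtimesObj x y ⟶ z}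
    (h : ∀ d a, boxtimesι x y d a ≫ f = boxtimesι x y d a ≫ g) : f = g := by
  refine coend.hom_ext fun d => Sigma.hom_ext _ _ fun a => ?_
  exact (Category.assoc _ _ _).symm.trans ((h d a).trans (Category.assoc _ _ _))

theorem boxtimesDesc_aux (x : Dᵒᵖ ⥤ A) (y : D ⥤ Type u) {z : A}
    (k : ∀ d, y.obj d → (x.obj (op d) ⟶ z))
    (hk : ∀ ⦃d d' : D⦄ (f : d ⟶ d') (a : y.obj d), x.map f.op ≫ k d a = k d' (y.map f a))
    ⦃d d' : D⦄ (f : d ⟶ d') :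
    ((copower x y).map f.op).app d ≫ Sigma.desc (k d) =
      ((copower x y).obj (op d')).map f ≫ Sigma.desc (k d') := by
  refine Sigma.hom_ext _ _ fun a => ?_
  have h₁ := Sigma.ι_desc (fun a : y.obj d => x.map f.op ≫ Sigma.ι (fun _ => x.obj (op d)) a) a =≫
    Sigma.desc (k d)
  have h₂ := Sigma.ι_desc (fun a : y.obj d => Sigma.ι (fun _ => x.obj (op d')) (y.map f a)) a =≫
    Sigma.desc (k d')
  have h₃ : (x.map f.op ≫ Sigma.ι (fun _ => x.obj (op d)) a) ≫ Sigma.desc (k d) =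
      Sigma.ι (fun _ => x.obj (op d')) (y.map f a) ≫ Sigma.desc (k d') := by
    simpa using hk f a
  exact (Category.assoc _ _ _).symm.trans
    (((h₁.trans h₃).trans h₂.symm).trans (Category.assoc _ _ _))

/-- The map out of `x ⊠_D y` given by a compatible family of maps. -/
def boxtimesDesc (x : Dᵒᵖ ⥤ A) (y : D ⥤ Type u) {z : A}
    (k : ∀ d, y.obj d → (x.obj (op d) ⟶ z))
    (hk : ∀ ⦃d d' : D⦄ (f : d ⟶ d') (a : y.obj d), x.map f.op ≫ k d a = k d' (y.map f a)) :
    boxtimesObj x y ⟶ z :=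
  coend.desc (fun d => Sigma.desc (k d)) fun _ _ f => boxtimesDesc_aux x y k hk f

@[simp]
theorem boxtimesι_desc (x : Dᵒᵖ ⥤ A) (y : D ⥤ Type u) {z : A}
    (k : ∀ d, y.obj d → (x.obj (op d) ⟶ z))
    (hk : ∀ ⦃d d' : D⦄ (f : d ⟶ d') (a : y.obj d), x.map f.op ≫ k d a = k d' (y.map f a))
    (d : D) (a : y.obj d) :
    boxtimesι x y d a ≫ boxtimesDesc x y k hk = k d a := by
  have h₁ := Sigma.ι (fun _ : y.obj d => x.obj (op d)) a ≫=
    coend.ι_desc (F := copower x y) (fun d => Sigma.desc (k d)) (fun _ _ f => boxtimesDesc_aux x y k hk f) d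
  exact (Category.assoc _ _ _).trans (h₁.trans (Sigma.ι_desc _ _))

@[simp]
theorem boxtimesι_desc_assoc (x : Dᵒᵖ ⥤ A) (y : D ⥤ Type u) {z : A}
    (k : ∀ d, y.obj d → (x.obj (op d) ⟶ z))
    (hk : ∀ ⦃d d' : D⦄ (f : d ⟶ d') (a : y.obj d), x.map f.op ≫ k d a = k d' (y.map f a))
    (d : D) (a : y.obj d) {z' : A} (m : z ⟶ z') :
    boxtimesι x y d a ≫ boxtimesDesc x y k hk ≫ m = k d a ≫ m := by
  rw [← Category.assoc, boxtimesι_desc]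

/-- `x ⊠_D y` as a functor of `x` and `y`. -/
@[simps]
def boxtimes : (Dᵒᵖ ⥤ A) ⥤ (D ⥤ Type u) ⥤ A where
  obj x :=
    { obj := fun y => boxtimesObj x y
      map := fun {y y'} β => boxtimesDesc x y (fun d a => boxtimesι x y' d (β.app d a))
        (fun d d' f a => by
          rw [boxtimesι_condition]
          congr 1
          exact (NatTrans.naturality_apply β f a).symm)
      map_id := fun y => boxtimes_hom_ext (by simp)
      map_comp := fun β γ => boxtimes_hom_ext (by simp) }
  map {x x'} α :=
    { app := fun y => boxtimesDesc x y (fun d a => α.app (op d) ≫ boxtimesι x' y d a)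
        (fun d d' f a => by simp [boxtimesι_condition])
      naturality := fun y y' β => boxtimes_hom_ext (by simp) }
  map_id x := by
    ext y
    exact boxtimes_hom_ext (by simp)
  map_comp α β := by
    ext y
    exact boxtimes_hom_ext (by simp)

theorem boxtimesι_map (x : Dᵒᵖ ⥤ A) {y y' : D ⥤ Type u} (β : y ⟶ y') (d : D) (a : y.obj d) :
    boxtimesι x y d a ≫ (boxtimes.obj x).map β = boxtimesι x y' d (β.app d a) := by
  dsimp only [boxtimes]
  exact boxtimesι_desc _ _ _ _ d a

theorem boxtimesι_map_app {x x' : Dᵒᵖ ⥤ A} (α : x ⟶ x') (y : D ⥤ Type u) (d : D) (a : y.obj d) :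
    boxtimesι x y d a ≫ (boxtimes.map α).app y = α.app (op d) ≫ boxtimesι x' y d a := by
  dsimp only [boxtimes]
  exact boxtimesι_desc _ _ _ _ d a

variable {K G H : Type u} [Groupoid.{u} K] [Groupoid.{u} G] [Groupoid.{u} H]

/-- For `φ : G ⥤ H`, the functor from `H^op` to left `G`-sets whose value at `s` is the
`G`-set `t ↦ Hom(s, φ t)`. -/
abbrev regularAlong (φ : G ⥤ H) : Hᵒᵖ ⥤ G ⥤ Type u := (φ ⋙ yoneda).flip

/-- A natural transformation `φ ⟶ ψ` acts on `regularAlong` by composition. -/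
abbrev regularAlongMap {φ ψ : G ⥤ H} (p : φ ⟶ ψ) : regularAlong φ ⟶ regularAlong ψ :=
  (flipFunctor G Hᵒᵖ (Type u)).map (Functor.whiskerRight p yoneda)

variable (A) in
/-- The functor `x ↦ x ⊠_φ H` from right `G`-representations to right `H`-representations,
`(x ⊠_φ H)(s) = ∫^{t ∈ G} x(t) · Hom(s, φ t)`. -/
@[simps!]
def pushforward (φ : G ⥤ H) : (Gᵒᵖ ⥤ A) ⥤ (Hᵒᵖ ⥤ A) :=
  boxtimes ⋙ (Functor.whiskeringLeft _ _ A).obj (regularAlong φ)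

variable (A) in
/-- The natural transformation with components `id_x ⊠ p : x ⊠_φ H ⟶ x ⊠_ψ H`. -/
@[simps!]
def pushforwardMap {φ ψ : G ⥤ H} (p : φ ⟶ ψ) : pushforward A φ ⟶ pushforward A ψ :=
  Functor.whiskerLeft boxtimes ((Functor.whiskeringLeft _ _ A).map (regularAlongMap p))

/-- The canonical map from the copy of `x(t)` indexed by `h : s ⟶ φ t` to
`(x ⊠_φ H)(s)`. -/
def pushforwardι (φ : G ⥤ H) (x : Gᵒᵖ ⥤ A) {s : H} (t : G) (h : s ⟶ φ.obj t) :
    x.obj (op t) ⟶ ((pushforward A φ).obj x).obj (op s) :=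
  boxtimesι x ((regularAlong φ).obj (op s)) t h

theorem pushforwardι_condition (φ : G ⥤ H) (x : Gᵒᵖ ⥤ A) {s : H} {t t' : G} (f : t ⟶ t')
    (h : s ⟶ φ.obj t) :
    x.map f.op ≫ pushforwardι φ x t h = pushforwardι φ x t' (h ≫ φ.map f) :=
  boxtimesι_condition x ((regularAlong φ).obj (op s)) f h

theorem pushforwardι_condition_assoc (φ : G ⥤ H) (x : Gᵒᵖ ⥤ A) {s : H} {t t' : G} (f : t ⟶ t')
    (h : s ⟶ φ.obj t) {z : A} (m : ((pushforward A φ).obj x).obj (op s) ⟶ z) :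
    x.map f.op ≫ pushforwardι φ x t h ≫ m = pushforwardι φ x t' (h ≫ φ.map f) ≫ m := by
  rw [← Category.assoc, pushforwardι_condition]

theorem pushforwardι_map (φ : G ⥤ H) (x : Gᵒᵖ ⥤ A) {s s' : H} (m : s' ⟶ s) (t : G)
    (h : s ⟶ φ.obj t) :
    pushforwardι φ x t h ≫ ((pushforward A φ).obj x).map m.op = pushforwardι φ x t (m ≫ h) :=
  boxtimesι_map x ((regularAlong φ).map m.op) t h

theorem pushforwardι_map_assoc (φ : G ⥤ H) (x : Gᵒᵖ ⥤ A) {s s' : H} (m : s' ⟶ s) (t : G)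
    (h : s ⟶ φ.obj t) {z : A} (n : ((pushforward A φ).obj x).obj (op s') ⟶ z) :
    pushforwardι φ x t h ≫ ((pushforward A φ).obj x).map m.op ≫ n =
      pushforwardι φ x t (m ≫ h) ≫ n := by
  rw [← Category.assoc, pushforwardι_map]

theorem pushforwardι_naturality (φ : G ⥤ H) {x x' : Gᵒᵖ ⥤ A} (α : x ⟶ x') {s : H} (t : G)
    (h : s ⟶ φ.obj t) :
    pushforwardι φ x t h ≫ ((pushforward A φ).map α).app (op s) =
      α.app (op t) ≫ pushforwardι φ x' t h :=
  boxtimesι_map_app α ((regularAlong φ).obj (op s)) t h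

theorem pushforwardι_naturality_assoc (φ : G ⥤ H) {x x' : Gᵒᵖ ⥤ A} (α : x ⟶ x') {s : H} (t : G)
    (h : s ⟶ φ.obj t) {z : A} (n : ((pushforward A φ).obj x').obj (op s) ⟶ z) :
    pushforwardι φ x t h ≫ ((pushforward A φ).map α).app (op s) ≫ n =
      α.app (op t) ≫ pushforwardι φ x' t h ≫ n := by
  rw [← Category.assoc, pushforwardι_naturality, Category.assoc]

theorem pushforwardι_pushforwardMap {φ ψ : G ⥤ H} (p : φ ⟶ ψ) (x : Gᵒᵖ ⥤ A) {s : H} (t : G)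
    (h : s ⟶ φ.obj t) :
    pushforwardι φ x t h ≫ ((pushforwardMap A p).app x).app (op s) =
      pushforwardι ψ x t (h ≫ p.app t) :=
  boxtimesι_map x ((regularAlongMap p).app (op s)) t h

theorem pushforward_hom_ext (φ : G ⥤ H) {x : Gᵒᵖ ⥤ A} {s : H} {z : A}
    {f g : ((pushforward A φ).obj x).obj (op s) ⟶ z}
    (w : ∀ (t : G) (h : s ⟶ φ.obj t), pushforwardι φ x t h ≫ f = pushforwardι φ x t h ≫ g) :
    f = g :=
  boxtimes_hom_ext w

/-- The map out of `(x ⊠_φ H)(s)` given by a compatible family of maps. -/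
def pushforwardDesc (φ : G ⥤ H) (x : Gᵒᵖ ⥤ A) (s : H) {z : A}
    (k : ∀ t : G, (s ⟶ φ.obj t) → (x.obj (op t) ⟶ z))
    (hk : ∀ ⦃t t' : G⦄ (f : t ⟶ t') (h : s ⟶ φ.obj t),
      x.map f.op ≫ k t h = k t' (h ≫ φ.map f)) :
    ((pushforward A φ).obj x).obj (op s) ⟶ z :=
  boxtimesDesc x ((regularAlong φ).obj (op s)) k hk

@[simp]
theorem pushforwardι_desc (φ : G ⥤ H) (x : Gᵒᵖ ⥤ A) (s : H) {z : A}
    (k : ∀ t : G, (s ⟶ φ.obj t) → (x.obj (op t) ⟶ z))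
    (hk : ∀ ⦃t t' : G⦄ (f : t ⟶ t') (h : s ⟶ φ.obj t),
      x.map f.op ≫ k t h = k t' (h ≫ φ.map f)) (t : G) (h : s ⟶ φ.obj t) :
    pushforwardι φ x t h ≫ pushforwardDesc φ x s k hk = k t h :=
  boxtimesι_desc _ _ _ _ _ _

@[simp]
theorem pushforwardι_desc_assoc (φ : G ⥤ H) (x : Gᵒᵖ ⥤ A) (s : H) {z : A}
    (k : ∀ t : G, (s ⟶ φ.obj t) → (x.obj (op t) ⟶ z))
    (hk : ∀ ⦃t t' : G⦄ (f : t ⟶ t') (h : s ⟶ φ.obj t),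
      x.map f.op ≫ k t h = k t' (h ≫ φ.map f)) (t : G) (h : s ⟶ φ.obj t) {z' : A}
    (m : z ⟶ z') :
    pushforwardι φ x t h ≫ pushforwardDesc φ x s k hk ≫ m = k t h ≫ m := by
  rw [← Category.assoc, pushforwardι_desc]

/-- The isomorphism `((x ⊠_ξ G) ⊠_φ H)(s) ≅ (x ⊠_{ξ ⋙ φ} H)(s)`. It sends the copy of `x(k)`
indexed by `u : g ⟶ ξ k` and by `h : s ⟶ φ g` to the one indexed by `h ≫ φ u`; its inverse
sends the copy of `x(k)` indexed by `h : s ⟶ φ (ξ k)` to the one indexed by the identity of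
`ξ k` and by `h`. -/
def pushforwardCompApp (ξ : K ⥤ G) (φ : G ⥤ H) (x : Kᵒᵖ ⥤ A) (s : H) :
    ((pushforward A φ).obj ((pushforward A ξ).obj x)).obj (op s) ≅
      ((pushforward A (ξ ⋙ φ)).obj x).obj (op s) where
  hom := pushforwardDesc φ _ s
    (fun g h => pushforwardDesc ξ x g
      (fun k u => pushforwardι (ξ ⋙ φ) x k (h ≫ φ.map u))
      (fun k k' f u => by simp [pushforwardι_condition]))
    (fun g g' f h => pushforward_hom_ext ξ fun k u => by
      rw [pushforwardι_map_assoc]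
      simp)
  inv := pushforwardDesc (ξ ⋙ φ) x s
    (fun k h => pushforwardι ξ x k (𝟙 _) ≫ pushforwardι φ _ (ξ.obj k) h)
    (fun k k' f h => by
      rw [pushforwardι_condition_assoc, Category.id_comp, Functor.comp_map,
        ← pushforwardι_condition φ, pushforwardι_map_assoc, Category.comp_id])
  hom_inv_id := pushforward_hom_ext φ fun g h => pushforward_hom_ext ξ fun k u => by
    simp only [pushforwardι_desc_assoc, pushforwardι_desc, Category.comp_id]
    rw [← pushforwardι_condition φ, pushforwardι_map_assoc, Category.comp_id]
  inv_hom_id := pushforward_hom_ext (ξ ⋙ φ) fun k h => by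
    simp

variable (A) in
/-- The natural isomorphism `(x ⊠_ξ G) ⊠_φ H ≅ x ⊠_{ξ ⋙ φ} H`. -/
def pushforwardComp (ξ : K ⥤ G) (φ : G ⥤ H) :
    pushforward A ξ ⋙ pushforward A φ ≅ pushforward A (ξ ⋙ φ) :=
  NatIso.ofComponents
    (fun x => NatIso.ofComponents (fun s => pushforwardCompApp ξ φ x s.unop)
      (fun {s s'} m => pushforward_hom_ext φ fun g h => pushforward_hom_ext ξ fun k u => by
        have h₁ := pushforwardι_map_assoc φ ((pushforward A ξ).obj x) m.unop g h
          (pushforwardCompApp ξ φ x s'.unop).hom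
        have h₂ := pushforwardι_map (ξ ⋙ φ) x m.unop k (h ≫ φ.map u)
        simp only [Quiver.Hom.op_unop] at h₁ h₂
        refine Eq.trans (_ ≫= h₁) ?_
        simp only [pushforwardCompApp, pushforwardι_desc, pushforwardι_desc_assoc]
        refine Eq.trans ?_ h₂.symm
        simp))
    (fun {x x'} α => by
      ext s
      refine pushforward_hom_ext φ fun g h => pushforward_hom_ext ξ fun k u => ?_
      have h₁ := pushforwardι_naturality_assoc φ ((pushforward A ξ).map α) g h
        (pushforwardCompApp ξ φ x' s.unop).hom
      have h₂ := pushforwardι_naturality (ξ ⋙ φ) α k (h ≫ φ.map u)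
      refine Eq.trans (_ ≫= h₁) ?_
      rw [pushforwardι_naturality_assoc]
      simp only [pushforwardCompApp, pushforwardι_desc, pushforwardι_desc_assoc,
        NatIso.ofComponents_hom_app, NatTrans.comp_app]
      exact h₂.symm)

end Boxtimes

/-! ### Torsors -/

section Torsors

universe w

section Definition

variable {A : Type v} [Category.{w} A] [MonoidalCategory A] [BraidedCategory A]
  [HasColimitsOfSize.{u, u} A]

variable {G : Type u} [Groupoid.{u} G]

/-- The component at `(t, s)` of the map `τ_x` associated with a coalgebra `x` in the category
of right `G`-representations: from the coproduct of the copies of `x(t)` indexed by the arrows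
`g : s ⟶ t` to `x(t) ⊗ x(s)`, given on the copy indexed by `g` by the comultiplication of
`x(t)` followed by `id ⊗ x(g)`. -/
def torsorMap (x : CommComon (Gᵒᵖ ⥤ A)) (t s : G) :
    (∐ fun _ : s ⟶ t => x.X.obj (op t)) ⟶ x.X.obj (op t) ⊗ x.X.obj (op s) :=
  Sigma.desc fun g => (Δ[x.X]).app (op t) ≫ x.X.obj (op t) ◁ x.X.map g.op

/-- The counit of a coalgebra `x` in the category of right `G`-representations, as a cocone
from `x` to the monoidal unit of `A`. -/
def counitCocone (x : CommComon (Gᵒᵖ ⥤ A)) : Cocone x.X where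
  pt := 𝟙_ A
  ι := ε[x.X]

/-- A cocommutative coalgebra in the category of right `G`-representations is a right
`G`-torsor if `τ_x` is an isomorphism (its target is `x(t) ⊗ x(s)` for `t`, `s` in the same
connected component, and its source and target are initial otherwise) and its counit is a
colimit cocone. -/
structure IsTorsor (x : CommComon (Gᵒᵖ ⥤ A)) : Prop where
  principal (t s : G) (h : Nonempty (s ⟶ t)) : IsIso (torsorMap x t s)
  colimit : Nonempty (IsColimit (counitCocone x))

/-- The category of right `G`-torsors in `A`; its morphisms are the maps of coalgebras in the
category of right `G`-representations. -/
abbrev Tors (G : Type u) [Groupoid.{u} G] (A : Type v) [Category.{w} A] [MonoidalCategory A]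
    [BraidedCategory A] [HasColimitsOfSize.{u, u} A] := ObjectProperty.FullSubcategory (fun x : CommComon (Gᵒᵖ ⥤ A) => IsTorsor x)

end Definition

section Cartesian

/-- In a cartesian monoidal category every object is a cocommutative coalgebra in a unique way
and every morphism is a map of coalgebras. -/
def cartesianCommComon (C : Type v) [Category.{w} C] [CartesianMonoidalCategory C]
    [BraidedCategory C] : C ⥤ CommComon C where
  obj X :=
    letI : ComonObj X := ((cartesianComon C).obj X).comon
    { X := X
      comm := ⟨by simp⟩ }
  map f := ⟨(cartesianComon C).map f⟩

variable {A : Type v} [Category.{w} A] [CartesianMonoidalCategory A] [BraidedCategory A]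
  [HasColimitsOfSize.{u, u} A]

variable {K G H : Type u} [Groupoid.{u} K] [Groupoid.{u} G] [Groupoid.{u} H]

/-- The right `G`-representation underlying a torsor. -/
def Tors.forget : Tors G A ⥤ (Gᵒᵖ ⥤ A) :=
  ObjectProperty.ι _ ⋙ CommComon.forget₂Comon _ ⋙ Comon.forget _

variable (A) in
/-- For every torsor `x` and every functor `φ`, `x ⊠_φ H` is a torsor. -/
def PushforwardPreservesTorsors : Prop :=
  ∀ (G H : Type u) [Groupoid.{u} G] [Groupoid.{u} H] (φ : G ⥤ H) (x : Tors G A),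
    IsTorsor ((cartesianCommComon _).obj ((pushforward A φ).obj (Tors.forget.obj x)))

/-- The functor `x ↦ x ⊠_φ H` on torsors. -/
def Tors.push (h : PushforwardPreservesTorsors.{u} A) (φ : G ⥤ H) : Tors G A ⥤ Tors H A :=
  ObjectProperty.lift _ (Tors.forget ⋙ pushforward A φ ⋙ cartesianCommComon _)
    (h G H φ)

/-- For `p : ξ ⋙ φ ⟶ ξ ⋙ ψ`, the composite
`(y ⊠_ξ G) ⊠_φ H ≅ y ⊠_{ξ ⋙ φ} H ⟶ y ⊠_{ξ ⋙ ψ} H ≅ (y ⊠_ξ G) ⊠_ψ H`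
whose middle map is `id_y ⊠ p`. -/
def pushforwardComparison (ξ : K ⥤ G) (φ ψ : G ⥤ H) (p : ξ ⋙ φ ⟶ ξ ⋙ ψ) :
    pushforward A ξ ⋙ pushforward A φ ⟶ pushforward A ξ ⋙ pushforward A ψ :=
  (pushforwardComp A ξ φ).hom ≫ pushforwardMap A p ≫ (pushforwardComp A ξ ψ).inv

/-- The maps of `pushforwardComparison`, as maps of torsors. -/
def Tors.pushComparison (h : PushforwardPreservesTorsors.{u} A) (ξ : K ⥤ G) (φ ψ : G ⥤ H)
    (p : ξ ⋙ φ ⟶ ξ ⋙ ψ) :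
    Tors.push h ξ ⋙ Tors.push h φ ⟶ Tors.push h ξ ⋙ Tors.push h ψ where
  app y := ObjectProperty.homMk ((cartesianCommComon _).map
    ((pushforwardComparison ξ φ ψ p).app (Tors.forget.obj y)))
  naturality y y' f := by
    apply ObjectProperty.hom_ext
    apply CommComon.hom_ext
    exact (pushforwardComparison ξ φ ψ p).naturality (Tors.forget.map f)

/-- `Tors(G, A; φ, ψ)`: right `G`-torsors `x` with a map of right `H`-torsors
`q : x ⊠_φ H ⟶ x ⊠_ψ H`; the morphisms are the maps of torsors that commute with the `q`'s. -/
abbrev TorsPair (h : PushforwardPreservesTorsors.{u} A) (φ ψ : G ⥤ H) :=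
  Inserter (Tors.push h φ) (Tors.push h ψ)

/-- The functor `T : Tors(K, A) ⥤ Tors(G, A; φ, ψ)` that sends `y` to `y ⊠_ξ G` with the
isomorphism `(y ⊠_ξ G) ⊠_φ H ≅ (y ⊠_ξ G) ⊠_ψ H` induced by `p`. -/
def Tors.T (h : PushforwardPreservesTorsors.{u} A) (ξ : K ⥤ G) (φ ψ : G ⥤ H)
    (p : ξ ⋙ φ ≅ ξ ⋙ ψ) : Tors K A ⥤ TorsPair h φ ψ :=
  Inserter.lift (Tors.push h ξ) (Tors.pushComparison h ξ φ ψ p.hom)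

end Cartesian

end Torsors

/-! ### The 2-category of commutative 2-rings -/

section Morphisms

universe w v₁ v₂ v₃ u₁ u₂ u₃

/-- A 1-morphism of commutative 2-rings: a cocontinuous symmetric monoidal functor. -/
structure TwoRingHom (B : Type u₁) [Category.{v₁} B] [MonoidalCategory B] [SymmetricCategory B]
    (A : Type u₂) [Category.{v₂} A] [MonoidalCategory A] [SymmetricCategory A] where
  functor : B ⥤ A
  [braided : functor.Braided]
  [cocontinuous : PreservesColimitsOfSize.{w, w} functor]

namespace TwoRingHom

attribute [instance] braided cocontinuous

section

variable {B : Type u₁} [Category.{v₁} B] [MonoidalCategory B] [SymmetricCategory B]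
  {A : Type u₂} [Category.{v₂} A] [MonoidalCategory A] [SymmetricCategory A]

/-- A 2-morphism: a monoidal natural transformation. -/
@[ext]
structure Hom (α β : TwoRingHom.{w} B A) where
  natTrans : α.functor ⟶ β.functor
  [isMonoidal : NatTrans.IsMonoidal natTrans]

attribute [instance] Hom.isMonoidal

@[simps]
instance : Category (TwoRingHom.{w} B A) where
  Hom α β := Hom α β
  id α := ⟨𝟙 α.functor⟩
  comp f g := ⟨f.natTrans ≫ g.natTrans⟩

@[ext]
theorem hom_ext {α β : TwoRingHom.{w} B A} {f g : α ⟶ β} (h : f.natTrans = g.natTrans) :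
    f = g :=
  Hom.ext h

/-- A monoidal natural isomorphism gives an isomorphism of 1-morphisms. -/
def mkIso {α β : TwoRingHom.{w} B A} (e : α.functor ≅ β.functor)
    [NatTrans.IsMonoidal e.hom] : α ≅ β where
  hom := ⟨e.hom⟩
  inv := ⟨e.inv⟩

end

variable {C : Type u₁} [Category.{v₁} C] [MonoidalCategory C] [SymmetricCategory C]
  {B : Type u₂} [Category.{v₂} B] [MonoidalCategory B] [SymmetricCategory B]

/-- Composition of 1-morphisms (in diagrammatic order). -/
@[simps]
def comp {A : Type u₃} [Category.{v₃} A] [MonoidalCategory A] [SymmetricCategory A]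
    (f : TwoRingHom.{w} C B) (α : TwoRingHom.{w} B A) : TwoRingHom.{w} C A where
  functor := f.functor ⋙ α.functor

section

variable {A : Type u₃} [Category.{v₃} A] [MonoidalCategory A] [SymmetricCategory A]

/-- Composition of a 1-morphism `f : C → B` with the 2-morphisms between 1-morphisms
`B → A`. -/
@[simps]
def whiskerLeft (f : TwoRingHom.{w} C B) {α β : TwoRingHom.{w} B A} (χ : α ⟶ β) :
    f.comp α ⟶ f.comp β where
  natTrans := Functor.whiskerLeft f.functor χ.natTrans
  isMonoidal := inferInstanceAs
    (NatTrans.IsMonoidal (Functor.whiskerLeft f.functor χ.natTrans))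

/-- Composition of the 2-morphisms between 1-morphisms `C → B` with a 1-morphism
`α : B → A`. -/
@[simps]
def whiskerRight {f g : TwoRingHom.{w} C B} (θ : f ⟶ g) (α : TwoRingHom.{w} B A) :
    f.comp α ⟶ g.comp α where
  natTrans := Functor.whiskerRight θ.natTrans α.functor
  isMonoidal := inferInstanceAs
    (NatTrans.IsMonoidal (Functor.whiskerRight θ.natTrans α.functor))

/-- Composition of the 2-isomorphisms between 1-morphisms `C → B` with a 1-morphism
`α : B → A`. -/
@[simps]
def whiskerRightIso {f g : TwoRingHom.{w} C B} (θ : f ≅ g) (α : TwoRingHom.{w} B A) :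
    f.comp α ≅ g.comp α where
  hom := whiskerRight θ.hom α
  inv := whiskerRight θ.inv α
  hom_inv_id := by
    ext c
    exact (α.functor.map_comp _ _).symm.trans
      ((congrArg (fun χ : f ⟶ f => α.functor.map (χ.natTrans.app c)) θ.hom_inv_id).trans
        (α.functor.map_id _))
  inv_hom_id := by
    ext c
    exact (α.functor.map_comp _ _).symm.trans
      ((congrArg (fun χ : g ⟶ g => α.functor.map (χ.natTrans.app c)) θ.inv_hom_id).trans
        (α.functor.map_id _))

/-- Composition of 1-morphisms is associative. -/
def assoc {D : Type*} [Category* D] [MonoidalCategory D] [SymmetricCategory D]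
    (f : TwoRingHom.{w} D C) (k : TwoRingHom.{w} C B) (α : TwoRingHom.{w} B A) :
    (f.comp k).comp α ≅ f.comp (k.comp α) :=
  @mkIso _ _ _ _ _ _ _ _ ((f.comp k).comp α) (f.comp (k.comp α))
    (Functor.associator f.functor k.functor α.functor)
    (inferInstanceAs (NatTrans.IsMonoidal
      (Functor.associator f.functor k.functor α.functor).hom))

@[simp]
theorem assoc_hom_natTrans_app {D : Type*} [Category* D] [MonoidalCategory D]
    [SymmetricCategory D] (f : TwoRingHom.{w} D C) (k : TwoRingHom.{w} C B)
    (α : TwoRingHom.{w} B A) (d : D) : (assoc f k α).hom.natTrans.app d = 𝟙 _ :=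
  rfl

@[simp]
theorem assoc_inv_natTrans_app {D : Type*} [Category* D] [MonoidalCategory D]
    [SymmetricCategory D] (f : TwoRingHom.{w} D C) (k : TwoRingHom.{w} C B)
    (α : TwoRingHom.{w} B A) (d : D) : (assoc f k α).inv.natTrans.app d = 𝟙 _ :=
  rfl

end

variable (A : Type u₃) [Category.{v₃} A] [MonoidalCategory A] [SymmetricCategory A]

/-- Composition with a 1-morphism `f : C → B`, as a functor `Hom(B, A) ⥤ Hom(C, A)`. -/
@[simps]
def precomp (f : TwoRingHom.{w} C B) : TwoRingHom.{w} B A ⥤ TwoRingHom.{w} C A where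
  obj α := f.comp α
  map χ := whiskerLeft f χ

/-- For a 2-isomorphism `θ : f₁ ≫ k ≅ f₂ ≫ k`, the isomorphisms
`f₁ ≫ (k ≫ α) ≅ f₂ ≫ (k ≫ α)` obtained by composing `θ` with the 1-morphisms `α : B → A`. -/
def precompIso {D : Type*} [Category* D] [MonoidalCategory D] [SymmetricCategory D]
    {f₁ f₂ : TwoRingHom.{w} D C} {k : TwoRingHom.{w} C B} (θ : f₁.comp k ≅ f₂.comp k) :
    precomp A k ⋙ precomp A f₁ ≅ precomp A k ⋙ precomp A f₂ :=
  NatIso.ofComponents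
    (fun α => (assoc f₁ k α).symm ≪≫ whiskerRightIso θ α ≪≫ assoc f₂ k α)
    (fun {α β} χ => by
      ext d
      have e := χ.natTrans.naturality (θ.hom.natTrans.app d)
      change χ.natTrans.app _ ≫ 𝟙 _ ≫ β.functor.map (θ.hom.natTrans.app d) ≫ 𝟙 _ =
        (𝟙 _ ≫ α.functor.map (θ.hom.natTrans.app d) ≫ 𝟙 _) ≫ χ.natTrans.app _
      rw [Category.id_comp, Category.id_comp, Category.comp_id, Category.comp_id]
      exact e.symm)

end TwoRingHom

end Morphisms

section Spec

variable {K G H : Type u} [Groupoid.{u} K] [Groupoid.{u} G] [Groupoid.{u} H]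

/-- The 1-morphism `φ^* : ^H Set → ^G Set` of commutative 2-rings given by composition with
`φ : G ⥤ H`. -/
def restriction (φ : G ⥤ H) : TwoRingHom.{u} (H ⥤ Type u) (G ⥤ Type u) where
  functor := (Functor.whiskeringLeft G H (Type u)).obj φ
  braided := { braided := fun X Y => by ext; rfl }
  cocontinuous := inferInstance

/-- The 2-isomorphism `φ^* ≫ ξ^* ≅ ψ^* ≫ ξ^*` given by `p : ξ ⋙ φ ≅ ξ ⋙ ψ`; its component at
`S : H ⥤ Type u` and `k` is `S (p k) : S (φ (ξ k)) ⟶ S (ψ (ξ k))`. -/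
def restrictionIso (ξ : K ⥤ G) (φ ψ : G ⥤ H) (p : ξ ⋙ φ ≅ ξ ⋙ ψ) :
    (restriction φ).comp (restriction ξ) ≅ (restriction ψ).comp (restriction ξ) :=
  @TwoRingHom.mkIso _ _ _ _ _ _ _ _
    ((restriction φ).comp (restriction ξ)) ((restriction ψ).comp (restriction ξ))
    ((Functor.whiskeringLeft K H (Type u)).mapIso p)
    { unit := rfl
      tensor := fun _ _ => rfl }

end Spec

/-- `k : C → B` with `θ : f ≫ k ≅ g ≫ k` is an equalizer of `f, g : D → C` in the
2-category of good affine 2-schemes, the 1-opposite of the 2-category of good commutative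
2-rings: for every good commutative 2-ring `A`, composition with `(k, θ)` is an equivalence from
`Hom(B, A)` to the equalizer of the functors `Hom(C, A) ⥤ Hom(D, A)` given by composition with
`f` and with `g`. -/
def IsGoodAffineSchemeEqualizer {B C D : Type v}
    [Category.{u} B] [MonoidalCategory B] [SymmetricCategory B]
    [Category.{u} C] [MonoidalCategory C] [SymmetricCategory C]
    [Category.{u} D] [MonoidalCategory D] [SymmetricCategory D]
    (f g : TwoRingHom.{u} D C) (k : TwoRingHom.{u} C B) (θ : f.comp k ≅ g.comp k) : Prop :=
  ∀ (A : Type v') [Category.{u} A] [MonoidalCategory A] [SymmetricCategory A]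
    [IsGoodTwoRing.{u} A],
    (IsoInserter.lift (TwoRingHom.precomp A k) (TwoRingHom.precompIso A θ)).IsEquivalence

end TwoRing

end

/-!
Both parts of the theorem are one statement about functors out of categories of left `G`-sets. In a
good cartesian category `C`, a right `G`-torsor `x` is the same as a functor `F` from left `G`-sets
to `C` that is cocontinuous and preserves finite products: `x` gives `F = x ⊠ -`, and `F` gives the
restriction of `F` to the representable `G`-sets (`IsPrincipal.isCocontinuousCartesian`,
`IsCocontinuousCartesian.isPrincipal`, `isTorsor_iff`). The torsor condition says that `F` preserves
products of representables, because `Hom(t, -) × Hom(s, -)` is the coproduct of copies of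
`Hom(t, -)` indexed by the arrows `s ⟶ t`. Under this correspondence `x ↦ x ⊠_φ H` becomes
precomposition with the restriction `φ^*` from `H`-sets to `G`-sets (`pushforwardBoxtimesIso`). In
particular the pushforward of a torsor is a torsor.

For a commutative 2-ring `A`, the tensor product of cocommutative coalgebras is their cartesian
product, and colimits of cocommutative coalgebras are computed in `A`. So the category of
cocommutative coalgebras of a good commutative 2-ring is a good cartesian category, except perhaps
for presentability, which is not needed. As every `G`-set is a coalgebra by its diagonal, a
1-morphism from left `G`-sets to `A` is the same as a functor from left `G`-sets to the
cocommutative coalgebras of `A` that is cocontinuous and preserves finite products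
(`toCocontinuousCartesian`).

What remains is `IsConcreteEqualizer.isEqualizing`: in a good cartesian category `C`, for an
equalizer `ξ : K ⥤ G`, `p : ξ ⋙ φ ≅ ξ ⋙ ψ` of `φ` and `ψ`, the functors `B` on `K`-sets correspond to
the functors `F` on `G`-sets with a transformation `q : φ^* ⋙ F ⟶ ψ^* ⋙ F`. Concretely `K` is the
groupoid of pairs of an object `t` of `G` and an arrow `h : φ(t) ⟶ ψ(t)`.

* Given `F` and `q`, the value of `q` on the universal element of an `H`-set over `φ(t)` is a map
  from `F(Hom(t, -))` to `F(Hom(φ(t), ψ -))`. As coproducts are disjoint and stable, it decomposes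
  `F(Hom(t, -))` into the parts on which `q` is given by the action of an arrow
  `h : φ(t) ⟶ ψ(t)` (`nonempty_isColimit_locus`). These parts are the values at `(t, h)` of a right
  `K`-representation `descent`; it is a torsor (`isPrincipal_descent`), and the functor on `G`-sets
  that it induces is `F` (`isIso_descentComparison`). No invertibility of `q` is needed.
* The `K`-set `Hom(k, -)` is the equalizer of two maps out of the restriction of `Hom(ξ(k), -)`,
  and a subset of a set with a groupoid action that is stable under the action has a stable
  complement. So this equalizer is a summand, and it is preserved by cocontinuous functors that
  preserve finite products (`IsCocontinuousCartesian.existsUnique_lift`). Thus a transformation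
  of functors on `K`-sets is determined by its restriction to `G`-sets, and every transformation of
  the restrictions that is compatible with `p` arises in this way.
-/

noncomputable section

namespace TwoRing

/-! ### Coproducts of set-valued functors -/

section Sets

variable {D : Type u} [Category.{u} D] {I : Type u} {a : I → D ⥤ Type u}

/-- A cofan of set-valued functors is a coproduct if and only if it is one at every object. -/
theorem nonempty_isColimit_cofan_iff (c : Cofan a) :
    Nonempty (IsColimit c) ↔ ∀ d, Function.Bijective
      (fun z : Σ i, (a i).obj d => (c.inj z.1).app d z.2) := by
  have key (d : D) : Nonempty (IsColimit (((evaluation D (Type u)).obj d).mapCocone c)) ↔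
      Function.Bijective (fun z : Σ i, (a i).obj d => (c.inj z.1).app d z.2) := by
    rw [(Cofan.isColimitMapCoconeEquiv _ _ _).nonempty_congr,
      Limits.Cofan.nonempty_isColimit_iff_bijective_fromSigma]
    rfl
  simp only [← key]
  exact ⟨fun ⟨h⟩ d => ⟨isColimitOfPreserves _ h⟩,
    fun h => ⟨evaluationJointlyReflectsColimits _ fun d => (h d).some⟩⟩

theorem nonempty_isInitial_of_isEmpty {z : D ⥤ Type u} (h : ∀ d, IsEmpty (z.obj d)) :
    Nonempty (IsInitial z) := by
  refine ⟨IsInitial.ofUniqueHom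
    (fun y => { app := fun d => TypeCat.ofHom fun a => (h d).elim a
                naturality := fun d _ _ => by ext a; exact (h d).elim a }) fun y m => ?_⟩
  ext d a
  exact (h d).elim a

variable (D) in
theorem hasDisjointStableCoproducts_functorToType :
    HasDisjointStableCoproducts.{u} (D ⥤ Type u) where
  mono_inj {I a} c hc i := by
    have h := (nonempty_isColimit_cofan_iff c).1 ⟨hc⟩
    rw [NatTrans.mono_iff_mono_app]
    intro d
    rw [mono_iff_injective]
    intro s s' e
    have := (h d).1 (a₁ := ⟨i, s⟩) (a₂ := ⟨i, s'⟩) e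
    simpa using this
  disjoint {I a} c hc i j hij := by
    have h := (nonempty_isColimit_cofan_iff c).1 ⟨hc⟩
    refine ⟨_, _, _, IsPullback.of_hasPullback _ _, nonempty_isInitial_of_isEmpty fun d => ⟨?_⟩⟩
    intro z
    refine hij (congrArg Sigma.fst ((h d).1 (a₁ := ⟨i, (pullback.fst (c.inj i) (c.inj j)).app d z⟩)
      (a₂ := ⟨j, (pullback.snd (c.inj i) (c.inj j)).app d z⟩) ?_))
    exact congr($(pullback.condition (f := c.inj i) (g := c.inj j)).app d z)
  stable {I a} c hc b f := by
    have h := (nonempty_isColimit_cofan_iff c).1 ⟨hc⟩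
    refine ⟨_, _, _, fun i => IsPullback.of_hasPullback f (c.inj i), ?_⟩
    rw [nonempty_isColimit_cofan_iff]
    intro d
    have hp (i) := (Types.isPullback_iff _ _ _ _).1
      ((IsPullback.of_hasPullback f (c.inj i)).map ((evaluation D (Type u)).obj d))
    constructor
    · rintro ⟨i, z⟩ ⟨j, w⟩ e
      have e' : (pullback.fst f (c.inj i)).app d z = (pullback.fst f (c.inj j)).app d w := e
      have e₁ : f.app d ((pullback.fst f (c.inj i)).app d z) =
        (c.inj i).app d ((pullback.snd f (c.inj i)).app d z) :=
        congr($(pullback.condition (f := f) (g := c.inj i)).app d z)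
      have e₂ : f.app d ((pullback.fst f (c.inj j)).app d w) =
        (c.inj j).app d ((pullback.snd f (c.inj j)).app d w) :=
        congr($(pullback.condition (f := f) (g := c.inj j)).app d w)
      have e₃ := (h d).1 (a₁ := ⟨i, (pullback.snd f (c.inj i)).app d z⟩)
        (a₂ := ⟨j, (pullback.snd f (c.inj j)).app d w⟩) (e₁.symm.trans ((congrArg _ e').trans e₂))
      obtain rfl : i = j := congrArg Sigma.fst e₃
      have e₄ := eq_of_heq (Sigma.mk.inj e₃).2
      exact congrArg _ ((hp i).2.1 _ _ ⟨e', e₄⟩)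
    · intro x
      obtain ⟨⟨i, y⟩, hy⟩ := (h d).2 (f.app d x)
      obtain ⟨z, hz, -⟩ := (hp i).2.2 x y hy.symm
      exact ⟨⟨i, z⟩, hz⟩

end Sets

theorem HasDisjointStableCoproducts.of_equivalence {C : Type v} [Category.{u} C] {D : Type v'}
    [Category.{u} D] (e : C ≌ D) (h : HasDisjointStableCoproducts.{u} C) :
    HasDisjointStableCoproducts.{u} D where
  mono_inj {I a} c hc i := by
    have hc' := isColimitCofanMkObjOfIsColimit e.inverse _ c.inj
      (hc.ofIsoColimit (Cocone.ext (Iso.refl _)))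
    have := h.mono_inj _ hc' i
    exact e.inverse.mono_of_mono_map this
  disjoint {I a} c hc i j hij := by
    have hc' := isColimitCofanMkObjOfIsColimit e.inverse _ c.inj
      (hc.ofIsoColimit (Cocone.ext (Iso.refl _)))
    obtain ⟨z, f, g, hp, ⟨hz⟩⟩ := h.disjoint _ hc' i j hij
    refine ⟨e.functor.obj z, e.functor.map f ≫ e.counit.app _, e.functor.map g ≫ e.counit.app _,
      ?_, ⟨hz.isInitialObj e.functor⟩⟩
    exact (hp.map e.functor).of_iso (Iso.refl _) (e.counitIso.app _) (e.counitIso.app _)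
      (e.counitIso.app _) (by simp) (by simp) (by simp) (by simp)
  stable {I a} c hc b f := by
    have hc' := isColimitCofanMkObjOfIsColimit e.inverse _ c.inj
      (hc.ofIsoColimit (Cocone.ext (Iso.refl _)))
    obtain ⟨b', g, f', hp, ⟨hb⟩⟩ := h.stable _ hc' (e.inverse.map f)
    refine ⟨fun i => e.functor.obj (b' i), fun i => e.functor.map (g i) ≫ e.counit.app _,
      fun i => e.functor.map (f' i) ≫ e.counit.app _, fun i => ?_, ?_⟩
    · exact ((hp i).map e.functor).of_iso (Iso.refl _) (e.counitIso.app _) (e.counitIso.app _)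
        (e.counitIso.app _) (by simp) (by simp) (by simp) (by simp)
    · exact ⟨(isColimitCofanMkObjOfIsColimit e.functor _ g hb).ofIsoColimit
        (Cofan.ext (e.counitIso.app _))⟩

section CommComon

variable (C : Type v) [Category.{u} C] [CartesianMonoidalCategory C]

variable {C} in
theorem comp_comul_of_cartesian {X Y : C} [ComonObj X] [ComonObj Y] (f : X ⟶ Y) :
    f ≫ Δ[Y] = Δ[X] ≫ (f ⊗ₘ f) := by
  simp

variable [BraidedCategory C]

variable {C} in
/-- Every morphism of a cartesian monoidal category is a map of coalgebras. -/
def CommComon.homOfCartesian {X Y : CommComon C} (f : X.X ⟶ Y.X) : X ⟶ Y :=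
  ⟨.mk' f (toUnit_unique _ _) (comp_comul_of_cartesian f)⟩

/-- The category of cocommutative coalgebras in a cartesian monoidal category is the category
itself. -/
def cartesianCommComonEquivalence : C ≌ CommComon C where
  functor := cartesianCommComon C
  inverse := CommComon.forget₂Comon C ⋙ Comon.forget C
  unitIso := Iso.refl _
  counitIso := NatIso.ofComponents (fun X =>
    { hom := CommComon.homOfCartesian (𝟙 X.X)
      inv := CommComon.homOfCartesian (𝟙 X.X)
      hom_inv_id := CommComon.hom_ext _ _ (Category.id_comp _)
      inv_hom_id := CommComon.hom_ext _ _ (Category.id_comp _) })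
    fun f => CommComon.hom_ext _ _ ((Category.comp_id f.hom.hom).trans
      (Category.id_comp f.hom.hom).symm)
  functor_unitIso_comp _ := CommComon.hom_ext _ _ (Category.id_comp _)

end CommComon

/-- The category of left `K`-sets is cartesian, so that it is equivalent to its category of
cocommutative coalgebras; it is presentable because it is equivalent to the category of presheaves
on `K`. -/
theorem isGoodTwoRing_functorToType (K : Type u) [Groupoid.{u} K] :
    IsGoodTwoRing.{u} (K ⥤ Type u) where
  presentable :=
    (((Groupoid.invEquivalence (C := K)).congrLeft (E := Type u)).symm).isLocallyPresentable
  tensorLeft_cocontinuous _ := inferInstance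
  tensorRight_cocontinuous _ := inferInstance
  good := (hasDisjointStableCoproducts_functorToType K).of_equivalence
    (cartesianCommComonEquivalence (K ⥤ Type u))

/-! ### Disjoint and stable coproducts -/

section Disjoint

variable {C : Type v} [Category.{u} C]

/-- A coproduct of initial objects is initial. -/
theorem nonempty_isInitial_of_cofan {I : Type*} {b : I → C} {w : C} {g : ∀ i, b i ⟶ w}
    (hg : IsColimit (Cofan.mk w g)) (hb : ∀ i, Nonempty (IsInitial (b i))) :
    Nonempty (IsInitial w) :=
  ⟨IsInitial.ofUniqueHom (fun z => Cofan.IsColimit.desc hg fun i => (hb i).some.to z)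
    fun _ _ => Cofan.IsColimit.hom_ext hg _ _ fun i => (hb i).some.hom_ext _ _⟩

/-- Initial summands may be left out of a coproduct. -/
theorem nonempty_isColimit_cofan_of_isInitial {I J : Type*} {b : I → C} {w : C}
    {g : ∀ i, b i ⟶ w} (hg : IsColimit (Cofan.mk w g)) {e : J → I} (he : Function.Injective e)
    {b' : J → C} {g' : ∀ j, b' j ⟶ w} (k : ∀ j, b' j ≅ b (e j))
    (hk : ∀ j, (k j).hom ≫ g (e j) = g' j)
    (hb : ∀ i, i ∉ Set.range e → Nonempty (IsInitial (b i))) :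
    Nonempty (IsColimit (Cofan.mk w g')) := by
  classical
  have hk' (j) : (k j).inv ≫ g' j = g (e j) := by rw [← hk, Iso.inv_hom_id_assoc]
  let d (s : Cofan b') (i : I) : b i ⟶ s.pt :=
    if h : i ∈ Set.range e then eqToHom (by rw [h.choose_spec]) ≫ (k h.choose).inv ≫ s.inj h.choose
    else (hb i h).some.to _
  have hd (s : Cofan b') (j : J) : d s (e j) = (k j).inv ≫ s.inj j := by
    have h : e j ∈ Set.range e := ⟨j, rfl⟩
    have h' (j' : J) (hj : e j' = e j) :
        eqToHom (congrArg b hj.symm) ≫ (k j').inv ≫ s.inj j' = (k j).inv ≫ s.inj j := by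
      obtain rfl := he hj
      simp
    simp only [d, dif_pos h]
    exact h' _ h.choose_spec
  refine ⟨Cofan.IsColimit.mk _ (fun s => Cofan.IsColimit.desc hg (d s)) (fun s j => ?_)
    (fun s m hm => Cofan.IsColimit.hom_ext hg _ _ fun i => ?_)⟩
  · have := Cofan.IsColimit.fac hg (d s) (e j)
    simp only [cofan_mk_inj] at this ⊢
    rw [← hk, Category.assoc, this, hd, Iso.hom_inv_id_assoc]
  · rw [Cofan.IsColimit.fac]
    by_cases h : i ∈ Set.range e
    · obtain ⟨j, rfl⟩ := h
      have := hm j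
      simp only [cofan_mk_inj] at this ⊢
      rw [hd, ← hk', Category.assoc, this]
    · exact (hb i h).some.hom_ext _ _

namespace HasDisjointStableCoproducts

variable (h : HasDisjointStableCoproducts.{u} C)
include h

/-- The initial object is strict. -/
theorem nonempty_isInitial_of_hom {z w : C} (hz : IsInitial z) (f : w ⟶ z) :
    Nonempty (IsInitial w) := by
  have hc : IsColimit (Cofan.mk z (fun i : PEmpty.{u + 1} => (i.elim : (i.elim : C) ⟶ z))) :=
    Cofan.IsColimit.mk _ (fun s => hz.to _) (fun _ i => i.elim) (fun _ _ _ => hz.hom_ext _ _)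
  obtain ⟨b', g, f', -, ⟨hb⟩⟩ := h.stable _ hc f
  exact nonempty_isInitial_of_cofan hb fun i => i.elim

/-- An object that maps to two different summands of a coproduct, in a way that agrees in the
coproduct, is initial. -/
theorem nonempty_isInitial_of_ne {I : Type u} {a : I → C} {c : Cofan a} (hc : IsColimit c)
    {i j : I} (hij : i ≠ j) {w : C} (r : w ⟶ a i) (s : w ⟶ a j) (e : r ≫ c.inj i = s ≫ c.inj j) :
    Nonempty (IsInitial w) := by
  obtain ⟨z, f, g, hp, ⟨hz⟩⟩ := h.disjoint c hc i j hij
  exact h.nonempty_isInitial_of_hom hz (hp.lift r s e)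

end HasDisjointStableCoproducts

variable (C) in
/-- A cartesian monoidal category with small colimits, a tensor product that is cocontinuous in
each variable, and disjoint stable coproducts: a good cartesian 2-ring, except that it need not
be locally presentable. -/
class IsGoodCartesian [CartesianMonoidalCategory C] : Prop where
  hasColimits : HasColimitsOfSize.{u, u} C
  tensorLeft_cocontinuous (a : C) : PreservesColimitsOfSize.{u, u} (tensorLeft a)
  tensorRight_cocontinuous (a : C) : PreservesColimitsOfSize.{u, u} (tensorRight a)
  good : HasDisjointStableCoproducts.{u} C

attribute [instance] IsGoodCartesian.hasColimits IsGoodCartesian.tensorLeft_cocontinuous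
  IsGoodCartesian.tensorRight_cocontinuous

end Disjoint

/-! ### Cocontinuous functors on set-valued functors -/

section Cocontinuous

variable {D : Type u} [Category.{u} D]

/-- The map from a representable functor that corresponds to an element. -/
abbrev el {S : D ⥤ Type u} {t : D} (a : S.obj t) : coyoneda.obj (op t) ⟶ S :=
  coyonedaEquiv.symm a

theorem el_app_id {S : D ⥤ Type u} {t : D} (a : S.obj t) : (el a).app t (𝟙 t) = a :=
  coyonedaEquiv.apply_symm_apply a

theorem el_comp {S S' : D ⥤ Type u} {t : D} (a : S.obj t) (α : S ⟶ S') :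
    el a ≫ α = el (α.app t a) := by
  apply coyonedaEquiv.injective
  rw [coyonedaEquiv_comp]
  simp

theorem coyoneda_map_el {S : D ⥤ Type u} {t t' : D} (g : t ⟶ t') (a : S.obj t) :
    coyoneda.map g.op ≫ el a = el (S.map g a) :=
  (coyonedaEquiv_symm_map g a).symm

theorem el_coyoneda {t t' : D} (g : t ⟶ t') :
    el (S := coyoneda.obj (op t)) g = coyoneda.map g.op := by
  apply coyonedaEquiv.injective
  rw [coyonedaEquiv_coyoneda_map]
  simp

theorem el_id (t : D) : el (S := coyoneda.obj (op t)) (𝟙 t) = 𝟙 _ := by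
  rw [el_coyoneda]
  simp

/-- A set-valued functor as a cocone over the representable functors that map to it. -/
def elementsCocone (S : D ⥤ Type u) : Cocone ((CategoryOfElements.π S).op ⋙ coyoneda) where
  pt := S
  ι :=
    { app := fun p => el p.unop.2
      naturality := fun p q f => by
        have := coyoneda_map_el (S := S) f.unop.1 q.unop.2
        rw [f.unop.2] at this
        exact this.trans (Category.comp_id _).symm }

/-- A set-valued functor is the colimit of the representable functors that map to it. -/
def elementsCoconeIsColimit (S : D ⥤ Type u) : IsColimit (elementsCocone S) where
  desc s :=
    { app := fun d => TypeCat.ofHom fun a => (s.ι.app (op ⟨d, a⟩)).app d (𝟙 d)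
      naturality := fun d d' f => by
        ext a
        have h := s.w (CategoryOfElements.homMk (F := S) ⟨d, a⟩ ⟨d', S.map f a⟩ f rfl).op
        have h₁ := congr(($h).app d' (𝟙 d'))
        have h₂ := NatTrans.naturality_apply (s.ι.app (op ⟨d, a⟩)) f (𝟙 d)
        exact h₁.symm.trans ((congrArg ((s.ι.app (op ⟨d, a⟩)).app d')
          (show f ≫ 𝟙 d' = 𝟙 d ≫ f by simp)).trans h₂) }
  fac s p := by
    ext d (f : _ ⟶ d)
    have h := s.w (CategoryOfElements.homMk p.unop ⟨d, S.map f p.unop.2⟩ f rfl).op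
    have h₁ := congr(($h).app d (𝟙 d))
    exact h₁.symm.trans (congrArg ((s.ι.app p).app d) (Category.comp_id f))
  uniq s m hm := by
    ext d a
    have h := congr(($(hm (op ⟨d, a⟩))).app d (𝟙 d))
    have h' : ((elementsCocone S).ι.app (op ⟨d, a⟩)).app d (𝟙 d) = a :=
      el_app_id a
    exact (congrArg (m.app d) h').symm.trans h

variable {C : Type v} [Category.{u} C] (F : (D ⥤ Type u) ⥤ C)

section

theorem map_coyoneda_map_el {S : D ⥤ Type u} ⦃t t' : D⦄ (f : t ⟶ t') (a : S.obj t) :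
    F.map (coyoneda.map f.op) ≫ F.map (el a) = F.map (el (S.map f a)) := by
  rw [← F.map_comp, coyoneda_map_el]

theorem cocontinuousExtend_aux {F F' : (D ⥤ Type u) ⥤ C} (k : coyoneda ⋙ F ⟶ coyoneda ⋙ F')
    (S : D ⥤ Type u) ⦃t t' : D⦄ (f : t ⟶ t') (a : S.obj t) :
    F.map (coyoneda.map f.op) ≫ k.app (op t) ≫ F'.map (el a) =
      k.app (op t') ≫ F'.map (el (S.map f a)) := by
  have := k.naturality f.op
  dsimp at this
  rw [reassoc_of% this, ← F'.map_comp, coyoneda_map_el]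

variable [PreservesColimitsOfSize.{u, u} F]

/-- Maps out of the value of a cocontinuous functor at `S` may be compared on the elements of
`S`. -/
theorem cocontinuous_hom_ext {S : D ⥤ Type u} {z : C} {f g : F.obj S ⟶ z}
    (h : ∀ t (a : S.obj t), F.map (el a) ≫ f = F.map (el a) ≫ g) : f = g :=
  (isColimitOfPreserves F (elementsCoconeIsColimit S)).hom_ext fun p => h _ p.unop.2

/-- The map out of the value of a cocontinuous functor given by a compatible family of maps out
of its values on representable functors. -/
def cocontinuousDesc {S : D ⥤ Type u} {z : C} (k : ∀ t, S.obj t → (F.obj (coyoneda.obj (op t)) ⟶ z))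
    (hk : ∀ ⦃t t' : D⦄ (f : t ⟶ t') (a : S.obj t),
      F.map (coyoneda.map f.op) ≫ k t a = k t' (S.map f a)) : F.obj S ⟶ z :=
  (isColimitOfPreserves F (elementsCoconeIsColimit S)).desc
    { pt := z
      ι :=
        { app := fun p => k _ p.unop.2
          naturality := fun p q f => by
            have := hk f.unop.1 q.unop.2
            rw [f.unop.2] at this
            exact this.trans (Category.comp_id _).symm } }

theorem map_el_cocontinuousDesc {S : D ⥤ Type u} {z : C}
    (k : ∀ t, S.obj t → (F.obj (coyoneda.obj (op t)) ⟶ z))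
    (hk : ∀ ⦃t t' : D⦄ (f : t ⟶ t') (a : S.obj t),
      F.map (coyoneda.map f.op) ≫ k t a = k t' (S.map f a)) (t : D) (a : S.obj t) :
    F.map (el a) ≫ cocontinuousDesc F k hk = k t a :=
  (isColimitOfPreserves F (elementsCoconeIsColimit S)).fac _ (op ⟨t, a⟩)

theorem nonempty_isInitial_of_coyoneda
    (h : ∀ t, Nonempty (IsInitial (F.obj (coyoneda.obj (op t))))) (S : D ⥤ Type u) :
    Nonempty (IsInitial (F.obj S)) :=
  ⟨IsInitial.ofUniqueHom
    (fun _ => cocontinuousDesc F (fun t _ => (h t).some.to _) fun _ _ _ _ => (h _).some.hom_ext _ _)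
    fun _ _ => cocontinuous_hom_ext F fun t _ => (h t).some.hom_ext _ _⟩

variable {F}

/-- A family of maps, natural on the representable functors, extends to a natural transformation
out of a cocontinuous functor. -/
def cocontinuousExtend {F' : (D ⥤ Type u) ⥤ C} (k : coyoneda ⋙ F ⟶ coyoneda ⋙ F') : F ⟶ F' where
  app S := cocontinuousDesc F (fun t a => k.app (op t) ≫ F'.map (el a))
    (cocontinuousExtend_aux k S)
  naturality S S' α := cocontinuous_hom_ext F fun t a => by
    rw [← F.map_comp_assoc, el_comp, map_el_cocontinuousDesc, ← Category.assoc,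
      map_el_cocontinuousDesc, Category.assoc, ← F'.map_comp, el_comp]

theorem cocontinuousExtend_app {F' : (D ⥤ Type u) ⥤ C} (k : coyoneda ⋙ F ⟶ coyoneda ⋙ F')
    (t : D) : (cocontinuousExtend k).app (coyoneda.obj (op t)) = k.app (op t) := by
  have := map_el_cocontinuousDesc F (S := coyoneda.obj (op t))
    (fun t a => k.app (op t) ≫ F'.map (el a)) (cocontinuousExtend_aux k _) t (𝟙 t)
  rw [el_id, F.map_id, F'.map_id, Category.id_comp] at this
  exact this.trans (Category.comp_id _)

theorem natTrans_ext_of_coyoneda {F' : (D ⥤ Type u) ⥤ C} {α β : F ⟶ F'}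
    (h : ∀ t, α.app (coyoneda.obj (op t)) = β.app (coyoneda.obj (op t))) : α = β := by
  ext S
  exact cocontinuous_hom_ext F fun t a => by rw [α.naturality, β.naturality, h]

/-- A natural transformation of cocontinuous functors is invertible if it is invertible on the
representable functors. -/
theorem isIso_of_coyoneda {F' : (D ⥤ Type u) ⥤ C} [PreservesColimitsOfSize.{u, u} F']
    (α : F ⟶ F') (h : ∀ t, IsIso (α.app (coyoneda.obj (op t)))) : IsIso α := by
  have (X : Dᵒᵖ) : IsIso ((Functor.whiskerLeft coyoneda α).app X) := h X.unop
  have := NatIso.isIso_of_isIso_app (Functor.whiskerLeft coyoneda α)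
  refine ⟨cocontinuousExtend (inv (Functor.whiskerLeft coyoneda α)), ?_, ?_⟩ <;>
  · refine natTrans_ext_of_coyoneda fun t => ?_
    rw [NatTrans.comp_app, cocontinuousExtend_app]
    simp

end

end Cocontinuous

/-! ### Tensor products of functors as cocontinuous functors -/

section Boxtimes

variable {D : Type u} [Category.{u} D] {A : Type v} [Category.{u} A] [HasColimitsOfSize.{u, u} A]

/-- The canonical map from the copy of `x(t)` indexed by `a ∈ y(t)` to `x ⊠ y`, where `x ⊠ y` is
the value of the bifunctor `boxtimes`. -/
def boxι (x : Dᵒᵖ ⥤ A) (y : D ⥤ Type u) (t : D) (a : y.obj t) :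
    x.obj (op t) ⟶ (boxtimes.obj x).obj y :=
  boxtimesι x y t a

/-- The map out of `x ⊠ y` given by a compatible family of maps. -/
def boxDesc (x : Dᵒᵖ ⥤ A) (y : D ⥤ Type u) {z : A}
    (k : ∀ d, y.obj d → (x.obj (op d) ⟶ z))
    (hk : ∀ ⦃d d' : D⦄ (f : d ⟶ d') (a : y.obj d), x.map f.op ≫ k d a = k d' (y.map f a)) :
    (boxtimes.obj x).obj y ⟶ z :=
  boxtimesDesc x y k hk

theorem box_hom_ext {x : Dᵒᵖ ⥤ A} {y : D ⥤ Type u} {z : A} {f g : (boxtimes.obj x).obj y ⟶ z}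
    (h : ∀ d a, boxι x y d a ≫ f = boxι x y d a ≫ g) : f = g :=
  boxtimes_hom_ext h

@[simp]
theorem boxι_desc (x : Dᵒᵖ ⥤ A) (y : D ⥤ Type u) {z : A}
    (k : ∀ d, y.obj d → (x.obj (op d) ⟶ z))
    (hk : ∀ ⦃d d' : D⦄ (f : d ⟶ d') (a : y.obj d), x.map f.op ≫ k d a = k d' (y.map f a))
    (d : D) (a : y.obj d) : boxι x y d a ≫ boxDesc x y k hk = k d a :=
  boxtimesι_desc x y k hk d a

@[simp]
theorem boxι_desc_assoc (x : Dᵒᵖ ⥤ A) (y : D ⥤ Type u) {z : A}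
    (k : ∀ d, y.obj d → (x.obj (op d) ⟶ z))
    (hk : ∀ ⦃d d' : D⦄ (f : d ⟶ d') (a : y.obj d), x.map f.op ≫ k d a = k d' (y.map f a))
    (d : D) (a : y.obj d) {z' : A} (m : z ⟶ z') :
    boxι x y d a ≫ boxDesc x y k hk ≫ m = k d a ≫ m := by
  rw [← Category.assoc, boxι_desc]

theorem boxι_condition (x : Dᵒᵖ ⥤ A) (y : D ⥤ Type u) {d d' : D} (f : d ⟶ d') (a : y.obj d) :
    x.map f.op ≫ boxι x y d a = boxι x y d' (y.map f a) :=
  boxtimesι_condition x y f a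

theorem boxι_condition_assoc (x : Dᵒᵖ ⥤ A) (y : D ⥤ Type u) {d d' : D} (f : d ⟶ d')
    (a : y.obj d) {z : A} (m : (boxtimes.obj x).obj y ⟶ z) :
    x.map f.op ≫ boxι x y d a ≫ m = boxι x y d' (y.map f a) ≫ m := by
  rw [← Category.assoc, boxι_condition]

theorem boxι_map (x : Dᵒᵖ ⥤ A) {y y' : D ⥤ Type u} (β : y ⟶ y') (d : D) (a : y.obj d) :
    boxι x y d a ≫ (boxtimes.obj x).map β = boxι x y' d (β.app d a) :=
  boxtimesι_map x β d a

theorem boxι_map_assoc (x : Dᵒᵖ ⥤ A) {y y' : D ⥤ Type u} (β : y ⟶ y') (d : D) (a : y.obj d)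
    {z : A} (m : (boxtimes.obj x).obj y' ⟶ z) :
    boxι x y d a ≫ (boxtimes.obj x).map β ≫ m = boxι x y' d (β.app d a) ≫ m := by
  rw [← Category.assoc, boxι_map]

theorem boxι_map_app {x x' : Dᵒᵖ ⥤ A} (α : x ⟶ x') (y : D ⥤ Type u) (d : D) (a : y.obj d) :
    boxι x y d a ≫ (boxtimes.map α).app y = α.app (op d) ≫ boxι x' y d a :=
  boxtimesι_map_app α y d a

theorem boxι_map_app_assoc {x x' : Dᵒᵖ ⥤ A} (α : x ⟶ x') (y : D ⥤ Type u) (d : D) (a : y.obj d)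
    {z : A} (m : (boxtimes.obj x').obj y ⟶ z) :
    boxι x y d a ≫ (boxtimes.map α).app y ≫ m = α.app (op d) ≫ boxι x' y d a ≫ m := by
  rw [← Category.assoc, boxι_map_app, Category.assoc]

/-- The functor `y ↦ x ⊠ y` is left adjoint to `z ↦ Hom(x -, z)`. -/
def boxtimesAdjunction (x : Dᵒᵖ ⥤ A) : boxtimes.obj x ⊣ (x.rightOp ⋙ coyoneda).flip :=
  Adjunction.mkOfHomEquiv
    { homEquiv := fun y z =>
        { toFun := fun f =>
            { app := fun d => TypeCat.ofHom fun a => boxι x y d a ≫ f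
              naturality := fun d d' g => by
                ext a
                exact (boxι_condition_assoc x y g a f).symm }
          invFun := fun β => boxDesc x y (fun d a => β.app d a) fun d d' g a =>
            (NatTrans.naturality_apply β g a).symm
          left_inv := fun f => box_hom_ext fun d a => by
            rw [boxι_desc]
            rfl
          right_inv := fun β => by
            ext d a
            exact boxι_desc _ _ _ _ _ _ }
      homEquiv_naturality_left_symm := fun {y y' z} β γ => box_hom_ext fun d a => by
        dsimp only [Equiv.coe_fn_symm_mk]
        rw [boxι_desc, boxι_map_assoc, boxι_desc]
        rfl
      homEquiv_naturality_right := fun f g => by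
        ext d a
        exact (Category.assoc _ _ _).symm }

instance (x : Dᵒᵖ ⥤ A) : PreservesColimitsOfSize.{u, u} (boxtimes.obj x) :=
  (boxtimesAdjunction x).leftAdjoint_preservesColimits

/-- The isomorphism `x(t) ≅ x ⊠ Hom(t, -)`. -/
@[simps]
def boxtimesCoyonedaIso (x : Dᵒᵖ ⥤ A) (t : D) :
    x.obj (op t) ≅ (boxtimes.obj x).obj (coyoneda.obj (op t)) where
  hom := boxι x (coyoneda.obj (op t)) t (𝟙 t)
  inv := boxDesc x (coyoneda.obj (op t)) (fun d (a : t ⟶ d) => x.map a.op) fun d d' f a =>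
    (x.map_comp f.op (Quiver.Hom.op (show t ⟶ d from a))).symm
  hom_inv_id := by
    rw [boxι_desc, op_id, x.map_id]
  inv_hom_id := box_hom_ext fun d (a : t ⟶ d) => by
    rw [boxι_desc_assoc, boxι_condition, Category.comp_id]
    congr 1
    exact Category.id_comp a

/-- The restriction of `x ⊠ -` to the representable functors is `x`. -/
def coyonedaBoxtimesIso (x : Dᵒᵖ ⥤ A) : x ≅ coyoneda ⋙ boxtimes.obj x :=
  NatIso.ofComponents (fun t => boxtimesCoyonedaIso x t.unop) fun {t t'} f => by
    dsimp only [boxtimesCoyonedaIso_hom, Functor.comp_map]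
    refine Eq.trans ?_ (boxι_map x (coyoneda.map f) t.unop (𝟙 t.unop)).symm
    refine (boxι_condition x (coyoneda.obj (op t'.unop)) f.unop (𝟙 t'.unop)).trans ?_
    congr 1
    simp

/-- The canonical map from `F|_D ⊠ -` to `F`. -/
def boxtimesComparison (F : (D ⥤ Type u) ⥤ A) : boxtimes.obj (coyoneda ⋙ F) ⟶ F where
  app S := boxDesc _ _ (fun _ a => F.map (el a)) (map_coyoneda_map_el F (S := S))
  naturality S S' α := box_hom_ext fun t a => by
    rw [boxι_desc_assoc, ← F.map_comp, el_comp, boxι_map_assoc, boxι_desc]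

theorem boxι_comparison (F : (D ⥤ Type u) ⥤ A) (S : D ⥤ Type u) (t : D) (a : S.obj t) :
    boxι (coyoneda ⋙ F) S t a ≫ (boxtimesComparison F).app S = F.map (el a) :=
  boxι_desc (coyoneda ⋙ F) S (fun _ a => F.map (el a)) (map_coyoneda_map_el F (S := S)) t a

/-- A cocontinuous functor `F` is determined by its restriction to the representable functors. -/
instance (F : (D ⥤ Type u) ⥤ A) [PreservesColimitsOfSize.{u, u} F] :
    IsIso (boxtimesComparison F) :=
  isIso_of_coyoneda _ fun t => by
    have h := boxι_comparison F (coyoneda.obj (op t)) t (𝟙 t)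
    rw [el_id, F.map_id, ← boxtimesCoyonedaIso_hom] at h
    erw [Iso.hom_comp_eq_id] at h
    rw [h]
    infer_instance

end Boxtimes

section Cofan

variable {C : Type v} [Category.{u} C] {I : Type*} {b b' : I → C} {w w' : C}
  {g : ∀ i, b i ⟶ w} {g' : ∀ i, b' i ⟶ w'}

theorem nonempty_isColimit_cofan_of_iso (hg : IsColimit (Cofan.mk w g)) (k : ∀ i, b' i ≅ b i)
    (p : w ≅ w') (h : ∀ i, (k i).hom ≫ g i ≫ p.hom = g' i) :
    Nonempty (IsColimit (Cofan.mk w' g')) := by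
  refine ⟨Cofan.IsColimit.mk _
    (fun s => p.inv ≫ Cofan.IsColimit.desc hg fun i => (k i).inv ≫ s.inj i) (fun s i => ?_)
    fun s m hm => ?_⟩
  · have := Cofan.IsColimit.fac hg (fun i => (k i).inv ≫ s.inj i) i
    simp only [cofan_mk_inj] at this ⊢
    rw [← h]
    simp [this]
  · rw [Iso.eq_inv_comp]
    refine Cofan.IsColimit.hom_ext hg _ _ fun i => ?_
    rw [Cofan.IsColimit.fac, Iso.eq_inv_comp, ← hm]
    simp [← h]

theorem isIso_of_isColimit_cofan {g' : ∀ i, b i ⟶ w'} (hg : IsColimit (Cofan.mk w g))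
    (hg' : IsColimit (Cofan.mk w' g')) (f : w ⟶ w') (h : ∀ i, g i ≫ f = g' i) : IsIso f := by
  have h' (i) : g' i ≫ Cofan.IsColimit.desc hg' g = g i := Cofan.IsColimit.fac hg' g i
  refine ⟨Cofan.IsColimit.desc hg' g, Cofan.IsColimit.hom_ext hg _ _ fun i => ?_,
    Cofan.IsColimit.hom_ext hg' _ _ fun i => ?_⟩
  · simp only [cofan_mk_inj]
    rw [reassoc_of% h, h']
    exact (Category.comp_id _).symm
  · simp only [cofan_mk_inj]
    rw [reassoc_of% h', h]
    exact (Category.comp_id _).symm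

end Cofan

/-! ### Cocontinuous functors that preserve finite products -/

section Cartesian

variable {C : Type v} [Category.{u} C] [CartesianMonoidalCategory C]

/-- A functor from left `G`-sets is cocontinuous and preserves finite products. -/
structure IsCocontinuousCartesian {G : Type u} [Category.{u} G] (F : (G ⥤ Type u) ⥤ C) :
    Prop where
  cocontinuous : PreservesColimitsOfSize.{u, u} F
  terminal : IsIso (toUnit (F.obj (𝟙_ _)))
  prod (S S' : G ⥤ Type u) : IsIso (CartesianMonoidalCategory.prodComparison F S S')

variable {G : Type u} [Groupoid.{u} G]

/-- For a groupoid `G`, the product of `Hom(t, -)` with a `G`-set `S` is the coproduct of copies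
of `Hom(t, -)` indexed by the elements of `S(t)`. -/
theorem nonempty_isColimit_coyoneda_tensor (t : G) (S : G ⥤ Type u) :
    Nonempty (IsColimit (Cofan.mk (coyoneda.obj (op t) ⊗ S)
      (fun a : S.obj t => lift (𝟙 (coyoneda.obj (op t))) (el a)))) := by
  rw [nonempty_isColimit_cofan_iff]
  intro d
  have hS (f : t ⟶ d) : Function.Bijective (S.map f) := (isIso_iff_bijective _).1 inferInstance
  constructor
  · rintro ⟨a, f : t ⟶ d⟩ ⟨a', f' : t ⟶ d⟩ e
    obtain rfl : f = f' := congrArg Prod.fst e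
    have e' : S.map f a = S.map f a' := congrArg Prod.snd e
    rw [(hS f).1 e']
  · rintro ⟨f : t ⟶ d, b⟩
    obtain ⟨a, rfl⟩ := (hS f).2 b
    exact ⟨⟨a, f⟩, rfl⟩

namespace IsCocontinuousCartesian

variable {F : (G ⥤ Type u) ⥤ C} (hF : IsCocontinuousCartesian F)
include hF

/-- `F(S)` is constant over `F(Hom(t, -))`, with fibre `S(t)`. -/
theorem nonempty_isColimit_tensor (t : G) (S : G ⥤ Type u) :
    Nonempty (IsColimit (Cofan.mk (F.obj (coyoneda.obj (op t)) ⊗ F.obj S)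
      (fun a : S.obj t => lift (𝟙 _) (F.map (el a))))) := by
  have := hF.cocontinuous
  have := hF.prod
  obtain ⟨h⟩ := nonempty_isColimit_coyoneda_tensor t S
  refine nonempty_isColimit_cofan_of_iso (isColimitCofanMkObjOfIsColimit F _ _ h)
    (fun _ => Iso.refl _) (asIso (CartesianMonoidalCategory.prodComparison F _ _)) fun a => ?_
  apply CartesianMonoidalCategory.hom_ext <;> simp [← F.map_comp]

variable [IsGoodCartesian C]

/-- Two different elements of `S(t)` give maps `F(Hom(t, -)) ⟶ F(S)` that agree nowhere. -/
theorem nonempty_isInitial_of_map_el_eq {t : G} {S : G ⥤ Type u} {a b : S.obj t} (hab : a ≠ b)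
    {z : C} (r : z ⟶ F.obj (coyoneda.obj (op t))) (h : r ≫ F.map (el a) = r ≫ F.map (el b)) :
    Nonempty (IsInitial z) := by
  obtain ⟨hc⟩ := hF.nonempty_isColimit_tensor t S
  refine IsGoodCartesian.good.nonempty_isInitial_of_ne hc hab r r ?_
  apply CartesianMonoidalCategory.hom_ext <;> simp [h]

/-- A map to `F(S)` that is defined over `F(Hom(t, -))` is locally given by elements of `S(t)`. -/
theorem exists_decomposition {t : G} {S : G ⥤ Type u} {z : C}
    (r : z ⟶ F.obj (coyoneda.obj (op t))) (m : z ⟶ F.obj S) :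
    ∃ (b : S.obj t → C) (g : ∀ a, b a ⟶ z), Nonempty (IsColimit (Cofan.mk z g)) ∧
      ∀ a, g a ≫ m = g a ≫ r ≫ F.map (el a) ∧
        ∀ {w : C} (k : w ⟶ z), k ≫ m = k ≫ r ≫ F.map (el a) → ∃! l : w ⟶ b a, l ≫ g a = k := by
  obtain ⟨hc⟩ := hF.nonempty_isColimit_tensor t S
  obtain ⟨b, g, f, hp, hb⟩ := IsGoodCartesian.good.stable _ hc (lift r m)
  refine ⟨b, g, hb, fun a => ?_⟩
  have h₁ : g a ≫ r = f a := by simpa using (hp a).w =≫ fst _ _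
  have h₂ : g a ≫ m = f a ≫ F.map (el a) := by simpa using (hp a).w =≫ snd _ _
  refine ⟨by rw [h₂, ← h₁, Category.assoc], fun {w} k hk => ?_⟩
  have hk' : k ≫ lift r m = (k ≫ r) ≫ (Cofan.mk (F.obj (coyoneda.obj (op t)) ⊗ F.obj S)
      (fun a : S.obj t => lift (𝟙 _) (F.map (el a)))).inj a := by
    apply CartesianMonoidalCategory.hom_ext <;> simp [hk]
  refine ⟨(hp a).lift k (k ≫ r) hk', (hp a).lift_fst _ _ _, fun l hl => (hp a).hom_ext ?_ ?_⟩
  · rw [hl, (hp a).lift_fst]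
  · rw [(hp a).lift_snd, ← h₁, ← hl, Category.assoc]

/-- The objects `F(Hom(t, -))` cover the terminal object. -/
theorem nonempty_isInitial_of_tensor {z : C}
    (h : ∀ t : G, Nonempty (IsInitial (z ⊗ F.obj (coyoneda.obj (op t))))) :
    Nonempty (IsInitial z) := by
  have := hF.cocontinuous
  have := hF.terminal
  obtain ⟨hi⟩ := nonempty_isInitial_of_coyoneda (F ⋙ tensorLeft z) h (𝟙_ _)
  exact ⟨hi.ofIso (whiskerLeftIso z (asIso (toUnit (F.obj (𝟙_ _)))) ≪≫ ρ_ z)⟩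

/-- `F` preserves equalizers: for maps `f, g : S ⟶ S'` of `G`-sets, a map to `F(S)` that
equalizes `F(f)` and `F(g)` factors uniquely through the value of `F` at the equalizer. The reason
is that the equalizer of `f` and `g` is a summand of `S`. -/
theorem existsUnique_lift {E S S' : G ⥤ Type u} (i : E ⟶ S) (f g : S ⟶ S')
    (w : i ≫ f = i ≫ g) (hi : ∀ t, Function.Injective (i.app t))
    (he : ∀ t (s : S.obj t), f.app t s = g.app t s → ∃ e, i.app t e = s) {z : C}
    (m : z ⟶ F.obj S) (hm : m ≫ F.map f = m ≫ F.map g) : ∃! l, l ≫ F.map i = m := by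
  have := hF.cocontinuous
  -- The complement of the equalizer is a subfunctor, because `G` is a groupoid.
  let D : G ⥤ Type u :=
    { obj := fun t => { s : S.obj t // f.app t s ≠ g.app t s }
      map := fun {t t'} k => TypeCat.ofHom fun s => ⟨S.map k s.1, fun h => s.2 (by
        rw [NatTrans.naturality_apply, NatTrans.naturality_apply] at h
        exact ((isIso_iff_bijective (S'.map k)).1 inferInstance).1 h)⟩ }
  let j : D ⟶ S := { app := fun t => TypeCat.ofHom Subtype.val }
  let a : ULift.{u} Bool → (G ⥤ Type u) := fun b => bif b.down then E else D
  let k : ∀ b, a b ⟶ S := fun b => match b with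
    | ⟨true⟩ => i
    | ⟨false⟩ => j
  have hk : Nonempty (IsColimit (Cofan.mk S k)) := by
    rw [nonempty_isColimit_cofan_iff]
    intro t
    have hw (e : E.obj t) : f.app t (i.app t e) = g.app t (i.app t e) := congr(($w).app t e)
    constructor
    · rintro ⟨⟨_ | _⟩, x⟩ ⟨⟨_ | _⟩, y⟩ h
      · obtain rfl : x = y := Subtype.ext h
        rfl
      · have h' : j.app t x = i.app t y := h
        exact (x.2 (show f.app t (j.app t x) = g.app t (j.app t x) by rw [h', hw])).elim
      · have h' : i.app t x = j.app t y := h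
        exact (y.2 (show f.app t (j.app t y) = g.app t (j.app t y) by rw [← h', hw])).elim
      · obtain rfl : x = y := hi t h
        rfl
    · intro s
      by_cases hs : f.app t s = g.app t s
      · obtain ⟨e, he⟩ := he t s hs
        exact ⟨⟨⟨true⟩, e⟩, he⟩
      · exact ⟨⟨⟨false⟩, ⟨s, hs⟩⟩, rfl⟩
  have hFk := isColimitCofanMkObjOfIsColimit F _ _ hk.some
  have hmono : Mono (F.map i) := IsGoodCartesian.good.mono_inj _ hFk ⟨true⟩
  obtain ⟨b, p, q, hp, ⟨hb⟩⟩ := IsGoodCartesian.good.stable _ hFk m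
  -- The part of `z` that lies over the complement is initial, because `f` and `g` have different
  -- values on every element of the complement; so `z` lies over `E`.
  have hD : Nonempty (IsInitial (b ⟨false⟩)) := by
    refine hF.nonempty_isInitial_of_tensor fun t => ?_
    obtain ⟨c, r, ⟨hc⟩, hr⟩ := hF.exists_decomposition
      (snd (b ⟨false⟩) (F.obj (coyoneda.obj (op t)))) (fst _ _ ≫ q ⟨false⟩)
    refine nonempty_isInitial_of_cofan hc fun d => ?_
    refine hF.nonempty_isInitial_of_map_el_eq d.2 (r d ≫ snd _ _) ?_
    have h₁ : q ⟨false⟩ ≫ F.map j = p ⟨false⟩ ≫ m := (hp ⟨false⟩).w.symm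
    have h₂ := (hr d).1
    have hj (v : S ⟶ S') : (r d ≫ snd _ _) ≫ F.map (el (v.app t d.1)) =
        r d ≫ fst _ _ ≫ p ⟨false⟩ ≫ m ≫ F.map v := by
      have h₃ : el (v.app t d.1) = el d ≫ j ≫ v := by
        rw [el_comp]
        rfl
      have h₄ := h₂ =≫ (F.map j ≫ F.map v)
      simp only [Category.assoc] at h₄
      rw [reassoc_of% h₁] at h₄
      rw [h₃, F.map_comp, F.map_comp, Category.assoc]
      exact h₄.symm
    rw [hj, hj, hm]
  have hsplit : Nonempty (IsColimit (Cofan.mk z (fun _ : Unit => p ⟨true⟩))) := by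
    refine nonempty_isColimit_cofan_of_isInitial hb (e := fun _ => ⟨true⟩)
      (Function.injective_of_subsingleton _) (fun _ => Iso.refl _)
      (fun _ => Category.id_comp _) ?_
    rintro ⟨_ | _⟩ h
    · exact hD
    · exact (h ⟨⟨⟩, rfl⟩).elim
  let s : z ⟶ b ⟨true⟩ := Cofan.IsColimit.desc hsplit.some fun _ => 𝟙 _
  have hs : p ⟨true⟩ ≫ s = 𝟙 _ := Cofan.IsColimit.fac hsplit.some _ ⟨⟩
  refine ⟨s ≫ q ⟨true⟩, ?_, fun l hl => ?_⟩
  · refine Cofan.IsColimit.hom_ext hsplit.some _ _ fun _ => ?_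
    have h₁ : q ⟨true⟩ ≫ F.map i = p ⟨true⟩ ≫ m := (hp ⟨true⟩).w.symm
    have h₂ : p ⟨true⟩ ≫ (s ≫ q ⟨true⟩) ≫ F.map i = p ⟨true⟩ ≫ m := by
      rw [Category.assoc, reassoc_of% hs, h₁]
    exact h₂
  · have h₁ : q ⟨true⟩ ≫ F.map i = p ⟨true⟩ ≫ m := (hp ⟨true⟩).w.symm
    refine Cofan.IsColimit.hom_ext hsplit.some _ _ fun _ => ?_
    have h₂ : p ⟨true⟩ ≫ l = p ⟨true⟩ ≫ s ≫ q ⟨true⟩ := by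
      rw [reassoc_of% hs]
      refine hmono.right_cancellation _ _ ?_
      rw [Category.assoc, hl]
      exact h₁.symm
    exact h₂

end IsCocontinuousCartesian

end Cartesian

/-! ### Torsors as functors on left `G`-sets -/

section Principal

variable {C : Type v} [Category.{u} C] [CartesianMonoidalCategory C] [IsGoodCartesian C]
variable {G : Type u} [Groupoid.{u} G]

/-- The torsor condition for a right `G`-representation in a good cartesian category, with the
maps `∐_{g : s ⟶ t} x(t) ⟶ x(t) ⊗ x(s)` invertible for all `t` and `s`, also for those in
different connected components. -/
structure IsPrincipal (x : Gᵒᵖ ⥤ C) : Prop where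
  principal (t s : G) : Nonempty (IsColimit (Cofan.mk (x.obj (op t) ⊗ x.obj (op s))
    (fun g : s ⟶ t => lift (𝟙 (x.obj (op t))) (x.map g.op))))
  terminal : IsIso (toUnit ((boxtimes.obj x).obj (𝟙_ (G ⥤ Type u))))

omit [IsGoodCartesian C] in
theorem nonempty_isColimit_cofan_of_natIso {x x' : Gᵒᵖ ⥤ C} (e : x ≅ x') {t s : G}
    (h : IsColimit (Cofan.mk (x.obj (op t) ⊗ x.obj (op s))
      (fun g : s ⟶ t => lift (𝟙 (x.obj (op t))) (x.map g.op)))) :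
    Nonempty (IsColimit (Cofan.mk (x'.obj (op t) ⊗ x'.obj (op s))
      (fun g : s ⟶ t => lift (𝟙 (x'.obj (op t))) (x'.map g.op)))) :=
  nonempty_isColimit_cofan_of_iso h (fun _ => (e.app (op t)).symm)
    (e.app (op t) ⊗ᵢ e.app (op s)) fun g => by
      apply CartesianMonoidalCategory.hom_ext <;> simp

/-- A cocontinuous functor preserves binary products if it preserves binary products of
representable functors. -/
theorem isIso_prodComparison {F : (G ⥤ Type u) ⥤ C} (hF : PreservesColimitsOfSize.{u, u} F)
    (h : ∀ t s : G, Nonempty (IsColimit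
      (Cofan.mk (F.obj (coyoneda.obj (op t)) ⊗ F.obj (coyoneda.obj (op s)))
        (fun g : s ⟶ t => lift (𝟙 _) (F.map (coyoneda.map g.op)))))) (S S' : G ⥤ Type u) :
    IsIso (CartesianMonoidalCategory.prodComparison F S S') := by
  have h₀ (t s : G) : IsIso (CartesianMonoidalCategory.prodComparison F
      (coyoneda.obj (op t)) (coyoneda.obj (op s))) := by
    obtain ⟨h₁⟩ := nonempty_isColimit_coyoneda_tensor t (coyoneda.obj (op s))
    obtain ⟨h₂⟩ := h t s
    refine isIso_of_isColimit_cofan (isColimitCofanMkObjOfIsColimit F _ _ h₁) h₂ _ fun g => ?_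
    have : el (S := coyoneda.obj (op s)) g = coyoneda.map (Quiver.Hom.op (show s ⟶ t from g)) :=
      el_coyoneda g
    rw [← this]
    apply CartesianMonoidalCategory.hom_ext <;> simp [← Functor.map_comp]
  let α (S : G ⥤ Type u) : tensorLeft S ⋙ F ⟶ F ⋙ tensorLeft (F.obj S) :=
    { app := fun S' => CartesianMonoidalCategory.prodComparison F S S'
      naturality := fun _ _ f => CartesianMonoidalCategory.prodComparison_natural_whiskerLeft F f }
  let β (S' : G ⥤ Type u) : tensorRight S' ⋙ F ⟶ F ⋙ tensorRight (F.obj S') :=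
    { app := fun S => CartesianMonoidalCategory.prodComparison F S S'
      naturality := fun _ _ f => CartesianMonoidalCategory.prodComparison_natural_whiskerRight F f }
  have h₁ (t : G) : IsIso (α (coyoneda.obj (op t))) := isIso_of_coyoneda _ fun s => h₀ t s
  have h₂ : IsIso (β S') := isIso_of_coyoneda _ fun t =>
    NatIso.isIso_app_of_isIso (α (coyoneda.obj (op t))) S'
  exact NatIso.isIso_app_of_isIso (β S') S

/-- A torsor `x` gives the functor `x ⊠ -`. -/
theorem IsPrincipal.isCocontinuousCartesian {x : Gᵒᵖ ⥤ C} (hx : IsPrincipal x) :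
    IsCocontinuousCartesian (boxtimes.obj x) where
  cocontinuous := inferInstance
  terminal := hx.terminal
  prod := isIso_prodComparison inferInstance fun t s =>
    nonempty_isColimit_cofan_of_natIso (coyonedaBoxtimesIso x) (hx.principal t s).some

/-- A cocontinuous functor that preserves finite products restricts to a torsor on the
representable functors. -/
theorem IsCocontinuousCartesian.isPrincipal {F : (G ⥤ Type u) ⥤ C}
    (hF : IsCocontinuousCartesian F) : IsPrincipal (coyoneda ⋙ F) where
  principal t s := by
    obtain ⟨h⟩ := hF.nonempty_isColimit_tensor t (coyoneda.obj (op s))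
    refine nonempty_isColimit_cofan_of_iso h (fun _ => Iso.refl _) (Iso.refl _) fun g => ?_
    have : el (S := coyoneda.obj (op s)) g = coyoneda.map g.op := el_coyoneda g
    rw [this]
    simp
  terminal := by
    have := hF.terminal
    have := hF.cocontinuous
    rw [toUnit_unique (toUnit _) ((boxtimesComparison F).app (𝟙_ _) ≫ toUnit _)]
    infer_instance

end Principal

/-! ### The locus where a transformation is given by an arrow -/

section Locus

variable {G H : Type u} [Groupoid.{u} G] [Groupoid.{u} H]

/-- Restriction of left `H`-sets along `φ : G ⥤ H`. -/
abbrev res (φ : G ⥤ H) : (H ⥤ Type u) ⥤ (G ⥤ Type u) :=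
  (Functor.whiskeringLeft G H (Type u)).obj φ

variable {C : Type v} [Category.{u} C] [CartesianMonoidalCategory C] [IsGoodCartesian C]
variable {φ ψ : G ⥤ H} {F : (G ⥤ Type u) ⥤ C} (q : res φ ⋙ F ⟶ res ψ ⋙ F)

/-- For `q : φ^* ⋙ F ⟶ ψ^* ⋙ F` and `h : φ(t) ⟶ ψ(t)`: on `r : z ⟶ F(Hom(t, -))` the
transformation `q` is given by the action of `h`. -/
def IsAt {t : G} (h : φ.obj t ⟶ ψ.obj t) {z : C} (r : z ⟶ F.obj (coyoneda.obj (op t))) : Prop :=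
  ∀ (S : H ⥤ Type u) (a : S.obj (φ.obj t)),
    r ≫ F.map (el (S := φ ⋙ S) a) ≫ q.app S = r ≫ F.map (el (S := ψ ⋙ S) (S.map h a))

/-- The value of `q` on the universal element of an `H`-set over `φ(t)`. -/
def universalValue (t : G) : F.obj (coyoneda.obj (op t)) ⟶
    F.obj (ψ ⋙ coyoneda.obj (op (φ.obj t))) :=
  F.map (el (S := φ ⋙ coyoneda.obj (op (φ.obj t))) (𝟙 (φ.obj t))) ≫
    q.app (coyoneda.obj (op (φ.obj t)))

variable {q}

omit [CartesianMonoidalCategory C] [IsGoodCartesian C] in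
/-- By the Yoneda lemma, it suffices to test `IsAt` on the universal element. -/
theorem isAt_iff {t : G} {h : φ.obj t ⟶ ψ.obj t} {z : C} {r : z ⟶ F.obj (coyoneda.obj (op t))} :
    IsAt q h r ↔ r ≫ universalValue q t =
      r ≫ F.map (el (S := ψ ⋙ coyoneda.obj (op (φ.obj t))) h) := by
  constructor
  · intro hr
    have := hr (coyoneda.obj (op (φ.obj t))) (𝟙 (φ.obj t))
    rw [universalValue, this]
    congr 3
    exact Category.id_comp h
  · intro hr S a
    have h₁ : el (S := φ ⋙ S) a = el (S := φ ⋙ coyoneda.obj (op (φ.obj t))) (𝟙 (φ.obj t)) ≫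
        (res φ).map (el a) := by
      rw [el_comp]
      congr 1
      exact (el_app_id a).symm
    have h₂ : el (S := ψ ⋙ S) (S.map h a) = el (S := ψ ⋙ coyoneda.obj (op (φ.obj t))) h ≫
        (res ψ).map (el a) := by
      rw [el_comp]
      rfl
    have h₃ := q.naturality (el a)
    dsimp only [Functor.comp_map] at h₃
    rw [h₁, h₂, F.map_comp, F.map_comp, Category.assoc]
    erw [h₃]
    rw [universalValue] at hr
    have h₄ := hr =≫ F.map ((res ψ).map (el a))
    simp only [Category.assoc] at h₄
    exact h₄

omit [CartesianMonoidalCategory C] [IsGoodCartesian C] in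
theorem IsAt.comp {t : G} {h : φ.obj t ⟶ ψ.obj t} {z z' : C}
    {r : z ⟶ F.obj (coyoneda.obj (op t))} (hr : IsAt q h r) (k : z' ⟶ z) : IsAt q h (k ≫ r) :=
  fun S a => by rw [Category.assoc, Category.assoc, hr S a]

omit [CartesianMonoidalCategory C] [IsGoodCartesian C] in
theorem IsAt.map {t t' : G} {g : t ⟶ t'} {h : φ.obj t ⟶ ψ.obj t} {h' : φ.obj t' ⟶ ψ.obj t'}
    (hg : φ.map g ≫ h' = h ≫ ψ.map g) {z : C} {r : z ⟶ F.obj (coyoneda.obj (op t'))}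
    (hr : IsAt q h' r) : IsAt q h (r ≫ F.map (coyoneda.map g.op)) := fun S a => by
  have h₁ := map_coyoneda_map_el F (S := φ ⋙ S) g a
  have h₂ := map_coyoneda_map_el F (S := ψ ⋙ S) g (S.map h a)
  rw [Category.assoc, reassoc_of% h₁, Category.assoc, h₂]
  refine (hr S (S.map (φ.map g) a)).trans ?_
  congr 3
  have := congr(S.map $hg a)
  simpa using this

/-- The transformation `q` is nowhere given by the action of two different arrows. -/
theorem IsAt.nonempty_isInitial (hF : IsCocontinuousCartesian F) {t : G}
    {h h' : φ.obj t ⟶ ψ.obj t} (hne : h ≠ h') {z : C} {r : z ⟶ F.obj (coyoneda.obj (op t))}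
    (hr : IsAt q h r) (hr' : IsAt q h' r) : Nonempty (IsInitial z) :=
  hF.nonempty_isInitial_of_map_el_eq (S := ψ ⋙ coyoneda.obj (op (φ.obj t))) hne r
    ((isAt_iff.1 hr).symm.trans (isAt_iff.1 hr'))

section

variable (q)

/-- The decomposition of `F(Hom(t, -))` by the values of `q` on the universal element. -/
theorem exists_locus (hF : IsCocontinuousCartesian F) (t : G) : ∃ (b : (φ.obj t ⟶ ψ.obj t) → C)
    (g : ∀ h, b h ⟶ F.obj (coyoneda.obj (op t))), Nonempty (IsColimit (Cofan.mk _ g)) ∧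
      ∀ h, IsAt q h (g h) ∧ ∀ {w : C} (k : w ⟶ F.obj (coyoneda.obj (op t))),
        IsAt q h k → ∃! l : w ⟶ b h, l ≫ g h = k := by
  obtain ⟨b, g, hg, hb⟩ := hF.exists_decomposition
    (S := ψ ⋙ coyoneda.obj (op (φ.obj t))) (𝟙 _) (universalValue q t)
  refine ⟨b, g, hg, fun h => ⟨isAt_iff.2 (by simpa using (hb h).1), fun {w} k hk => ?_⟩⟩
  exact (hb h).2 k (by simpa using isAt_iff.1 hk)

variable (hF : IsCocontinuousCartesian F) (t : G) (h : φ.obj t ⟶ ψ.obj t)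

/-- The part of `F(Hom(t, -))` where `q` is given by the action of `h`. -/
def locus : C := (exists_locus q hF t).choose h

/-- The inclusion of the part of `F(Hom(t, -))` where `q` is given by the action of `h`. -/
def locusι : locus q hF t h ⟶ F.obj (coyoneda.obj (op t)) :=
  (exists_locus q hF t).choose_spec.choose h

/-- `F(Hom(t, -))` is the disjoint union of the parts where `q` is given by an arrow. -/
theorem nonempty_isColimit_locus : Nonempty (IsColimit (Cofan.mk _ (locusι q hF t))) :=
  (exists_locus q hF t).choose_spec.choose_spec.1

theorem isAt_locusι : IsAt q h (locusι q hF t h) :=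
  ((exists_locus q hF t).choose_spec.choose_spec.2 h).1

variable {h} in
theorem existsUnique_locus_lift {z : C} {r : z ⟶ F.obj (coyoneda.obj (op t))} (hr : IsAt q h r) :
    ∃! l, l ≫ locusι q hF t h = r :=
  ((exists_locus q hF t).choose_spec.choose_spec.2 h).2 r hr

instance : Mono (locusι q hF t h) where
  right_cancellation _ l' e :=
    (existsUnique_locus_lift q hF t ((isAt_locusι q hF t h).comp l')).unique e rfl

variable {h t}

/-- The factorization of a map through the part where `q` is given by the action of `h`. -/
def locusLift {z : C} (r : z ⟶ F.obj (coyoneda.obj (op t))) (hr : IsAt q h r) :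
    z ⟶ locus q hF t h :=
  (existsUnique_locus_lift q hF t hr).choose

@[simp]
theorem locusLift_ι {z : C} (r : z ⟶ F.obj (coyoneda.obj (op t))) (hr : IsAt q h r) :
    locusLift q hF r hr ≫ locusι q hF t h = r :=
  (existsUnique_locus_lift q hF t hr).choose_spec.1

@[simp]
theorem locusLift_ι_assoc {z : C} (r : z ⟶ F.obj (coyoneda.obj (op t))) (hr : IsAt q h r) {w : C}
    (m : F.obj (coyoneda.obj (op t)) ⟶ w) :
    locusLift q hF r hr ≫ locusι q hF t h ≫ m = r ≫ m := by
  rw [← Category.assoc, locusLift_ι]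

end

end Locus

/-! ### Descent to the equalizer -/

section Descent

variable {K G H : Type u} [Groupoid.{u} K] [Groupoid.{u} G] [Groupoid.{u} H]
variable {ξ : K ⥤ G} {φ ψ : G ⥤ H} {p : ξ ⋙ φ ≅ ξ ⋙ ψ}

variable (ξ φ ψ p) in
/-- The equalizer of groupoids `K` is equivalent to the groupoid of pairs of an object `t` of `G`
and an arrow `h : φ(t) ⟶ ψ(t)`. -/
structure IsConcreteEqualizer : Prop where
  faithful {k l : K} {f g : k ⟶ l} (h : ξ.map f = ξ.map g) : f = g
  full {k l : K} (u : ξ.obj k ⟶ ξ.obj l)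
    (h : φ.map u ≫ p.hom.app l = p.hom.app k ≫ ψ.map u) : ∃ f, ξ.map f = u
  essSurj (t : G) (h : φ.obj t ⟶ ψ.obj t) :
    ∃ (k : K) (u : t ⟶ ξ.obj k), φ.map u ≫ p.hom.app k = h ≫ ψ.map u

/-- The universal property of the equalizer, tested on the one-point groupoid. -/
theorem IsGroupoidEqualizer.isConcreteEqualizer (hK : IsGroupoidEqualizer ξ φ ψ p) :
    IsConcreteEqualizer ξ φ ψ p := by
  have := hK (Discrete PUnit.{u + 1})
  set T := IsoInserter.lift (F := (Functor.whiskeringRight (Discrete PUnit.{u + 1}) G H).obj φ)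
      (G := (Functor.whiskeringRight (Discrete PUnit.{u + 1}) G H).obj ψ)
      ((Functor.whiskeringRight (Discrete PUnit.{u + 1}) K G).obj ξ)
      ((Functor.whiskeringRight (Discrete PUnit.{u + 1}) K H).mapIso p)
  let pt {B : Type u} [Category.{u} B] (b : B) : Discrete PUnit.{u + 1} ⥤ B := Functor.fromPUnit b
  let hom {B : Type u} [Category.{u} B] {b b' : B} (f : b ⟶ b') : pt b ⟶ pt b' :=
    { app := fun _ => f }
  refine ⟨fun {k l f g} h => ?_, fun {k l} u h => ?_, fun t h => ?_⟩
  · have e : T.map (hom f) = T.map (hom g) := by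
      ext x
      exact h
    exact congr(($(T.map_injective e)).app ⟨⟨⟩⟩)
  · obtain ⟨f, hf⟩ := T.map_surjective (X := pt k) (Y := pt l)
      ⟨show pt k ⋙ ξ ⟶ pt l ⋙ ξ from
        { app := fun _ => u
          naturality := fun _ _ _ =>
            ((congrArg (· ≫ u) (ξ.map_id k)).trans (Category.id_comp u)).trans
              ((congrArg (u ≫ ·) (ξ.map_id l)).trans (Category.comp_id u)).symm }, by
        ext
        exact h⟩
    exact ⟨f.app ⟨⟨⟩⟩, congr(($hf).base.app ⟨⟨⟩⟩)⟩
  · let X : IsoInserter ((Functor.whiskeringRight (Discrete PUnit.{u + 1}) G H).obj φ)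
        ((Functor.whiskeringRight (Discrete PUnit.{u + 1}) G H).obj ψ) :=
      { base := pt t
        iso := NatIso.ofComponents fun _ => Groupoid.isoEquivHom _ _ |>.symm h }
    let e := T.objObjPreimageIso X
    refine ⟨(T.objPreimage X).obj ⟨⟨⟩⟩, e.inv.base.app ⟨⟨⟩⟩, ?_⟩
    exact congr(($(e.inv.comm)).app ⟨⟨⟩⟩)

variable {C : Type v} [Category.{u} C] [CartesianMonoidalCategory C] [IsGoodCartesian C]
variable {F : (G ⥤ Type u) ⥤ C} (q : res φ ⋙ F ⟶ res ψ ⋙ F) (hF : IsCocontinuousCartesian F)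

variable (ξ p) in
/-- The right `K`-representation whose value at `k` is the part of `F(Hom(ξ(k), -))` where `q` is
given by the action of `p(k)`. -/
def descent : Kᵒᵖ ⥤ C where
  obj k := locus q hF (ξ.obj k.unop) (p.hom.app k.unop)
  map {k l} f := locusLift q hF (locusι q hF _ _ ≫ F.map (coyoneda.map (ξ.map f.unop).op))
    ((isAt_locusι q hF _ _).map (g := ξ.map f.unop) (p.hom.naturality f.unop))
  map_id k := by
    rw [← cancel_mono (locusι q hF _ _)]
    simp
  map_comp f g := by
    rw [← cancel_mono (locusι q hF _ _)]
    simp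

variable (ξ p) in
/-- The inclusion of `descent` into the restriction of `F`. -/
def descentι (k : K) : (descent ξ p q hF).obj (op k) ⟶ F.obj (coyoneda.obj (op (ξ.obj k))) :=
  locusι q hF (ξ.obj k) (p.hom.app k)

instance (k : K) : Mono (descentι ξ p q hF k) :=
  inferInstanceAs (Mono (locusι q hF (ξ.obj k) (p.hom.app k)))

theorem isAt_descentι (k : K) : IsAt q (p.hom.app k) (descentι ξ p q hF k) :=
  isAt_locusι q hF _ _

theorem descent_map_ι {k l : K} (f : k ⟶ l) :
    (descent ξ p q hF).map f.op ≫ descentι ξ p q hF k =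
      descentι ξ p q hF l ≫ F.map (coyoneda.map (ξ.map f).op) :=
  locusLift_ι q hF _ ((isAt_locusι q hF _ _).map (g := ξ.map f) (p.hom.naturality f))

theorem descent_map_ι_assoc {k l : K} (f : k ⟶ l) {z : C}
    (m : F.obj (coyoneda.obj (op (ξ.obj k))) ⟶ z) :
    (descent ξ p q hF).map f.op ≫ descentι ξ p q hF k ≫ m =
      descentι ξ p q hF l ≫ F.map (coyoneda.map (ξ.map f).op) ≫ m := by
  rw [← Category.assoc, descent_map_ι, Category.assoc]

/-- The factorization of a map through `descent`. -/
def descentLift {k : K} {z : C} (r : z ⟶ F.obj (coyoneda.obj (op (ξ.obj k))))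
    (hr : IsAt q (p.hom.app k) r) : z ⟶ (descent ξ p q hF).obj (op k) :=
  locusLift q hF r hr

@[simp]
theorem descentLift_ι {k : K} {z : C} (r : z ⟶ F.obj (coyoneda.obj (op (ξ.obj k))))
    (hr : IsAt q (p.hom.app k) r) : descentLift q hF r hr ≫ descentι ξ p q hF k = r :=
  locusLift_ι _ _ _ _

@[simp]
theorem descentLift_ι_assoc {k : K} {z : C} (r : z ⟶ F.obj (coyoneda.obj (op (ξ.obj k))))
    (hr : IsAt q (p.hom.app k) r) {w : C} (m : F.obj (coyoneda.obj (op (ξ.obj k))) ⟶ w) :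
    descentLift q hF r hr ≫ descentι ξ p q hF k ≫ m = r ≫ m :=
  locusLift_ι_assoc _ _ _ _ _

variable (ξ p) in
/-- The comparison of the functor on `G`-sets that is given by `descent` with `F`. -/
def descentComparison : res ξ ⋙ boxtimes.obj (descent ξ p q hF) ⟶ F where
  app S := boxDesc _ _ (fun k a => descentι ξ p q hF k ≫ F.map (el (S := S) a))
    fun _ _ f a => (descent_map_ι_assoc q hF f _).trans
      (_ ≫= map_coyoneda_map_el F (S := S) (ξ.map f) a)
  naturality S S' α := box_hom_ext fun k a => by
    refine (boxι_map_assoc _ ((res ξ).map α) k a _).trans ?_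
    refine (boxι_desc _ _ _ _ _ _).trans ?_
    refine Eq.trans ?_ (boxι_desc_assoc _ _ _ _ _ _ _).symm
    rw [Category.assoc, ← F.map_comp, el_comp]
    rfl

theorem boxι_descentComparison (S : G ⥤ Type u) (k : K) (a : S.obj (ξ.obj k)) :
    boxι (descent ξ p q hF) (ξ ⋙ S) k a ≫ (descentComparison ξ p q hF).app S =
      descentι ξ p q hF k ≫ F.map (el a) :=
  boxι_desc _ _ _ (fun _ _ f a => (descent_map_ι_assoc q hF f _).trans
      (_ ≫= map_coyoneda_map_el F (S := S) (ξ.map f) a)) _ _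

theorem boxι_descentComparison_assoc (S : G ⥤ Type u) (k : K) (a : S.obj (ξ.obj k)) {z : C}
    (m : F.obj S ⟶ z) :
    boxι (descent ξ p q hF) (ξ ⋙ S) k a ≫ (descentComparison ξ p q hF).app S ≫ m =
      descentι ξ p q hF k ≫ F.map (el a) ≫ m :=
  (Category.assoc _ _ _).symm.trans ((boxι_descentComparison q hF S k a =≫ m).trans
    (Category.assoc _ _ _))

section

variable {q} {t : G} {h : φ.obj t ⟶ ψ.obj t} {k : K} (u : t ⟶ ξ.obj k)
  (hu : φ.map u ≫ p.hom.app k = h ≫ ψ.map u)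
include hu

omit [IsGoodCartesian C] [CartesianMonoidalCategory C] in
theorem IsAt.map_inv {z : C} {r : z ⟶ F.obj (coyoneda.obj (op t))} (hr : IsAt q h r) :
    IsAt q (p.hom.app k) (r ≫ F.map (coyoneda.map (inv u).op)) := by
  refine hr.map (g := inv u) ?_
  rw [φ.map_inv, ψ.map_inv, IsIso.inv_comp_eq, ← Category.assoc, IsIso.eq_comp_inv]
  exact hu.symm

variable (q)

/-- The part of `F(Hom(t, -))` where `q` is given by the action of `h`, mapped into the functor
given by `descent` by means of an isomorphism of `(t, h)` with an object of `K`. -/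
def locusToDescent : locus q hF t h ⟶
    (boxtimes.obj (descent ξ p q hF)).obj (ξ ⋙ coyoneda.obj (op t)) :=
  descentLift q hF (locusι q hF t h ≫ F.map (coyoneda.map (inv u).op))
    ((isAt_locusι q hF t h).map_inv u hu) ≫
    boxι (descent ξ p q hF) (ξ ⋙ coyoneda.obj (op t)) k u

theorem locusToDescent_comparison :
    locusToDescent q hF u hu ≫ (descentComparison ξ p q hF).app (coyoneda.obj (op t)) =
      locusι q hF t h := by
  have h₁ := boxι_descentComparison q hF (p := p) (coyoneda.obj (op t)) k u
  rw [el_coyoneda] at h₁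
  refine (Category.assoc _ _ _).trans ((_ ≫= h₁).trans ?_)
  rw [descentLift_ι_assoc, Category.assoc, ← F.map_comp, ← coyoneda.map_comp, ← op_comp,
    IsIso.hom_inv_id]
  simp

/-- The map `locusToDescent` does not depend on the choice of the isomorphism of `(t, h)` with an
object of `K`. -/
theorem locusToDescent_eq (hE : IsConcreteEqualizer ξ φ ψ p) {k' : K} (u' : t ⟶ ξ.obj k')
    (hu' : φ.map u' ≫ p.hom.app k' = h ≫ ψ.map u') :
    locusToDescent q hF u hu = locusToDescent q hF u' hu' := by
  obtain ⟨f, hf⟩ := hE.full (inv u ≫ u') (by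
    rw [φ.map_comp, ψ.map_comp, Category.assoc, hu', φ.map_inv, ψ.map_inv, IsIso.inv_comp_eq,
      ← Category.assoc, ← Category.assoc, hu, Category.assoc, Category.assoc,
      IsIso.hom_inv_id_assoc])
  have h₁ := boxι_condition (descent ξ p q hF) (ξ ⋙ coyoneda.obj (op t)) f u
  have h₂ : (ξ ⋙ coyoneda.obj (op t)).map f u = u' := by
    change u ≫ ξ.map f = u'
    rw [hf, IsIso.hom_inv_id_assoc]
  rw [h₂] at h₁
  rw [locusToDescent, locusToDescent, ← h₁, ← Category.assoc]
  congr 1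
  rw [← cancel_mono (descentι ξ p q hF k), descentLift_ι, Category.assoc, descent_map_ι,
    descentLift_ι_assoc, Category.assoc, ← F.map_comp, ← coyoneda.map_comp, ← op_comp, hf,
    Category.assoc, IsIso.hom_inv_id, Category.comp_id]

end

/-- `F(Hom(t, -))` is the disjoint union of the parts where `q` is given by `h : φ(t) ⟶ ψ(t)`, and
each `(t, h)` is isomorphic to an object of `K`: so `F` is recovered from `descent`. -/
theorem isIso_descentComparison (hE : IsConcreteEqualizer ξ φ ψ p) :
    IsIso (descentComparison ξ p q hF) := by
  have := hF.cocontinuous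
  have : PreservesColimitsOfSize.{u, u} (res ξ ⋙ boxtimes.obj (descent ξ p q hF)) :=
    inferInstance
  refine isIso_of_coyoneda _ fun t => ?_
  obtain ⟨hc⟩ := nonempty_isColimit_locus q hF t
  choose k u hu using hE.essSurj t
  let n := Cofan.IsColimit.desc hc fun h => locusToDescent q hF (u h) (hu h)
  have hn (h : φ.obj t ⟶ ψ.obj t) :
      locusι q hF t h ≫ n = locusToDescent q hF (u h) (hu h) := Cofan.IsColimit.fac hc _ h
  refine ⟨n, ?_, ?_⟩
  · refine box_hom_ext fun l (v : t ⟶ ξ.obj l) => ?_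
    have h₁ := boxι_descentComparison_assoc q hF (p := p) (coyoneda.obj (op t)) l v n
    rw [el_coyoneda] at h₁
    refine h₁.trans (Eq.trans ?_ (Category.comp_id _).symm)
    let h : φ.obj t ⟶ ψ.obj t := φ.map v ≫ p.hom.app l ≫ inv (ψ.map v)
    have hv : φ.map v ≫ p.hom.app l = h ≫ ψ.map v := by simp [h]
    have h₂ : IsAt q h (descentι ξ p q hF l ≫ F.map (coyoneda.map v.op)) :=
      (isAt_descentι q hF _).map hv
    have h₃ := locusLift_ι_assoc q hF _ h₂ n
    rw [Category.assoc] at h₃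
    have h₄ : locusLift q hF _ h₂ ≫ descentLift q hF _ ((isAt_locusι q hF t h).map_inv v hv) =
        𝟙 _ := by
      rw [← cancel_mono (descentι ξ p q hF l)]
      rw [Category.assoc, descentLift_ι, locusLift_ι_assoc, Category.assoc, ← F.map_comp,
        ← coyoneda.map_comp, ← op_comp, IsIso.inv_hom_id]
      simp
    rw [← h₃, hn, locusToDescent_eq q hF (u h) (hu h) hE v hv, locusToDescent, ← Category.assoc,
      h₄, Category.id_comp]
    rfl
  · refine Cofan.IsColimit.hom_ext hc _ _ fun h => ?_
    simp only [cofan_mk_inj]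
    rw [reassoc_of% hn h, locusToDescent_comparison]
    exact (Category.comp_id _).symm

/-- Under the comparison of the functor given by `descent` with `F`, the map `q` corresponds to
the action of `p`. -/
theorem descentComparison_app_comp (S : H ⥤ Type u) :
    (descentComparison ξ p q hF).app (φ ⋙ S) ≫ q.app S =
      (boxtimes.obj (descent ξ p q hF)).map (Functor.whiskerRight p.hom S) ≫
        (descentComparison ξ p q hF).app (ψ ⋙ S) :=
  box_hom_ext fun k a => by
    refine (boxι_descentComparison_assoc q hF (φ ⋙ S) k a (q.app S)).trans ?_
    refine (isAt_descentι q hF k S a).trans ?_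
    refine Eq.trans ?_ (boxι_map_assoc (descent ξ p q hF) (Functor.whiskerRight p.hom S) k a _).symm
    exact (boxι_descentComparison q hF (ψ ⋙ S) k _).symm

end Descent

/-! ### Transformations of functors on the equalizer -/

section Descent

variable {K G H : Type u} [Groupoid.{u} K] [Groupoid.{u} G] [Groupoid.{u} H]
variable {ξ : K ⥤ G} {φ ψ : G ⥤ H} {p : ξ ⋙ φ ≅ ξ ⋙ ψ}
variable {C : Type v} [Category.{u} C] [CartesianMonoidalCategory C] [IsGoodCartesian C]

section

variable {F : (G ⥤ Type u) ⥤ C} (q : res φ ⋙ F ⟶ res ψ ⋙ F) (hF : IsCocontinuousCartesian F)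

/-- The product of two values of `descent` is a part of the coproduct of copies of `F(Hom(ξ k, -))`
over the arrows `g : ξ l ⟶ ξ k`. For `g` in the image of `K` this part is a value of `descent`, and
otherwise `q` is given on it by two different arrows, so it is initial. -/
theorem isPrincipal_descent (hE : IsConcreteEqualizer ξ φ ψ p) :
    IsPrincipal (descent ξ p q hF) where
  principal k l := by
    obtain ⟨hc⟩ := hF.nonempty_isColimit_tensor (ξ.obj k) (coyoneda.obj (op (ξ.obj l)))
    obtain ⟨b, r, f, hp, ⟨hb⟩⟩ := IsGoodCartesian.good.stable _ hc
      (descentι ξ p q hF k ⊗ₘ descentι ξ p q hF l)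
    have h₁ (g : ξ.obj l ⟶ ξ.obj k) : r g ≫ fst _ _ ≫ descentι ξ p q hF k = f g := by
      simpa using (hp g).w =≫ fst _ _
    have h₂ (g : ξ.obj l ⟶ ξ.obj k) :
        r g ≫ snd _ _ ≫ descentι ξ p q hF l = f g ≫ F.map (coyoneda.map g.op) := by
      rw [← el_coyoneda]
      simpa using (hp g).w =≫ snd _ _
    have hι (g : l ⟶ k) : lift (𝟙 _) ((descent ξ p q hF).map g.op) ≫
        (descentι ξ p q hF k ⊗ₘ descentι ξ p q hF l) = descentι ξ p q hF k ≫
        (Cofan.mk (F.obj (coyoneda.obj (op (ξ.obj k))) ⊗ F.obj (coyoneda.obj (op (ξ.obj l))))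
          (fun a => lift (𝟙 _) (F.map (el a)))).inj (ξ.map g) := by
      dsimp only [cofan_mk_inj]
      apply CartesianMonoidalCategory.hom_ext
      · simp
      · simp only [Category.assoc, tensorHom_snd, lift_snd_assoc, lift_snd]
        rw [el_coyoneda, descent_map_ι]
    refine nonempty_isColimit_cofan_of_isInitial hb (e := fun g : l ⟶ k => ξ.map g)
      (fun _ _ h => hE.faithful h) (fun g =>
        { hom := (hp _).lift _ _ (hι g)
          inv := r _ ≫ fst _ _
          hom_inv_id := by
            rw [← Category.assoc, (hp _).lift_fst, lift_fst]
          inv_hom_id := (hp _).hom_ext (by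
            rw [Category.assoc, (hp _).lift_fst, Category.id_comp]
            apply CartesianMonoidalCategory.hom_ext
            · simp
            · rw [← cancel_mono (descentι ξ p q hF l)]
              simp only [Category.assoc, lift_snd]
              rw [h₂, descent_map_ι, ← h₁]
              simp only [Category.assoc]) (by
            rw [Category.assoc, (hp _).lift_snd, Category.id_comp, Category.assoc, h₁]) })
      (fun g => (hp _).lift_fst _ _ _) ?_
    intro g hg
    -- On the part for `g`, the transformation `q` at `ξ l` is given by `h` and by `p`; these differ if
    -- `g` is not in the image of `K`.
    let h : φ.obj (ξ.obj l) ⟶ ψ.obj (ξ.obj l) := φ.map g ≫ p.hom.app k ≫ inv (ψ.map g)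
    have hh : φ.map g ≫ p.hom.app k = h ≫ ψ.map g := by simp [h]
    have hne : h ≠ p.hom.app l := fun e => hg (hE.full g (by rw [hh, e]))
    have h₃ : IsAt q (p.hom.app k) (f g) := by
      rw [← h₁, ← Category.assoc]
      exact (isAt_descentι q hF k).comp _
    refine IsAt.nonempty_isInitial hF hne (h₃.map hh) ?_
    rw [← h₂, ← Category.assoc]
    exact (isAt_descentι q hF l).comp _
  terminal := by
    have := isIso_descentComparison q hF hE
    have := hF.terminal
    have h : IsIso (toUnit ((res ξ ⋙ boxtimes.obj (descent ξ p q hF)).obj (𝟙_ (G ⥤ Type u)))) := by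
      rw [toUnit_unique (toUnit _) ((descentComparison ξ p q hF).app (𝟙_ (G ⥤ Type u)) ≫ toUnit _)]
      infer_instance
    exact h

end

variable {B B' : (K ⥤ Type u) ⥤ C}

variable (ξ) in
/-- The map `f ↦ ξ(f)` from `Hom(k, -)` to the restriction of `Hom(ξ k, -)`. -/
def unitEl (k : K) : coyoneda.obj (op k) ⟶ (res ξ).obj (coyoneda.obj (op (ξ.obj k))) :=
  el (S := ξ ⋙ coyoneda.obj (op (ξ.obj k))) (𝟙 (ξ.obj k))

theorem unitEl_app {k l : K} (f : k ⟶ l) : (unitEl ξ k).app l f = ξ.map f :=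
  Category.id_comp _

theorem unitEl_res_map_el (S : G ⥤ Type u) (k : K) (a : S.obj (ξ.obj k)) :
    unitEl ξ k ≫ (res ξ).map (el a) = el (S := ξ ⋙ S) a := by
  rw [unitEl, el_comp]
  congr 1
  exact el_app_id a

theorem coyoneda_map_unitEl {k l : K} (f : k ⟶ l) :
    coyoneda.map f.op ≫ unitEl ξ k = unitEl ξ l ≫ (res ξ).map (coyoneda.map (ξ.map f).op) := by
  ext d (g : l ⟶ d)
  exact ((unitEl_app (f ≫ g)).trans (ξ.map_comp f g)).trans
    (congrArg (ξ.map f ≫ ·) (unitEl_app g)).symm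

variable (ξ φ) in
/-- The map `v ↦ φ(v) ≫ p` from the restriction of `Hom(ξ k, -)` to that of
`Hom(φ(ξ k), ψ -)`. -/
def leftAction (p : ξ ⋙ φ ≅ ξ ⋙ ψ) (k : K) : (res ξ).obj (coyoneda.obj (op (ξ.obj k))) ⟶
    (res ξ).obj ((res ψ).obj (coyoneda.obj (op (φ.obj (ξ.obj k))))) :=
  (res ξ).map (el (S := φ ⋙ coyoneda.obj (op (φ.obj (ξ.obj k)))) (𝟙 (φ.obj (ξ.obj k)))) ≫
    Functor.whiskerRight p.hom (coyoneda.obj (op (φ.obj (ξ.obj k))))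

variable (ξ φ) in
/-- The map `v ↦ p ≫ ψ(v)` from the restriction of `Hom(ξ k, -)` to that of
`Hom(φ(ξ k), ψ -)`. -/
def rightAction (p : ξ ⋙ φ ≅ ξ ⋙ ψ) (k : K) : (res ξ).obj (coyoneda.obj (op (ξ.obj k))) ⟶
    (res ξ).obj ((res ψ).obj (coyoneda.obj (op (φ.obj (ξ.obj k))))) :=
  (res ξ).map (el (S := ψ ⋙ coyoneda.obj (op (φ.obj (ξ.obj k)))) (p.hom.app k))

theorem leftAction_app {k l : K} (v : ξ.obj k ⟶ ξ.obj l) :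
    (leftAction ξ φ p k).app l v = φ.map v ≫ p.hom.app l :=
  congrArg (· ≫ p.hom.app l) (Category.id_comp (φ.map v))

theorem rightAction_app {k l : K} (v : ξ.obj k ⟶ ξ.obj l) :
    (rightAction ξ φ p k).app l v = p.hom.app k ≫ ψ.map v :=
  rfl

theorem unitEl_leftAction (k : K) :
    unitEl ξ k ≫ leftAction ξ φ p k = unitEl ξ k ≫ rightAction ξ φ p k := by
  ext l (f : k ⟶ l)
  refine ((congrArg ((leftAction ξ φ p k).app l) (unitEl_app f)).trans
    (leftAction_app (ξ.map f))).trans ?_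
  refine Eq.trans ?_ ((congrArg ((rightAction ξ φ p k).app l) (unitEl_app f)).trans
    (rightAction_app (ξ.map f))).symm
  exact p.hom.naturality f

/-- For an equalizer `K`, the functor `Hom(k, -)` is the equalizer of two maps out of the
restriction of `Hom(ξ k, -)`, and this equalizer is preserved by functors that are cocontinuous and
cartesian. -/
theorem IsConcreteEqualizer.existsUnique_lift (hE : IsConcreteEqualizer ξ φ ψ p)
    (hB : IsCocontinuousCartesian B) (k : K) {z : C}
    (m : z ⟶ B.obj ((res ξ).obj (coyoneda.obj (op (ξ.obj k)))))
    (hm : m ≫ B.map (leftAction ξ φ p k) = m ≫ B.map (rightAction ξ φ p k)) :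
    ∃! l, l ≫ B.map (unitEl ξ k) = m := by
  refine hB.existsUnique_lift (unitEl ξ k) _ _ (unitEl_leftAction (p := p) k) ?_ ?_ m hm
  · intro l (f : k ⟶ l) (g : k ⟶ l) h
    exact hE.faithful (((unitEl_app f).symm.trans h).trans (unitEl_app g))
  · intro l (v : ξ.obj k ⟶ ξ.obj l) h
    obtain ⟨f, hf⟩ := hE.full v ((leftAction_app v).symm.trans (h.trans (rightAction_app v)))
    exact ⟨f, (unitEl_app f).trans hf⟩

theorem IsConcreteEqualizer.mono_map_unitEl (hE : IsConcreteEqualizer ξ φ ψ p)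
    (hB : IsCocontinuousCartesian B) (k : K) : Mono (B.map (unitEl ξ k)) where
  right_cancellation l l' h := by
    refine (hE.existsUnique_lift hB k (l' ≫ B.map (unitEl ξ k)) ?_).unique h rfl
    rw [Category.assoc, Category.assoc, ← B.map_comp, ← B.map_comp, unitEl_leftAction]

/-- Restriction along the equalizer is faithful on natural transformations. -/
theorem IsConcreteEqualizer.whiskerLeft_injective (hE : IsConcreteEqualizer ξ φ ψ p)
    (hB : PreservesColimitsOfSize.{u, u} B) (hB' : IsCocontinuousCartesian B') {f g : B ⟶ B'}
    (h : Functor.whiskerLeft (res ξ) f = Functor.whiskerLeft (res ξ) g) : f = g := by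
  refine natTrans_ext_of_coyoneda fun k => ?_
  have := hE.mono_map_unitEl hB' k
  rw [← cancel_mono (B'.map (unitEl ξ k)), ← f.naturality, ← g.naturality]
  congr 1
  exact congr(($h).app _)

/-- Restriction along the equalizer is full on natural transformations that are compatible with
`p`. -/
theorem IsConcreteEqualizer.exists_whiskerLeft_eq (hE : IsConcreteEqualizer ξ φ ψ p)
    (hB : PreservesColimitsOfSize.{u, u} B) (hB' : IsCocontinuousCartesian B')
    (f : res ξ ⋙ B ⟶ res ξ ⋙ B')
    (hf : ∀ S : H ⥤ Type u, f.app (φ ⋙ S) ≫ B'.map (Functor.whiskerRight p.hom S) =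
      B.map (Functor.whiskerRight p.hom S) ≫ f.app (ψ ⋙ S)) :
    ∃ g : B ⟶ B', Functor.whiskerLeft (res ξ) g = f := by
  have hn {S S' : G ⥤ Type u} (α : S ⟶ S') :
      B.map ((res ξ).map α) ≫ f.app S' = f.app S ≫ B'.map ((res ξ).map α) := f.naturality α
  have hm (k : K) := hE.existsUnique_lift hB' k
    (B.map (unitEl ξ k) ≫ f.app (coyoneda.obj (op (ξ.obj k)))) (by
      have h₁ : f.app (coyoneda.obj (op (ξ.obj k))) ≫ B'.map (leftAction ξ φ p k) =
          B.map (leftAction ξ φ p k) ≫ f.app (ψ ⋙ coyoneda.obj (op (φ.obj (ξ.obj k)))) := by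
        rw [leftAction, B.map_comp, B'.map_comp, ← Category.assoc, ← hn, Category.assoc,
          Category.assoc]
        exact _ ≫= hf _
      have h₂ : f.app (coyoneda.obj (op (ξ.obj k))) ≫ B'.map (rightAction ξ φ p k) =
          B.map (rightAction ξ φ p k) ≫ f.app (ψ ⋙ coyoneda.obj (op (φ.obj (ξ.obj k)))) :=
        (hn _).symm
      rw [Category.assoc, Category.assoc, h₁, h₂, ← B.map_comp_assoc, ← B.map_comp_assoc,
        unitEl_leftAction])
  choose g hg _ using hm
  let γ : coyoneda ⋙ B ⟶ coyoneda ⋙ B' :=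
    { app := fun k => g k.unop
      naturality := fun k l a => by
        have := hE.mono_map_unitEl hB' l.unop
        rw [← cancel_mono (B'.map (unitEl ξ l.unop)), Category.assoc, Category.assoc]
        refine (_ ≫= hg _).trans ?_
        have h₁ := coyoneda_map_unitEl (ξ := ξ) a.unop
        dsimp only [Functor.comp_map]
        rw [← B'.map_comp, ← B.map_comp_assoc]
        rw [Quiver.Hom.op_unop] at h₁
        refine (congrArg (B.map · ≫ f.app _) h₁).trans ?_
        refine Eq.trans ?_ (congrArg (g _ ≫ B'.map ·) h₁).symm
        rw [B.map_comp, B'.map_comp, Category.assoc, hn, ← Category.assoc, ← Category.assoc,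
          ← hg] }
  refine ⟨cocontinuousExtend γ, ?_⟩
  ext S
  refine cocontinuous_hom_ext B fun k (a : S.obj (ξ.obj k)) => ?_
  have h₁ : B'.map (el (S := ξ ⋙ S) a) = B'.map (unitEl ξ k) ≫ B'.map ((res ξ).map (el a)) := by
    rw [← unitEl_res_map_el, B'.map_comp]
  have h₂ : B.map (el (S := ξ ⋙ S) a) = B.map (unitEl ξ k) ≫ B.map ((res ξ).map (el a)) := by
    rw [← unitEl_res_map_el, B.map_comp]
  refine ((cocontinuousExtend γ).naturality (el (S := ξ ⋙ S) a)).trans ?_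
  rw [cocontinuousExtend_app]
  refine (_ ≫= h₁).trans (Eq.trans ?_ (h₂ =≫ _).symm)
  rw [Category.assoc, hn, ← Category.assoc, ← Category.assoc, ← hg]

end Descent

/-! ### Recognition of equalizers of categories -/

section IsEqualizing

/-- The functor `P` with `θ : P ⋙ F ⟶ P ⋙ G` has the properties that make the induced functor to
the inserter of `F` and `G` an equivalence. -/
structure IsEqualizing {B C D : Type*} [Category* B] [Category* C] [Category* D] (P : B ⥤ C)
    (F G : C ⥤ D) (θ : P ⋙ F ⟶ P ⋙ G) : Prop where
  faithful {b b' : B} {g g' : b ⟶ b'} (h : P.map g = P.map g') : g = g'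
  full {b b' : B} (f : P.obj b ⟶ P.obj b') (hf : F.map f ≫ θ.app b' = θ.app b ≫ G.map f) :
    ∃ g, P.map g = f
  essSurj (c : C) (q : F.obj c ⟶ G.obj c) :
    ∃ (b : B) (e : P.obj b ≅ c), F.map e.hom ≫ q = θ.app b ≫ G.map e.hom

namespace IsEqualizing

section

variable {B C D : Type*} [Category* B] [Category* C] [Category* D] {P : B ⥤ C} {F G : C ⥤ D}

theorem comm_inv {c c' : C} (e : c ≅ c') {r : F.obj c ⟶ G.obj c} {r' : F.obj c' ⟶ G.obj c'}
    (h : F.map e.hom ≫ r' = r ≫ G.map e.hom) : F.map e.inv ≫ r = r' ≫ G.map e.inv := by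
  rw [← cancel_mono (G.map e.hom), Category.assoc, Category.assoc, ← h, ← G.map_comp,
    ← F.map_comp_assoc, e.inv_hom_id, F.map_id, G.map_id, Category.id_comp, Category.comp_id]

theorem isEquivalence_inserter_lift {θ : P ⋙ F ⟶ P ⋙ G} (h : IsEqualizing P F G θ) :
    (Inserter.lift P θ).IsEquivalence where
  faithful := ⟨fun e => h.faithful congr(($e).base)⟩
  full := ⟨fun f => by
    obtain ⟨g, hg⟩ := h.full f.base f.comm
    exact ⟨g, Inserter.hom_ext hg⟩⟩
  essSurj := ⟨fun X => by
    obtain ⟨b, e, he⟩ := h.essSurj X.base X.arrow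
    exact ⟨b, ⟨{
      hom := ⟨e.hom, he⟩
      inv := ⟨e.inv, comm_inv e he⟩
      hom_inv_id := Inserter.hom_ext e.hom_inv_id
      inv_hom_id := Inserter.hom_ext e.inv_hom_id }⟩⟩⟩

theorem isEquivalence_isoInserter_lift {θ : P ⋙ F ≅ P ⋙ G} (h : IsEqualizing P F G θ.hom) :
    (IsoInserter.lift P θ).IsEquivalence where
  faithful := ⟨fun e => h.faithful congr(($e).base)⟩
  full := ⟨fun f => by
    obtain ⟨g, hg⟩ := h.full f.base f.comm
    exact ⟨g, IsoInserter.hom_ext hg⟩⟩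
  essSurj := ⟨fun X => by
    obtain ⟨b, e, he⟩ := h.essSurj X.base X.iso.hom
    exact ⟨b, ⟨{
      hom := ⟨e.hom, he⟩
      inv := ⟨e.inv, comm_inv e he⟩
      hom_inv_id := IsoInserter.hom_ext e.hom_inv_id
      inv_hom_id := IsoInserter.hom_ext e.inv_hom_id }⟩⟩⟩

end

variable {B₀ C₀ D₀ B₁ C₁ D₁ : Type*} [Category* B₀] [Category* C₀] [Category* D₀] [Category* B₁]
  [Category* C₁] [Category* D₁] {P₀ : B₀ ⥤ C₀} {F₀ G₀ : C₀ ⥤ D₀} {θ₀ : P₀ ⋙ F₀ ⟶ P₀ ⋙ G₀}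
  {P₁ : B₁ ⥤ C₁} {F₁ G₁ : C₁ ⥤ D₁} {θ₁ : P₁ ⋙ F₁ ⟶ P₁ ⋙ G₁}

/-- The property `IsEqualizing` is invariant under equivalences of diagrams. -/
theorem of_equivalence (h : IsEqualizing P₁ F₁ G₁ θ₁) (EB : B₀ ⥤ B₁) [EB.IsEquivalence]
    (EC : C₀ ⥤ C₁) [EC.Full] [EC.Faithful] (ED : D₀ ⥤ D₁) [ED.Faithful]
    (cP : P₀ ⋙ EC ≅ EB ⋙ P₁) (cF : F₀ ⋙ ED ≅ EC ⋙ F₁) (cG : G₀ ⋙ ED ≅ EC ⋙ G₁)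
    (w : ∀ b, ED.map (θ₀.app b) ≫ cG.hom.app (P₀.obj b) ≫ G₁.map (cP.hom.app b) =
      cF.hom.app (P₀.obj b) ≫ F₁.map (cP.hom.app b) ≫ θ₁.app (EB.obj b)) :
    IsEqualizing P₀ F₀ G₀ θ₀ where
  faithful {b b' g g'} e := by
    have h₁ := cP.hom.naturality g
    have h₂ := cP.hom.naturality g'
    dsimp only [Functor.comp_map] at h₁ h₂
    rw [← e, h₁] at h₂
    exact EB.map_injective (h.faithful ((cancel_epi _).1 h₂))
  full {b b'} f hf := by
    have nF := cF.hom.naturality f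
    have nG := cG.hom.naturality f
    dsimp only [Functor.comp_map] at nF nG
    obtain ⟨g, hg⟩ := h.full (cP.inv.app b ≫ EC.map f ≫ cP.hom.app b') (by
      rw [← cancel_epi (cF.hom.app (P₀.obj b) ≫ F₁.map (cP.hom.app b))]
      have w' := w b =≫ G₁.map (cP.inv.app b ≫ EC.map f ≫ cP.hom.app b')
      simp only [Category.assoc] at w' ⊢
      rw [← w', ← F₁.map_comp_assoc, ← G₁.map_comp]
      have e := cP.hom_inv_id_app_assoc b (EC.map f ≫ cP.hom.app b')
      rw [e, F₁.map_comp, G₁.map_comp, Category.assoc, ← reassoc_of% nF, ← reassoc_of% nG, ← w b',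
        ← ED.map_comp_assoc, ← ED.map_comp_assoc, hf])
    refine ⟨EB.preimage g, EC.map_injective ?_⟩
    have h₁ := cP.hom.naturality (EB.preimage g)
    dsimp only [Functor.comp_map] at h₁
    rw [EB.map_preimage, hg] at h₁
    rw [← cancel_mono (cP.hom.app b'), h₁]
    exact cP.hom_inv_id_app_assoc b _
  essSurj c q := by
    obtain ⟨b₁, e₁, he₁⟩ := h.essSurj (EC.obj c) (cF.inv.app c ≫ ED.map q ≫ cG.hom.app c)
    let b := EB.objPreimage b₁
    let i : EB.obj b ≅ b₁ := EB.objObjPreimageIso b₁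
    let e : P₀.obj b ≅ c := EC.preimageIso (cP.app b ≪≫ P₁.mapIso i ≪≫ e₁)
    have he : EC.map e.hom = cP.hom.app b ≫ P₁.map i.hom ≫ e₁.hom := EC.map_preimage _
    refine ⟨b, e, ED.map_injective ?_⟩
    have nF := cF.hom.naturality e.hom
    have nG := cG.hom.naturality e.hom
    have nθ := θ₁.naturality i.hom
    dsimp only [Functor.comp_map] at nF nG nθ
    have h₁ : ED.map q ≫ cG.hom.app c = cF.hom.app c ≫
        (cF.inv.app c ≫ ED.map q ≫ cG.hom.app c) := (cF.hom_inv_id_app_assoc c _).symm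
    rw [← cancel_mono (cG.hom.app c), ED.map_comp, ED.map_comp, Category.assoc, Category.assoc,
      h₁, reassoc_of% nF, nG, he]
    simp only [Functor.map_comp, Category.assoc]
    rw [he₁, reassoc_of% nθ, reassoc_of% w b]

end IsEqualizing

end IsEqualizing

/-! ### The equalizer property for cocontinuous cartesian functors -/

section Core

variable {C : Type v} [Category.{u} C] [CartesianMonoidalCategory C]

variable (C) in
/-- The category of functors from left `G`-sets to `C` that are cocontinuous and preserve finite
products. -/
abbrev CocontinuousCartesian (G : Type u) [Groupoid.{u} G] :=
  ObjectProperty.FullSubcategory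
    (fun F : (G ⥤ Type u) ⥤ C => IsCocontinuousCartesian F)

variable {K G H : Type u} [Groupoid.{u} K] [Groupoid.{u} G] [Groupoid.{u} H]

theorem IsCocontinuousCartesian.res_comp {F : (G ⥤ Type u) ⥤ C} (hF : IsCocontinuousCartesian F)
    (φ : G ⥤ H) : IsCocontinuousCartesian (res φ ⋙ F) where
  cocontinuous := by
    have := hF.cocontinuous
    infer_instance
  terminal := hF.terminal
  prod S S' := by
    have := hF.prod (φ ⋙ S) (φ ⋙ S')
    have h : CartesianMonoidalCategory.prodComparison (res φ ⋙ F) S S' =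
        CartesianMonoidalCategory.prodComparison F (φ ⋙ S) (φ ⋙ S') := rfl
    rw [h]
    exact this

/-- Precomposition with the restriction along `φ`. -/
def precompRes (φ : G ⥤ H) : CocontinuousCartesian C G ⥤ CocontinuousCartesian C H :=
  ObjectProperty.lift _ (ObjectProperty.ι _ ⋙ (Functor.whiskeringLeft _ _ C).obj (res φ))
    fun F => F.property.res_comp φ

/-- The comparison of the two composites `K ⟶ G ⟶ H` on functors out of left `K`-sets. -/
def precompResMap {ξ : K ⥤ G} {φ ψ : G ⥤ H} (p : ξ ⋙ φ ⟶ ξ ⋙ ψ) :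
    precompRes (C := C) ξ ⋙ precompRes φ ⟶ precompRes ξ ⋙ precompRes ψ where
  app B := ObjectProperty.homMk
    { app := fun S => B.obj.map (Functor.whiskerRight p S)
      naturality := fun S S' α => by
        dsimp [precompRes]
        rw [← B.obj.map_comp, ← B.obj.map_comp]
        congr 1
        ext
        simp }
  naturality B B' f := by
    apply ObjectProperty.hom_ext
    ext S
    exact (f.hom.naturality (Functor.whiskerRight p S)).symm

variable [IsGoodCartesian C]

/-- Cocontinuous functors that preserve finite products turn the equalizer of groupoids into an
equalizer of categories. -/
theorem IsConcreteEqualizer.isEqualizing {ξ : K ⥤ G} {φ ψ : G ⥤ H} {p : ξ ⋙ φ ≅ ξ ⋙ ψ}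
    (hE : IsConcreteEqualizer ξ φ ψ p) :
    IsEqualizing (precompRes (C := C) ξ) (precompRes φ) (precompRes ψ) (precompResMap p.hom) where
  faithful {B B' f g} h := by
    apply ObjectProperty.hom_ext
    exact hE.whiskerLeft_injective B.property.cocontinuous B'.property congr(($h).hom)
  full {B B'} f hf := by
    obtain ⟨g, hg⟩ := hE.exists_whiskerLeft_eq B.property.cocontinuous B'.property f.hom
      fun S => congr(($hf).hom.app S)
    exact ⟨ObjectProperty.homMk g, ObjectProperty.hom_ext _ hg⟩
  essSurj F q := by
    have h : IsIso (descentComparison ξ p q.hom F.property) :=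
      isIso_descentComparison q.hom F.property hE
    refine ⟨⟨_, (isPrincipal_descent q.hom F.property hE).isCocontinuousCartesian⟩,
      (ObjectProperty.fullyFaithfulι _).preimageIso
        (@asIso _ _ _ _ (descentComparison ξ p q.hom F.property) h), ?_⟩
    apply ObjectProperty.hom_ext
    ext S
    exact descentComparison_app_comp q.hom F.property S

end Core

/-! ### Torsors and cocontinuous cartesian functors -/

section Torsors

variable {K G H : Type u} [Groupoid.{u} K] [Groupoid.{u} G] [Groupoid.{u} H]

section Cartesian

variable {A : Type v} [Category.{u} A] [CartesianMonoidalCategory A] [IsGoodCartesian A]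

/-- For `t` and `s` in different connected components, a product of `x(t)` and `x(s)` is initial,
because `x(t)` and `x(s)` live over disjoint summands of the terminal object. -/
theorem nonempty_isInitial_tensor (x : Gᵒᵖ ⥤ A)
    (hx : IsIso (toUnit ((boxtimes.obj x).obj (𝟙_ (G ⥤ Type u))))) {t s : G}
    (h : IsEmpty (s ⟶ t)) : Nonempty (IsInitial (x.obj (op t) ⊗ x.obj (op s))) := by
  -- The terminal `G`-set is the disjoint union of the component of `t` and its complement.
  let D (b : ULift.{u} Bool) : G ⥤ Type u :=
    { obj := fun d => ULift.{u} (PLift (Nonempty (t ⟶ d) ↔ b.down = true))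
      map := fun {d d'} f => TypeCat.ofHom fun e => ⟨⟨Iff.trans
        ⟨fun ⟨g⟩ => ⟨g ≫ inv f⟩, fun ⟨g⟩ => ⟨g ≫ f⟩⟩ e.down.down⟩⟩ }
  have hc : Nonempty (IsColimit (Cofan.mk (𝟙_ (G ⥤ Type u)) fun b => toUnit (D b))) := by
    rw [nonempty_isColimit_cofan_iff]
    intro d
    constructor
    · rintro ⟨⟨b⟩, ⟨⟨h₁⟩⟩⟩ ⟨⟨b'⟩, ⟨⟨h₂⟩⟩⟩ -
      obtain rfl : b = b' := Bool.eq_iff_iff.2 (h₁.symm.trans h₂)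
      rfl
    · intro e
      by_cases hd : Nonempty (t ⟶ d)
      · exact ⟨⟨⟨true⟩, ⟨⟨by simpa using hd⟩⟩⟩, rfl⟩
      · exact ⟨⟨⟨false⟩, ⟨⟨by simpa using hd⟩⟩⟩, rfl⟩
  have hc' := isColimitCofanMkObjOfIsColimit (boxtimes.obj x) _ _ hc.some
  have ht : Nonempty (t ⟶ t) ↔ true = true := by simpa using ⟨𝟙 t⟩
  have hs : Nonempty (t ⟶ s) ↔ false = true := by
    simpa using ⟨fun g : t ⟶ s => h.elim (inv g)⟩
  refine IsGoodCartesian.good.nonempty_isInitial_of_ne hc' (i := ⟨true⟩) (j := ⟨false⟩) (by simp)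
    (fst _ _ ≫ boxι x (D ⟨true⟩) t ⟨⟨ht⟩⟩) (snd _ _ ≫ boxι x (D ⟨false⟩) s ⟨⟨hs⟩⟩) ?_
  rw [← cancel_mono (toUnit ((boxtimes.obj x).obj (𝟙_ (G ⥤ Type u))))]
  exact toUnit_unique _ _

section

variable [BraidedCategory A] (x : CommComon (Gᵒᵖ ⥤ A))

omit [IsGoodCartesian A] in
/-- In a cartesian category the comultiplication is the diagonal. -/
theorem comul_app (t s : G) (g : s ⟶ t) : (Δ[x.X]).app (op t) ≫ x.X.obj (op t) ◁ x.X.map g.op =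
    lift (𝟙 (x.X.obj (op t))) (x.X.map g.op) := by
  have h : (Δ[x.X]).app (op t) = lift (𝟙 (x.X.obj (op t))) (𝟙 (x.X.obj (op t))) := by
    have h₁ : Δ[x.X] ≫ fst _ _ = 𝟙 _ := by simp
    have h₂ : Δ[x.X] ≫ snd _ _ = 𝟙 _ := by simp
    apply CartesianMonoidalCategory.hom_ext
    · rw [lift_fst]
      exact congr(($h₁).app (op t))
    · rw [lift_snd]
      exact congr(($h₂).app (op t))
  rw [h]
  simp

theorem isIso_torsorMap_iff (t s : G) : IsIso (torsorMap x t s) ↔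
    Nonempty (IsColimit (Cofan.mk (x.X.obj (op t) ⊗ x.X.obj (op s))
      (fun g : s ⟶ t => lift (𝟙 (x.X.obj (op t))) (x.X.map g.op)))) := by
  rw [Cofan.nonempty_isColimit_iff_isIso_sigmaDesc]
  have h : torsorMap x t s = Limits.Sigma.desc
      (fun g : s ⟶ t => lift (𝟙 (x.X.obj (op t))) (x.X.map g.op)) := by
    rw [torsorMap]
    congr 1
    funext g
    exact comul_app x t s g
  rw [h]
  rfl

/-- The colimit of `x` is `x ⊠ 1`, where `1` is the terminal `G`-set. -/
theorem nonempty_isColimit_counitCocone_iff : Nonempty (IsColimit (counitCocone x)) ↔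
    IsIso (toUnit ((boxtimes.obj x.X).obj (𝟙_ (G ⥤ Type u)))) := by
  constructor
  · rintro ⟨hc⟩
    let c : Cocone x.X :=
      { pt := (boxtimes.obj x.X).obj (𝟙_ (G ⥤ Type u))
        ι :=
          { app := fun t => boxι x.X (𝟙_ (G ⥤ Type u)) t.unop ⟨⟩
            naturality := fun t s g => (boxι_condition x.X (𝟙_ (G ⥤ Type u)) g.unop ⟨⟩).trans
              (Category.comp_id _).symm } }
    refine ⟨hc.desc c, box_hom_ext fun t a => ?_, toUnit_unique _ _⟩
    refine Eq.trans ?_ (Category.comp_id _).symm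
    have h : boxι x.X (𝟙_ (G ⥤ Type u)) t a ≫ toUnit _ = (counitCocone x).ι.app (op t) :=
      toUnit_unique _ _
    exact (Category.assoc _ _ _).symm.trans ((h =≫ hc.desc c).trans (hc.fac c (op t)))
  · intro h
    let j := inv (toUnit ((boxtimes.obj x.X).obj (𝟙_ (G ⥤ Type u))))
    have hj : toUnit ((boxtimes.obj x.X).obj (𝟙_ (G ⥤ Type u))) ≫ j = 𝟙 _ := IsIso.hom_inv_id _
    have hj' : j ≫ toUnit ((boxtimes.obj x.X).obj (𝟙_ (G ⥤ Type u))) = 𝟙 _ := IsIso.inv_hom_id _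
    refine ⟨{
      desc := fun c => j ≫
        boxDesc x.X (𝟙_ (G ⥤ Type u)) (fun t _ => c.ι.app (op t)) fun t s g _ => c.w g.op
      fac := fun c t => ?_
      uniq := fun c m hm => ?_ }⟩
    · have h' : (counitCocone x).ι.app t =
          boxι x.X (𝟙_ (G ⥤ Type u)) t.unop ⟨⟩ ≫ toUnit _ := toUnit_unique _ _
      have h₁ := (reassoc_of% hj) (boxDesc x.X (𝟙_ (G ⥤ Type u)) (fun t _ => c.ι.app (op t))
        (fun t s g _ => c.w g.op))
      exact (h' =≫ _).trans ((Category.assoc _ _ _).trans ((_ ≫= h₁).trans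
        (boxι_desc _ _ _ _ _ _)))
    · have h' : toUnit ((boxtimes.obj x.X).obj (𝟙_ (G ⥤ Type u))) ≫ m = boxDesc x.X
          (𝟙_ (G ⥤ Type u)) (fun t _ => c.ι.app (op t)) (fun t s g _ => c.w g.op) := by
        refine box_hom_ext fun t a => ?_
        rw [boxι_desc, ← hm (op t)]
        exact (Category.assoc _ _ _).symm.trans (congrArg (· ≫ m) (toUnit_unique _ _))
      exact ((reassoc_of% hj') m).symm.trans (congrArg (j ≫ ·) h')

/-- In a good cartesian category the torsor condition holds for all pairs of objects of `G`, because
source and target of the map are initial for objects in different components. -/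
theorem isTorsor_iff : IsTorsor x ↔ IsPrincipal x.X := by
  constructor
  · intro h
    have hx := (nonempty_isColimit_counitCocone_iff x).1 h.colimit
    refine ⟨fun t s => ?_, hx⟩
    by_cases hts : Nonempty (s ⟶ t)
    · exact (isIso_torsorMap_iff x t s).1 (h.principal t s hts)
    · rw [not_nonempty_iff] at hts
      obtain ⟨hi⟩ := nonempty_isInitial_tensor x.X hx hts
      exact ⟨Cofan.IsColimit.mk _ (fun c => hi.to _) (fun c g => hts.elim g)
        fun c m hm => hi.hom_ext _ _⟩
  · intro h
    exact ⟨fun t s _ => (isIso_torsorMap_iff x t s).2 (h.principal t s),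
      (nonempty_isColimit_counitCocone_iff x).2 h.terminal⟩

variable (A) in
/-- The functor on `H`-sets that corresponds to `x ⊠_φ H` is the composite of the restriction along
`φ` with the functor `x ⊠ -`. -/
theorem pushforwardPreservesTorsors : PushforwardPreservesTorsors.{u} A := by
  intro G H _ _ φ x
  rw [isTorsor_iff]
  exact (((isTorsor_iff _).1 x.property).isCocontinuousCartesian.res_comp φ).isPrincipal

end

end Cartesian

section Pushforward

variable {A : Type v} [Category.{u} A] [HasColimitsOfSize.{u, u} A]

/-- The isomorphism `(x ⊠_φ H) ⊠ S ≅ x ⊠ φ^* S`. -/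
def pushforwardBoxtimesIso (φ : G ⥤ H) :
    pushforward A φ ⋙ boxtimes ≅ boxtimes ⋙ (Functor.whiskeringLeft _ _ A).obj (res φ) :=
  NatIso.ofComponents (fun x => @asIso _ _ (boxtimes.obj (coyoneda ⋙ res φ ⋙ boxtimes.obj x))
      (res φ ⋙ boxtimes.obj x) (boxtimesComparison (res φ ⋙ boxtimes.obj x)) inferInstance)
    fun {x x'} f => by
      ext S
      refine box_hom_ext fun s a => ?_
      refine (boxι_map_app_assoc ((pushforward A φ).map f) S s a _).trans ?_
      refine (_ ≫= boxι_comparison (res φ ⋙ boxtimes.obj x') S s a).trans ?_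
      refine Eq.trans ?_ ((Category.assoc _ _ _).symm.trans
        (boxι_comparison (res φ ⋙ boxtimes.obj x) S s a =≫ _)).symm
      exact ((boxtimes.map f).naturality ((res φ).map (el a))).symm

theorem pushforwardι_boxι_iso (φ : G ⥤ H) (x : Gᵒᵖ ⥤ A) (S : H ⥤ Type u) {s : H} (a : S.obj s)
    {t : G} (h : s ⟶ φ.obj t) :
    pushforwardι φ x t h ≫ boxι ((pushforward A φ).obj x) S s a ≫
      ((pushforwardBoxtimesIso φ).hom.app x).app S = boxι x (φ ⋙ S) t (S.map h a) := by
  have h₁ := boxι_comparison (res φ ⋙ boxtimes.obj x) S s a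
  have h₂ := boxι_map x ((res φ).map (el a)) t h
  exact (congrArg (pushforwardι φ x t h ≫ ·) h₁).trans h₂

theorem pushforwardι_boxι_iso_assoc (φ : G ⥤ H) (x : Gᵒᵖ ⥤ A) (S : H ⥤ Type u) {s : H}
    (a : S.obj s) {t : G} (h : s ⟶ φ.obj t) {z : A}
    (m : (boxtimes.obj x).obj (φ ⋙ S) ⟶ z) :
    pushforwardι φ x t h ≫ boxι ((pushforward A φ).obj x) S s a ≫
      ((pushforwardBoxtimesIso φ).hom.app x).app S ≫ m = boxι x (φ ⋙ S) t (S.map h a) ≫ m := by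
  rw [← pushforwardι_boxι_iso]
  simp only [Category.assoc]

/-- The comparison of the pushforwards on the copy of `y(k)` indexed by `h` and `w`. -/
theorem pushforwardι_comparison {ξ : K ⥤ G} {φ ψ : G ⥤ H} (p : ξ ⋙ φ ⟶ ξ ⋙ ψ) (y : Kᵒᵖ ⥤ A)
    {s : H} {t : G} {k : K} (h : s ⟶ φ.obj t) (w : t ⟶ ξ.obj k) :
    pushforwardι ξ y k w ≫ pushforwardι φ ((pushforward A ξ).obj y) t h ≫
      ((pushforwardComparison ξ φ ψ p).app y).app (op s) =
    pushforwardι ξ y k (𝟙 _) ≫ pushforwardι ψ ((pushforward A ξ).obj y) (ξ.obj k)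
      (h ≫ φ.map w ≫ p.app k) := by
  change pushforwardι ξ y k w ≫ pushforwardι φ ((pushforward A ξ).obj y) t h ≫
    (pushforwardCompApp ξ φ y s).hom ≫ ((pushforwardMap A p).app y).app (op s) ≫
      (pushforwardCompApp ξ ψ y s).inv = _
  rw [pushforwardCompApp, pushforwardι_desc_assoc, pushforwardι_desc_assoc, ← Category.assoc,
    pushforwardι_pushforwardMap, pushforwardCompApp, pushforwardι_desc, Category.assoc]

/-- The identification of `- ⊠_φ H` with the restriction along `φ` is compatible with `p`. -/
theorem pushforwardBoxtimesIso_comparison {ξ : K ⥤ G} {φ ψ : G ⥤ H} (p : ξ ⋙ φ ⟶ ξ ⋙ ψ)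
    (y : Kᵒᵖ ⥤ A) (S : H ⥤ Type u) :
    (boxtimes.map ((pushforwardComparison ξ φ ψ p).app y)).app S ≫
      ((pushforwardBoxtimesIso ψ).hom.app ((pushforward A ξ).obj y)).app S ≫
        ((pushforwardBoxtimesIso ξ).hom.app y).app (ψ ⋙ S) =
    ((pushforwardBoxtimesIso φ).hom.app ((pushforward A ξ).obj y)).app S ≫
      ((pushforwardBoxtimesIso ξ).hom.app y).app (φ ⋙ S) ≫
        (boxtimes.obj y).map (Functor.whiskerRight p S) := by
  refine box_hom_ext fun s a => pushforward_hom_ext φ fun t h => pushforward_hom_ext ξ fun k w => ?_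
  have h₁ := boxι_map_app_assoc ((pushforwardComparison ξ φ ψ p).app y) S s a
    (((pushforwardBoxtimesIso ψ).hom.app ((pushforward A ξ).obj y)).app S ≫
        ((pushforwardBoxtimesIso ξ).hom.app y).app (ψ ⋙ S))
  have h₂ := pushforwardι_comparison p y h w =≫
    (boxι ((pushforward A ψ).obj ((pushforward A ξ).obj y)) S s a ≫
    (((pushforwardBoxtimesIso ψ).hom.app ((pushforward A ξ).obj y)).app S ≫
        ((pushforwardBoxtimesIso ξ).hom.app y).app (ψ ⋙ S)))
  have h₃ := pushforwardι_boxι_iso_assoc ψ ((pushforward A ξ).obj y) S a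
    (h ≫ φ.map w ≫ p.app k) (((pushforwardBoxtimesIso ξ).hom.app y).app (ψ ⋙ S))
  have h₄ := pushforwardι_boxι_iso ξ y (ψ ⋙ S) (S.map (h ≫ φ.map w ≫ p.app k) a) (𝟙 (ξ.obj k))
  have h₅ := pushforwardι_boxι_iso_assoc φ ((pushforward A ξ).obj y) S a h
    (((pushforwardBoxtimesIso ξ).hom.app y).app (φ ⋙ S) ≫
        (boxtimes.obj y).map (Functor.whiskerRight p S))
  have h₆ := pushforwardι_boxι_iso_assoc ξ y (φ ⋙ S) (S.map h a) w
    ((boxtimes.obj y).map (Functor.whiskerRight p S))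
  have h₇ := boxι_map y (Functor.whiskerRight p S) k ((φ ⋙ S).map w (S.map h a))
  refine (_ ≫= _ ≫= h₁).trans ?_
  simp only [Category.assoc] at h₂
  refine (h₂.trans (_ ≫= h₃)).trans (h₄.trans ?_)
  refine Eq.trans ?_ ((_ ≫= h₅).trans (h₆.trans h₇)).symm
  congr 1
  simp

end Pushforward

section Equivalence

variable {A : Type v} [Category.{u} A] [CartesianMonoidalCategory A] [IsGoodCartesian A]
  [BraidedCategory A]

variable (G A) in
/-- The functor that sends a torsor `x` to `x ⊠ -`. -/
def torsToFunctor : Tors G A ⥤ CocontinuousCartesian A G :=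
  ObjectProperty.lift _ (Tors.forget ⋙ boxtimes) fun x =>
    ((isTorsor_iff _).1 x.property).isCocontinuousCartesian

omit [BraidedCategory A] in
theorem coyonedaBoxtimesIso_naturality {x x' : Gᵒᵖ ⥤ A} (f : x ⟶ x') :
    (coyonedaBoxtimesIso x).hom ≫ Functor.whiskerLeft coyoneda (boxtimes.map f) =
      f ≫ (coyonedaBoxtimesIso x').hom := by
  ext t
  exact boxι_map_app f (coyoneda.obj (op t.unop)) t.unop (𝟙 t.unop)

instance : (torsToFunctor G A).Faithful where
  map_injective {x x' f g} h := by
    have h₁ : boxtimes.map (Tors.forget.map f) = boxtimes.map (Tors.forget.map g) :=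
      congr(($h).hom)
    have h₂ := coyonedaBoxtimesIso_naturality (Tors.forget.map f)
    rw [h₁, coyonedaBoxtimesIso_naturality, cancel_mono] at h₂
    apply ObjectProperty.hom_ext
    apply CommComon.hom_ext
    exact h₂.symm

instance : (torsToFunctor G A).Full where
  map_surjective {x x'} f := by
    let w : coyoneda ⋙ boxtimes.obj (Tors.forget.obj x) ⟶
        coyoneda ⋙ boxtimes.obj (Tors.forget.obj x') := Functor.whiskerLeft coyoneda f.hom
    let g : Tors.forget.obj x ⟶ Tors.forget.obj x' :=
      (coyonedaBoxtimesIso _).hom ≫ w ≫ (coyonedaBoxtimesIso _).inv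
    refine ⟨ObjectProperty.homMk (CommComon.homOfCartesian g), ?_⟩
    apply ObjectProperty.hom_ext
    refine natTrans_ext_of_coyoneda (F := boxtimes.obj (Tors.forget.obj x)) fun t => ?_
    have h := coyonedaBoxtimesIso_naturality g
    have hg : g ≫ (coyonedaBoxtimesIso (Tors.forget.obj x')).hom =
        (coyonedaBoxtimesIso (Tors.forget.obj x)).hom ≫ w := by
      simp [g]
    rw [hg, cancel_epi] at h
    exact congr(($h).app (op t))

instance : (torsToFunctor G A).EssSurj where
  mem_essImage F := by
    have := F.property.cocontinuous
    refine ⟨⟨(cartesianCommComon _).obj (coyoneda ⋙ F.obj),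
      (isTorsor_iff _).2 F.property.isPrincipal⟩, ⟨?_⟩⟩
    exact (ObjectProperty.fullyFaithfulι _).preimageIso
      (@asIso _ _ (boxtimes.obj (coyoneda ⋙ F.obj)) F.obj (boxtimesComparison F.obj) inferInstance)

instance : (torsToFunctor G A).IsEquivalence where

/-- Under the correspondence of torsors with functors, `- ⊠_φ H` is precomposition with the
restriction along `φ`. -/
def pushTorsToFunctorIso (h : PushforwardPreservesTorsors.{u} A) (φ : G ⥤ H) :
    Tors.push h φ ⋙ torsToFunctor H A ≅ torsToFunctor G A ⋙ precompRes φ :=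
  NatIso.ofComponents (fun x => (ObjectProperty.fullyFaithfulι _).preimageIso
    ((pushforwardBoxtimesIso φ).app (Tors.forget.obj x))) fun f => by
      apply ObjectProperty.hom_ext
      exact (pushforwardBoxtimesIso φ).hom.naturality (Tors.forget.map f)

theorem isEquivalence_torsT (h : PushforwardPreservesTorsors.{u} A) {ξ : K ⥤ G} {φ ψ : G ⥤ H}
    {p : ξ ⋙ φ ≅ ξ ⋙ ψ} (hE : IsConcreteEqualizer ξ φ ψ p) :
    (Tors.T h ξ φ ψ p).IsEquivalence := by
  refine IsEqualizing.isEquivalence_inserter_lift (hE.isEqualizing.of_equivalence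
    (torsToFunctor K A) (torsToFunctor G A) (torsToFunctor H A) (pushTorsToFunctorIso h ξ)
    (pushTorsToFunctorIso h φ) (pushTorsToFunctorIso h ψ) fun y => ?_)
  apply ObjectProperty.hom_ext
  ext S
  exact pushforwardBoxtimesIso_comparison p.hom (Tors.forget.obj y) S

end Equivalence

end Torsors

/-! ### The cartesian monoidal category of cocommutative coalgebras -/

section Comonoid

variable {A : Type v} [Category.{u} A] [MonoidalCategory A] [BraidedCategory A]

omit [BraidedCategory A] in
theorem comul_comul_comul (X : A) [ComonObj X] :
    Δ[X] ≫ (Δ[X] ⊗ₘ Δ[X]) ≫ (α_ X X (X ⊗ X)).hom ≫ X ◁ (α_ X X X).inv =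
      Δ[X] ≫ X ◁ (Δ[X] ≫ Δ[X] ▷ X) := by
  have h : Δ[X] ≫ Δ[X] ▷ X = Δ[X] ≫ X ◁ Δ[X] ≫ (α_ X X X).inv := by
    simp
  rw [h, MonoidalCategory.tensorHom_def]
  simp only [whiskerLeft_comp, Category.assoc]
  rw [associator_naturality_right_assoc, ← comul_assoc_assoc]

/-- The fourfold comultiplication of a cocommutative coalgebra is invariant under the exchange of
the middle factors. -/
theorem comul_comul_tensorμ (X : A) [ComonObj X] [IsCommComonObj X] :
    Δ[X] ≫ (Δ[X] ⊗ₘ Δ[X]) ≫ tensorμ X X X X = Δ[X] ≫ (Δ[X] ⊗ₘ Δ[X]) := by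
  have h := comul_comul_comul X
  have h' := h =≫ (X ◁ (α_ X X X).hom ≫ (α_ X X (X ⊗ X)).inv)
  simp only [Category.assoc, ← whiskerLeft_comp_assoc, Iso.inv_hom_id, whiskerLeft_id,
    Category.id_comp, Iso.hom_inv_id, Category.comp_id] at h'
  have h₂ := h =≫ (X ◁ (β_ X X).hom ▷ X ≫ X ◁ (α_ X X X).hom ≫ (α_ X X (X ⊗ X)).inv)
  simp only [Category.assoc] at h₂
  rw [tensorμ, h₂, h']
  simp only [← whiskerLeft_comp_assoc, Category.assoc]
  rw [← comp_whiskerRight_assoc, IsCommComonObj.comul_comm]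


/-- The projection `X ⊗ Y ⟶ X` given by the counit of `Y`. -/
def comonFst (X Y : A) [ComonObj Y] : X ⊗ Y ⟶ X := X ◁ ε[Y] ≫ (ρ_ X).hom

/-- The projection `X ⊗ Y ⟶ Y` given by the counit of `X`. -/
def comonSnd (X Y : A) [ComonObj X] : X ⊗ Y ⟶ Y := ε[X] ▷ Y ≫ (λ_ Y).hom

instance isComonHom_comonFst (X Y : A) [ComonObj X] [ComonObj Y] :
    IsComonHom (comonFst X Y) where
  hom_counit := by
    rw [comonFst, Comon.tensorObj_counit, MonoidalCategory.tensorHom_def', Category.assoc,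
      Category.assoc, ← rightUnitor_naturality, unitors_equal]
  hom_comul := by
    have h : tensorμ X X Y Y ≫ (comonFst X Y ⊗ₘ comonFst X Y) =
        (X ⊗ X) ◁ ((ε[Y] ⊗ₘ ε[Y]) ≫ (λ_ (𝟙_ A)).hom) ≫ (ρ_ (X ⊗ X)).hom := by
      rw [comonFst, ← tensorHom_comp_tensorHom, ← tensorμ_natural_right_assoc,
        tensor_right_unitality, ← whiskerLeft_comp_assoc, Category.assoc, Iso.hom_inv_id,
        Category.comp_id]
    rw [Comon.tensorObj_comul, Category.assoc, h, MonoidalCategory.tensorHom_def, Category.assoc,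
      ← whiskerLeft_comp_assoc, counit_comul_hom_assoc, Iso.inv_hom_id, Category.comp_id,
      ← whisker_exchange_assoc, rightUnitor_naturality, comonFst, Category.assoc]

instance isComonHom_comonSnd (X Y : A) [ComonObj X] [ComonObj Y] :
    IsComonHom (comonSnd X Y) where
  hom_counit := by
    rw [comonSnd, Comon.tensorObj_counit, MonoidalCategory.tensorHom_def, Category.assoc,
      Category.assoc, ← leftUnitor_naturality]
  hom_comul := by
    have h : tensorμ X X Y Y ≫ (comonSnd X Y ⊗ₘ comonSnd X Y) =
        ((ε[X] ⊗ₘ ε[X]) ≫ (λ_ (𝟙_ A)).hom) ▷ (Y ⊗ Y) ≫ (λ_ (Y ⊗ Y)).hom := by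
      rw [comonSnd, ← tensorHom_comp_tensorHom, ← tensorμ_natural_left_assoc,
        tensor_left_unitality, ← comp_whiskerRight_assoc, Category.assoc, Iso.hom_inv_id,
        Category.comp_id]
    rw [Comon.tensorObj_comul, Category.assoc, h, MonoidalCategory.tensorHom_def', Category.assoc,
      ← comp_whiskerRight_assoc, counit_comul_hom_assoc, Iso.inv_hom_id, Category.comp_id,
      whisker_exchange_assoc, leftUnitor_naturality, comonSnd, Category.assoc]

theorem tensorObj_comul_fst_snd (X Y : A) [ComonObj X] [ComonObj Y] :
    Δ[X ⊗ Y] ≫ (comonFst X Y ⊗ₘ comonSnd X Y) = 𝟙 _ := by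
  have h := tensorμ_natural (𝟙 X) ε[X] ε[Y] (𝟙 Y)
  simp only [id_tensorHom, tensorHom_id] at h
  have h' : ((ρ_ X).inv ⊗ₘ (λ_ Y).inv) ≫ tensorμ X (𝟙_ A) (𝟙_ A) Y ≫ ((ρ_ X).hom ⊗ₘ (λ_ Y).hom) =
      𝟙 _ := by
    rw [tensorμ, braiding_tensorUnit_left]
    monoidal
  rw [Comon.tensorObj_comul, comonFst, comonSnd, ← tensorHom_comp_tensorHom, Category.assoc,
    ← reassoc_of% h, ← id_tensorHom, ← tensorHom_id, tensorHom_comp_tensorHom_assoc,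
    comul_counit_hom, counit_comul_hom, Category.id_comp, Category.id_comp, h']

/-- The comultiplication of a cocommutative coalgebra is a map of coalgebras. -/
instance isComonHom_comul (T : A) [ComonObj T] [IsCommComonObj T] : IsComonHom Δ[T] where
  hom_counit := by
    rw [Comon.tensorObj_counit, counit_comul_hom_assoc, Iso.inv_hom_id, Category.comp_id]
  hom_comul := by
    rw [Comon.tensorObj_comul]
    exact comul_comul_tensorμ T

instance isComonHom_tensorHom {S T X Y : A} [ComonObj S] [ComonObj T] [ComonObj X] [ComonObj Y]
    (f : S ⟶ X) (g : T ⟶ Y) [IsComonHom f] [IsComonHom g] : IsComonHom (f ⊗ₘ g) where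
  hom_counit := by
    rw [Comon.tensorObj_counit, Comon.tensorObj_counit, tensorHom_comp_tensorHom_assoc,
      IsComonHom.hom_counit, IsComonHom.hom_counit]
  hom_comul := by
    rw [Comon.tensorObj_comul, Comon.tensorObj_comul, tensorHom_comp_tensorHom_assoc,
      IsComonHom.hom_comul, IsComonHom.hom_comul, ← tensorHom_comp_tensorHom_assoc,
      tensorμ_natural, Category.assoc]

omit [BraidedCategory A] in
theorem comul_fst {T X Y : A} [ComonObj T] [ComonObj Y] (f : T ⟶ X) (g : T ⟶ Y) [IsComonHom g] :
    (Δ[T] ≫ (f ⊗ₘ g)) ≫ comonFst X Y = f := by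
  rw [comonFst, ← id_tensorHom, Category.assoc, tensorHom_comp_tensorHom_assoc,
    IsComonHom.hom_counit, Category.comp_id, comul_counit_hom_assoc, Iso.inv_hom_id,
    Category.comp_id]

omit [BraidedCategory A] in
theorem comul_snd {T X Y : A} [ComonObj T] [ComonObj X] (f : T ⟶ X) (g : T ⟶ Y) [IsComonHom f] :
    (Δ[T] ≫ (f ⊗ₘ g)) ≫ comonSnd X Y = g := by
  rw [comonSnd, ← tensorHom_id, Category.assoc, tensorHom_comp_tensorHom_assoc,
    IsComonHom.hom_counit, Category.comp_id, counit_comul_hom_assoc, Iso.inv_hom_id,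
    Category.comp_id]

/-- A map of coalgebras to a tensor product is determined by its projections. -/
theorem comul_comp_fst_snd {T X Y : A} [ComonObj T] [ComonObj X] [ComonObj Y] (f : T ⟶ X ⊗ Y)
    [IsComonHom f] : Δ[T] ≫ (f ≫ comonFst X Y ⊗ₘ f ≫ comonSnd X Y) = f := by
  rw [← tensorHom_comp_tensorHom, ← reassoc_of% (IsComonHom.hom_comul f),
    tensorObj_comul_fst_snd, Category.comp_id]

end Comonoid

section CommComon

variable {A : Type v} [Category.{u} A] [MonoidalCategory A] [SymmetricCategory A]

/-- The underlying map of a map of cocommutative coalgebras. -/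
def und {X Y : CommComon A} (f : X ⟶ Y) : X.X ⟶ Y.X := f.hom.hom

instance {X Y : CommComon A} (f : X ⟶ Y) : IsComonHom (und f) := f.hom.isComonHom_hom

theorem und_injective {X Y : CommComon A} {f g : X ⟶ Y} (h : und f = und g) : f = g :=
  CommComon.hom_ext _ _ h

theorem und_comp {X Y Z : CommComon A} (f : X ⟶ Y) (g : Y ⟶ Z) :
    und (f ≫ g) = und f ≫ und g :=
  rfl

theorem und_id (X : CommComon A) : und (𝟙 X) = 𝟙 X.X :=
  rfl

/-- A map of cocommutative coalgebras, from the underlying map. -/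
def mkCommComonHom {X Y : CommComon A} (f : X.X ⟶ Y.X) [h : IsComonHom f] : X ⟶ Y :=
  ⟨@Comon.Hom.mk _ _ _ X.toComon Y.toComon f h⟩

variable (A) in
/-- The functor that forgets the coalgebra structure. -/
def forgetCommComon : CommComon A ⥤ A where
  obj X := X.X
  map f := und f

theorem isIso_of_und {X Y : CommComon A} (f : X ⟶ Y) [IsIso (und f)] : IsIso f := by
  have : IsComonHom (asIso (und f)).hom := inferInstanceAs (IsComonHom (und f))
  exact ⟨mkCommComonHom (asIso (und f)).inv, und_injective (asIso (und f)).hom_inv_id,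
    und_injective (asIso (und f)).inv_hom_id⟩

instance : (forgetCommComon A).ReflectsIsomorphisms where
  reflects f hf := @isIso_of_und _ _ _ _ _ _ f hf

section

variable (X Y : CommComon A)

/-- The tensor product of cocommutative coalgebras. -/
def commComonProd : CommComon A := ⟨X.X ⊗ Y.X⟩

/-- The first projection of the tensor product of cocommutative coalgebras. -/
def commComonFst : commComonProd X Y ⟶ X :=
  @mkCommComonHom _ _ _ _ (commComonProd X Y) X (comonFst X.X Y.X) (isComonHom_comonFst X.X Y.X)

/-- The second projection of the tensor product of cocommutative coalgebras. -/
def commComonSnd : commComonProd X Y ⟶ Y :=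
  @mkCommComonHom _ _ _ _ (commComonProd X Y) Y (comonSnd X.X Y.X) (isComonHom_comonSnd X.X Y.X)

variable {X Y}

/-- The map to a tensor product of cocommutative coalgebras with given components. -/
def commComonLift {T : CommComon A} (f : T ⟶ X) (g : T ⟶ Y) : T ⟶ commComonProd X Y :=
  @mkCommComonHom _ _ _ _ T (commComonProd X Y) (Δ[T.X] ≫ (und f ⊗ₘ und g))
    (inferInstanceAs (IsComonHom (Δ[T.X] ≫ (und f ⊗ₘ und g))))

/-- The unit of `A` is the terminal cocommutative coalgebra. -/
def isTerminalTrivial : IsTerminal (CommComon.trivial A) :=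
  IsTerminal.ofUniqueHom (fun X => ⟨(Comon.uniqueHomToTrivial X.toComon).default⟩)
    fun X m => InducedCategory.hom_ext ((Comon.uniqueHomToTrivial X.toComon).uniq m.hom)

end

/-- The tensor product of cocommutative coalgebras is their cartesian product. -/
instance : CartesianMonoidalCategory (CommComon A) :=
  .ofChosenFiniteProducts ⟨asEmptyCone _, isTerminalTrivial⟩ fun X Y =>
    ⟨BinaryFan.mk (commComonFst X Y) (commComonSnd X Y),
      BinaryFan.isLimitMk (fun s => commComonLift s.fst s.snd)
        (fun s => und_injective (comul_fst (und s.fst) (und s.snd)))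
        (fun s => und_injective (comul_snd (und s.fst) (und s.snd)))
        fun s m h₁ h₂ => und_injective (by
          have h : @IsComonHom _ _ _ s.pt.X (X.X ⊗ Y.X) _ _ (und m) :=
            inferInstanceAs (IsComonHom (und m))
          refine (@comul_comp_fst_snd _ _ _ _ _ X.X Y.X _ _ _ (und m) h).symm.trans ?_
          exact congrArg₂ (fun (f : s.pt ⟶ X) (g : s.pt ⟶ Y) => Δ[s.pt.X] ≫ (und f ⊗ₘ und g))
            h₁ h₂)⟩

end CommComon

/-! ### Colimits of cocommutative coalgebras -/

section CommComonColimits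

variable {A : Type v} [Category.{u} A] [MonoidalCategory A] [SymmetricCategory A]

section Colimit

universe w w'

variable {J : Type w} [Category.{w'} J] (D : J ⥤ CommComon A) {c : Cocone (D ⋙ forgetCommComon A)}
  (hc : IsColimit c)

/-- The component of a colimit cocone at `j`. -/
def colimitInj (c : Cocone (D ⋙ forgetCommComon A)) (j : J) : (D.obj j).X ⟶ c.pt := c.ι.app j

omit [SymmetricCategory A] in
theorem comul_tensorHom_comp {X Y Z W : A} (d : W ⟶ X ⊗ X) (f : X ⟶ Y) (g : Y ⟶ Z) {k : X ⟶ Z}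
    (h : f ≫ g = k) : d ≫ (f ⊗ₘ f) ≫ (g ⊗ₘ g) = d ≫ (k ⊗ₘ k) := by
  rw [tensorHom_comp_tensorHom, h]

/-- The counit of a colimit of cocommutative coalgebras. -/
def colimitCounit : c.pt ⟶ 𝟙_ A :=
  hc.desc ⟨𝟙_ A, fun j => ε[(D.obj j).X], fun _ _ f => by
    refine Eq.trans ?_ (Category.comp_id _).symm
    exact IsComonHom.hom_counit (und (D.map f))⟩

/-- The comultiplication of a colimit of cocommutative coalgebras. -/
def colimitComul : c.pt ⟶ c.pt ⊗ c.pt :=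
  hc.desc ⟨c.pt ⊗ c.pt, fun j => Δ[(D.obj j).X] ≫ (colimitInj D c j ⊗ₘ colimitInj D c j), fun _ _ f => by
    refine Eq.trans ?_ (Category.comp_id _).symm
    refine (Category.assoc _ _ _).symm.trans
      ((IsComonHom.hom_comul (und (D.map f)) =≫ _).trans ?_)
    exact (Category.assoc _ _ _).trans (comul_tensorHom_comp _ _ _ (c.w f))⟩

theorem colimit_counit_fac (j : J) : colimitInj D c j ≫ colimitCounit D hc = ε[(D.obj j).X] :=
  hc.fac _ j

theorem colimit_comul_fac (j : J) : colimitInj D c j ≫ colimitComul D hc =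
    Δ[(D.obj j).X] ≫ (colimitInj D c j ⊗ₘ colimitInj D c j) :=
  hc.fac _ j

include hc in
theorem colimitInj_hom_ext {z : A} {f g : c.pt ⟶ z}
    (h : ∀ j, colimitInj D c j ≫ f = colimitInj D c j ≫ g) : f = g :=
  hc.hom_ext h

/-- The coalgebra structure of a colimit of cocommutative coalgebras. -/
abbrev colimitComonObj : ComonObj c.pt where
  counit := colimitCounit D hc
  comul := colimitComul D hc
  counit_comul := colimitInj_hom_ext D hc fun j => by
    rw [reassoc_of% (colimit_comul_fac D hc j), ← tensorHom_id, tensorHom_comp_tensorHom,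
      colimit_counit_fac, Category.comp_id, counit_comul_hom]
  comul_counit := colimitInj_hom_ext D hc fun j => by
    rw [reassoc_of% (colimit_comul_fac D hc j), ← id_tensorHom, tensorHom_comp_tensorHom,
      colimit_counit_fac, Category.comp_id, comul_counit_hom]
  comul_assoc := colimitInj_hom_ext D hc fun j => by
    have h₁ : (colimitInj D c j ⊗ₘ colimitInj D c j) ≫ c.pt ◁ colimitComul D hc =
        (D.obj j).X ◁ Δ[(D.obj j).X] ≫
          (colimitInj D c j ⊗ₘ (colimitInj D c j ⊗ₘ colimitInj D c j)) := by
      rw [← id_tensorHom, ← id_tensorHom, tensorHom_comp_tensorHom, tensorHom_comp_tensorHom,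
        colimit_comul_fac, Category.comp_id, Category.id_comp]
    have h₂ : (colimitInj D c j ⊗ₘ colimitInj D c j) ≫ colimitComul D hc ▷ c.pt =
        Δ[(D.obj j).X] ▷ (D.obj j).X ≫
          ((colimitInj D c j ⊗ₘ colimitInj D c j) ⊗ₘ colimitInj D c j) := by
      rw [← tensorHom_id, ← tensorHom_id, tensorHom_comp_tensorHom, tensorHom_comp_tensorHom,
        colimit_comul_fac, Category.comp_id, Category.id_comp]
    rw [reassoc_of% (colimit_comul_fac D hc j), reassoc_of% (colimit_comul_fac D hc j), h₁,
      reassoc_of% h₂, associator_naturality, comul_assoc_assoc]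

/-- The colimit of cocommutative coalgebras carried by a colimit of the underlying objects. -/
def colimitCommComon : CommComon A :=
  letI := colimitComonObj D hc
  { X := c.pt
    comm := ⟨colimitInj_hom_ext D hc fun j => by
      refine ((reassoc_of% (colimit_comul_fac D hc j)) _).trans ?_
      rw [BraidedCategory.braiding_naturality, IsCommComonObj.comul_comm_assoc]
      exact (colimit_comul_fac D hc j).symm⟩ }

/-- The cocone of cocommutative coalgebras carried by a colimit cocone of the underlying
objects. -/
def colimitCommComonCocone : Cocone D where
  pt := colimitCommComon D hc
  ι :=
    { app j := @mkCommComonHom _ _ _ _ (D.obj j) (colimitCommComon D hc) (colimitInj D c j)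
        ⟨colimit_counit_fac D hc j, colimit_comul_fac D hc j⟩
      naturality _ _ f := und_injective ((c.w f).trans (Category.comp_id _).symm) }

/-- The cocone `colimitCommComonCocone` is a colimit cocone. -/
def isColimitColimitCommComonCocone : IsColimit (colimitCommComonCocone D hc) where
  desc s := @mkCommComonHom _ _ _ _ (colimitCommComon D hc) s.pt
    (hc.desc ((forgetCommComon A).mapCocone s)) (by
      have h (j : J) : colimitInj D c j ≫ hc.desc ((forgetCommComon A).mapCocone s) =
        und (s.ι.app j) := hc.fac _ j
      refine ⟨colimitInj_hom_ext D hc fun j => ?_, colimitInj_hom_ext D hc fun j => ?_⟩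
      · refine ((reassoc_of% (h j)) _).trans ((IsComonHom.hom_counit (und (s.ι.app j))).trans ?_)
        exact (colimit_counit_fac D hc j).symm
      · refine ((reassoc_of% (h j)) _).trans ((IsComonHom.hom_comul (und (s.ι.app j))).trans ?_)
        refine Eq.trans ?_ ((reassoc_of% (colimit_comul_fac D hc j)) _).symm
        exact (comul_tensorHom_comp _ _ _ (h j)).symm)
  fac s j := und_injective (hc.fac _ j)
  uniq s m h := und_injective (hc.uniq ((forgetCommComon A).mapCocone s) (und m)
    fun j => congrArg und (h j))

end Colimit

/-- The colimit of a diagram of cocommutative coalgebras is the colimit of the underlying objects. -/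
instance : CreatesColimitsOfSize.{u, u} (forgetCommComon A) where
  CreatesColimitsOfShape :=
    { CreatesColimit := fun {D} => createsColimitOfReflectsIso fun _ hc =>
        { liftedCocone := colimitCommComonCocone D hc
          validLift := Cocone.ext (Iso.refl _) fun _ => Category.comp_id _
          makesColimit := isColimitColimitCommComonCocone D hc } }

theorem und_tensorHom {X Y X' Y' : CommComon A} (f : X ⟶ X') (g : Y ⟶ Y') :
    und (f ⊗ₘ g) = (und f ⊗ₘ und g : X.X ⊗ Y.X ⟶ X'.X ⊗ Y'.X) := by
  have h : f ⊗ₘ g = lift (fst X Y ≫ f) (snd X Y ≫ g) := by ext <;> simp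
  rw [h]
  change Δ[X.X ⊗ Y.X] ≫ (comonFst X.X Y.X ≫ und f ⊗ₘ comonSnd X.X Y.X ≫ und g) = _
  rw [← tensorHom_comp_tensorHom, reassoc_of% (tensorObj_comul_fst_snd X.X Y.X)]

/-- The tensor product of coalgebras is cocontinuous because the forgetful functor creates colimits
and respects tensor products. -/
instance isGoodCartesian_commComon [IsGoodTwoRing.{u} A] : IsGoodCartesian (CommComon A) := by
  have : HasColimitsOfSize.{u, u} (CommComon A) :=
    hasColimits_of_hasColimits_createsColimits (forgetCommComon A)
  refine ⟨this, fun X => ?_, fun X => ?_, IsGoodTwoRing.good⟩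
  · have := IsTwoRing.tensorLeft_cocontinuous X.X
    have e : tensorLeft X ⋙ forgetCommComon A ≅ forgetCommComon A ⋙ tensorLeft X.X :=
      NatIso.ofComponents (fun Y => Iso.refl _) fun {Y Y'} f => by
        refine (Category.comp_id _).trans (Eq.trans ?_ (Category.id_comp _).symm)
        change und (X ◁ f) = X.X ◁ und f
        rw [← id_tensorHom, und_tensorHom, und_id, id_tensorHom]
    have := preservesColimits_of_natIso e.symm
    exact preservesColimits_of_reflects_of_preserves (tensorLeft X) (forgetCommComon A)
  · have := IsTwoRing.tensorRight_cocontinuous X.X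
    have e : tensorRight X ⋙ forgetCommComon A ≅ forgetCommComon A ⋙ tensorRight X.X :=
      NatIso.ofComponents (fun Y => Iso.refl _) fun {Y Y'} f => by
        refine (Category.comp_id _).trans (Eq.trans ?_ (Category.id_comp _).symm)
        change und (f ▷ X) = und f ▷ X.X
        rw [← tensorHom_id, und_tensorHom, und_id, tensorHom_id]
    have := preservesColimits_of_natIso e.symm
    exact preservesColimits_of_reflects_of_preserves (tensorRight X) (forgetCommComon A)

end CommComonColimits

/-! ### Symmetric monoidal functors out of a cartesian category -/

section Diagonal

open Functor.OplaxMonoidal Functor.LaxMonoidal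

universe u₁ u₂ v₁ v₂

variable {S : Type u₁} [Category.{v₁} S] [CartesianMonoidalCategory S] [BraidedCategory S]
  {A : Type u₂} [Category.{v₂} A] [MonoidalCategory A] [SymmetricCategory A]

section Braided

variable (F : S ⥤ A) [F.Braided]

omit [BraidedCategory S] [SymmetricCategory A] in
theorem map_diag_comp_δ (F : S ⥤ A) [F.Monoidal] {X Y Z : S} (f : X ⟶ Y) (g : X ⟶ Z) :
    (F.map (lift (𝟙 X) (𝟙 X)) ≫ δ F X X) ≫ (F.map f ⊗ₘ F.map g) =
      F.map (lift f g) ≫ δ F Y Z := by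
  rw [Category.assoc, δ_natural, ← F.map_comp_assoc]
  simp

theorem δ_comp_braiding (X Y : S) : δ F X Y ≫ (β_ (F.obj X) (F.obj Y)).hom =
    F.map (β_ X Y).hom ≫ δ F Y X := by
  have h := Functor.LaxBraided.braided (F := F) X Y
  rw [← cancel_epi (μ F X Y), Functor.Monoidal.μ_δ_assoc, reassoc_of% h,
    Functor.Monoidal.μ_δ, Category.comp_id]

/-- The cocommutative coalgebra `F(X)` given by the diagonal of `X`. -/
def diagonalCommComon (X : S) : CommComon A :=
  letI : ComonObj X := ((cartesianComon S).obj X).comon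
  letI : ComonObj (F.obj X) := Functor.obj.instComonObj X F
  { X := F.obj X
    comm := ⟨by
      change (F.map (lift (𝟙 X) (𝟙 X)) ≫ δ F X X) ≫ _ = F.map (lift (𝟙 X) (𝟙 X)) ≫ δ F X X
      rw [Category.assoc, δ_comp_braiding, ← F.map_comp_assoc]
      simp⟩ }

theorem diagonalCommComon_counit (X : S) :
    ε[(diagonalCommComon F X).X] = (F.map (toUnit X) ≫ η F : F.obj X ⟶ 𝟙_ A) :=
  rfl

variable {F}

/-- A map of the coalgebras `F(X)` and `F'(Y)`, from a map that respects the structures. -/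
def diagonalHom {F' : S ⥤ A} [F'.Braided] {X Y : S} (f : F.obj X ⟶ F'.obj Y)
    (h₁ : f ≫ F'.map (toUnit Y) ≫ η F' = F.map (toUnit X) ≫ η F)
    (h₂ : f ≫ F'.map (lift (𝟙 Y) (𝟙 Y)) ≫ δ F' Y Y =
      (F.map (lift (𝟙 X) (𝟙 X)) ≫ δ F X X) ≫ (f ⊗ₘ f)) :
    diagonalCommComon F X ⟶ diagonalCommComon F' Y :=
  @mkCommComonHom _ _ _ _ (diagonalCommComon F X) (diagonalCommComon F' Y) f ⟨h₁, h₂⟩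

variable (F)

/-- The functor `X ↦ F(X)` to cocommutative coalgebras. -/
def diagonal : S ⥤ CommComon A where
  obj X := diagonalCommComon F X
  map {X Y} f := diagonalHom (F.map f)
    (by rw [← F.map_comp_assoc, comp_toUnit])
    (by rw [map_diag_comp_δ, ← F.map_comp_assoc, comp_lift, Category.comp_id])
  map_id X := und_injective (F.map_id X)
  map_comp f g := und_injective (F.map_comp f g)

theorem isIso_toUnit_diagonal : IsIso (toUnit ((diagonal F).obj (𝟙_ S))) := by
  have h : und (toUnit ((diagonal F).obj (𝟙_ S))) = η F := by
    refine (diagonalCommComon_counit F (𝟙_ S)).trans ?_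
    rw [toUnit_unit, F.map_id, Category.id_comp]
  have : IsIso (und (toUnit ((diagonal F).obj (𝟙_ S)))) := by
    rw [h]
    exact inferInstanceAs (IsIso (η F))
  exact isIso_of_und _

theorem isIso_prodComparison_diagonal (X Y : S) :
    IsIso (CartesianMonoidalCategory.prodComparison (diagonal F) X Y) := by
  have h : und (CartesianMonoidalCategory.prodComparison (diagonal F) X Y) = δ F X Y := by
    refine (map_diag_comp_δ F (fst X Y) (snd X Y)).trans ?_
    rw [lift_fst_snd, F.map_id, Category.id_comp]
  have : IsIso (und (CartesianMonoidalCategory.prodComparison (diagonal F) X Y)) := by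
    rw [h]
    exact inferInstanceAs (IsIso (δ F X Y))
  exact isIso_of_und _

variable {F}

/-- A monoidal natural transformation consists of maps of coalgebras. -/
def diagonalMap {F' : S ⥤ A} [F'.Braided] (τ : F ⟶ F') [NatTrans.IsMonoidal τ] :
    diagonal F ⟶ diagonal F' where
  app X := diagonalHom (τ.app X)
    (by
      have h : τ.app (𝟙_ S) ≫ η F' = η F := by
        rw [← cancel_epi (Functor.LaxMonoidal.ε F), NatTrans.IsMonoidal.unit_assoc, Functor.Monoidal.ε_η,
          Functor.Monoidal.ε_η]
      rw [← τ.naturality_assoc, h])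
    (by
      have h : τ.app (X ⊗ X) ≫ δ F' X X = δ F X X ≫ (τ.app X ⊗ₘ τ.app X) := by
        rw [← cancel_epi (μ F X X), NatTrans.IsMonoidal.tensor_assoc, Functor.Monoidal.μ_δ,
          Functor.Monoidal.μ_δ_assoc, Category.comp_id]
      rw [← τ.naturality_assoc, h, Category.assoc])
  naturality _ _ f := und_injective (τ.naturality f)

/-- A natural transformation that consists of maps of coalgebras is monoidal. -/
theorem isMonoidal_of_diagonal {F' : S ⥤ A} [F'.Braided] (τ : F ⟶ F')
    (h₁ : ∀ X, τ.app X ≫ F'.map (toUnit X) ≫ η F' = F.map (toUnit X) ≫ η F)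
    (h₂ : ∀ X, τ.app X ≫ F'.map (lift (𝟙 X) (𝟙 X)) ≫ δ F' X X =
      (F.map (lift (𝟙 X) (𝟙 X)) ≫ δ F X X) ≫ (τ.app X ⊗ₘ τ.app X)) :
    NatTrans.IsMonoidal τ where
  unit := by
    have h := h₁ (𝟙_ S)
    rw [toUnit_unit, F.map_id, F'.map_id, Category.id_comp, Category.id_comp] at h
    rw [← cancel_mono (η F'), Category.assoc, h, Functor.Monoidal.ε_η, Functor.Monoidal.ε_η]
  tensor X Y := by
    have h : τ.app (X ⊗ Y) ≫ δ F' X Y = δ F X Y ≫ (τ.app X ⊗ₘ τ.app Y) := by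
      have h := h₂ (X ⊗ Y) =≫ (F'.map (fst X Y) ⊗ₘ F'.map (snd X Y))
      rw [Category.assoc, map_diag_comp_δ, Category.assoc, tensorHom_comp_tensorHom,
        ← τ.naturality, ← τ.naturality, ← tensorHom_comp_tensorHom,
        ← Category.assoc (_ ≫ δ F _ _), map_diag_comp_δ] at h
      simpa using h
    rw [← cancel_mono (δ F' X Y), Category.assoc, h, Category.assoc, Functor.Monoidal.μ_δ,
      Functor.Monoidal.μ_δ_assoc, Category.comp_id]

end Braided

section Comp

universe u₃ v₃

variable {R : Type u₃} [Category.{v₃} R] [CartesianMonoidalCategory R] [BraidedCategory R]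
  (Φ : R ⥤ S) [Φ.Braided] (F : S ⥤ A) [F.Braided]

/-- Braided functors between cartesian categories preserve diagonals. -/
def diagonalCompIso : diagonal (Φ ⋙ F) ≅ Φ ⋙ diagonal F :=
  have e (X : R) : @IsComonHom _ _ _ (diagonalCommComon (Φ ⋙ F) X).X
      (diagonalCommComon F (Φ.obj X)).X _ _ (𝟙 (F.obj (Φ.obj X))) :=
    { hom_counit := by
        refine (Category.id_comp _).trans ?_
        have h : Φ.map (toUnit X) ≫ η Φ = toUnit (Φ.obj X) := toUnit_unique _ _
        change _ = F.map (Φ.map (toUnit X)) ≫ F.map (η Φ) ≫ η F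
        rw [← F.map_comp_assoc, h]
        rfl
      hom_comul := by
        refine (Category.id_comp _).trans (Eq.trans ?_ (_ ≫= (id_tensorHom_id _ _).symm))
        refine Eq.trans ?_ (Category.comp_id _).symm
        have h : Φ.map (lift (𝟙 X) (𝟙 X)) ≫ δ Φ X X = lift (𝟙 _) (𝟙 _) := by
          ext <;> simp
        change _ = F.map (Φ.map (lift (𝟙 X) (𝟙 X))) ≫ F.map (δ Φ X X) ≫ δ F _ _
        rw [← F.map_comp_assoc, h]
        rfl }
  NatIso.ofComponents
    (fun X =>
      let f := @mkCommComonHom _ _ _ _ ((diagonal (Φ ⋙ F)).obj X) ((diagonal F).obj (Φ.obj X))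
        (𝟙 (F.obj (Φ.obj X))) (e X)
      haveI : IsIso (und f) := inferInstanceAs (IsIso (𝟙 (F.obj (Φ.obj X))))
      haveI := isIso_of_und f
      asIso f)
    fun f => und_injective ((Category.comp_id _).trans (Category.id_comp _).symm)

end Comp

section Underlying

variable (F : S ⥤ CommComon A)

/-- The map `F(X ⊗ Y) ⟶ F(X) ⊗ F(Y)` induced by the projections. -/
def undδ (X Y : S) : (F.obj (X ⊗ Y)).X ⟶ (F.obj X).X ⊗ (F.obj Y).X :=
  Δ[(F.obj (X ⊗ Y)).X] ≫ (und (F.map (fst X Y)) ⊗ₘ und (F.map (snd X Y)))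

omit [BraidedCategory S] in
theorem map_comp_undδ {X Y Z : S} (f : Z ⟶ X ⊗ Y) : und (F.map f) ≫ undδ F X Y =
    Δ[(F.obj Z).X] ≫ (und (F.map (f ≫ fst X Y)) ⊗ₘ und (F.map (f ≫ snd X Y))) := by
  rw [undδ, reassoc_of% (IsComonHom.hom_comul (und (F.map f))), tensorHom_comp_tensorHom,
    F.map_comp, F.map_comp, und_comp, und_comp]

omit [BraidedCategory S] in
theorem undδ_natural {X Y X' Y' : S} (f : X ⟶ X') (g : Y ⟶ Y') :
    undδ F X Y ≫ (und (F.map f) ⊗ₘ und (F.map g)) = und (F.map (f ⊗ₘ g)) ≫ undδ F X' Y' := by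
  rw [map_comp_undδ, undδ, Category.assoc, tensorHom_comp_tensorHom, ← und_comp, ← und_comp,
    ← F.map_comp, ← F.map_comp, tensorHom_fst, tensorHom_snd]

omit [SymmetricCategory A] in
theorem comul_assoc_tensorHom {T X Y Z : A} [ComonObj T] (a : T ⟶ X) (b : T ⟶ Y) (c : T ⟶ Z) :
    Δ[T] ≫ (Δ[T] ≫ (a ⊗ₘ b) ⊗ₘ c) ≫ (α_ X Y Z).hom = Δ[T] ≫ (a ⊗ₘ Δ[T] ≫ (b ⊗ₘ c)) := by
  have h₁ : (Δ[T] ≫ (a ⊗ₘ b) ⊗ₘ c) = Δ[T] ▷ T ≫ ((a ⊗ₘ b) ⊗ₘ c) := by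
    rw [← tensorHom_id, tensorHom_comp_tensorHom, Category.id_comp]
  have h₂ : (a ⊗ₘ Δ[T] ≫ (b ⊗ₘ c)) = T ◁ Δ[T] ≫ (a ⊗ₘ (b ⊗ₘ c)) := by
    rw [← id_tensorHom, tensorHom_comp_tensorHom, Category.id_comp]
  rw [h₁, h₂, Category.assoc, associator_naturality, comul_assoc_assoc]

omit [BraidedCategory S] in
theorem undδ_associativity (X Y Z : S) :
    undδ F (X ⊗ Y) Z ≫ undδ F X Y ▷ (F.obj Z).X ≫ (α_ (F.obj X).X (F.obj Y).X (F.obj Z).X).hom =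
      und (F.map (α_ X Y Z).hom) ≫ undδ F X (Y ⊗ Z) ≫ (F.obj X).X ◁ undδ F Y Z := by
  have h₁ : undδ F (X ⊗ Y) Z ≫ undδ F X Y ▷ (F.obj Z).X =
      Δ[(F.obj ((X ⊗ Y) ⊗ Z)).X] ≫ (Δ[(F.obj ((X ⊗ Y) ⊗ Z)).X] ≫
        (und (F.map (fst _ _ ≫ fst _ _)) ⊗ₘ und (F.map (fst _ _ ≫ snd _ _))) ⊗ₘ
          und (F.map (snd _ _))) := by
    rw [← map_comp_undδ, ← tensorHom_id]
    nth_rw 1 [undδ]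
    rw [Category.assoc, tensorHom_comp_tensorHom, Category.comp_id]
  rw [reassoc_of% h₁, comul_assoc_tensorHom, reassoc_of% (map_comp_undδ F (α_ X Y Z).hom),
    ← id_tensorHom, tensorHom_comp_tensorHom, Category.comp_id, map_comp_undδ]
  simp

omit [BraidedCategory S] in
theorem undδ_left_unitality (X : S) : (λ_ (F.obj X).X).inv =
    und (F.map (λ_ X).inv) ≫ undδ F (𝟙_ S) X ≫ ε[(F.obj (𝟙_ S)).X] ▷ (F.obj X).X := by
  rw [reassoc_of% (map_comp_undδ F (λ_ X).inv), ← tensorHom_id, tensorHom_comp_tensorHom,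
    IsComonHom.hom_counit, Category.comp_id, counit_comul_hom, leftUnitor_inv_snd, F.map_id,
    und_id, Category.id_comp]

omit [BraidedCategory S] in
theorem undδ_right_unitality (X : S) : (ρ_ (F.obj X).X).inv =
    und (F.map (ρ_ X).inv) ≫ undδ F X (𝟙_ S) ≫ (F.obj X).X ◁ ε[(F.obj (𝟙_ S)).X] := by
  rw [reassoc_of% (map_comp_undδ F (ρ_ X).inv), ← id_tensorHom, tensorHom_comp_tensorHom,
    IsComonHom.hom_counit, Category.comp_id, comul_counit_hom, rightUnitor_inv_fst, F.map_id,
    und_id, Category.id_comp]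

theorem undδ_braiding (X Y : S) : undδ F X Y ≫ (β_ (F.obj X).X (F.obj Y).X).hom =
    und (F.map (β_ X Y).hom) ≫ undδ F Y X := by
  rw [map_comp_undδ, undδ, Category.assoc, BraidedCategory.braiding_naturality,
    IsCommComonObj.comul_comm_assoc]
  simp

/-- The oplax monoidal structure on the underlying functor of a functor to cocommutative
coalgebras. -/
abbrev underlyingOplaxMonoidal : (F ⋙ forgetCommComon A).OplaxMonoidal where
  η := ε[(F.obj (𝟙_ S)).X]
  δ X Y := undδ F X Y
  δ_natural_left {X Y} f Z := by
    have h := undδ_natural F f (𝟙 Z)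
    rw [F.map_id, und_id, tensorHom_id, tensorHom_id] at h
    exact h
  δ_natural_right {X Y} Z f := by
    have h := undδ_natural F (𝟙 Z) f
    rw [F.map_id, und_id, id_tensorHom, id_tensorHom] at h
    exact h
  oplax_associativity := undδ_associativity F
  oplax_left_unitality := undδ_left_unitality F
  oplax_right_unitality := undδ_right_unitality F

variable (h₁ : IsIso (toUnit (F.obj (𝟙_ S))))
  (h₂ : ∀ X Y, IsIso (CartesianMonoidalCategory.prodComparison F X Y))

/-- The monoidal structure on the underlying functor of a functor to cocommutative
coalgebras that preserves finite products. -/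
abbrev underlyingMonoidal : (F ⋙ forgetCommComon A).Monoidal :=
  letI := underlyingOplaxMonoidal F
  haveI : IsIso (η (F ⋙ forgetCommComon A)) :=
    inferInstanceAs (IsIso ((forgetCommComon A).map (toUnit (F.obj (𝟙_ S)))))
  haveI (X Y : S) : IsIso (δ (F ⋙ forgetCommComon A) X Y) :=
    inferInstanceAs (IsIso ((forgetCommComon A).map
      (CartesianMonoidalCategory.prodComparison F X Y)))
  Functor.Monoidal.ofOplaxMonoidal _

/-- The underlying functor of a functor to cocommutative coalgebras that preserves finite
products is symmetric monoidal. -/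
abbrev underlyingBraided : (F ⋙ forgetCommComon A).Braided :=
  letI := underlyingMonoidal F h₁ h₂
  { braided := fun X Y => by
      have h : δ (F ⋙ forgetCommComon A) X Y ≫
        (β_ ((F ⋙ forgetCommComon A).obj X) ((F ⋙ forgetCommComon A).obj Y)).hom =
        (F ⋙ forgetCommComon A).map (β_ X Y).hom ≫ δ (F ⋙ forgetCommComon A) Y X :=
        undδ_braiding F X Y
      rw [← cancel_mono (δ (F ⋙ forgetCommComon A) Y X), Category.assoc, Category.assoc, ← h,
        Functor.Monoidal.μ_δ_assoc, Functor.Monoidal.μ_δ, Category.comp_id] }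

/-- The coalgebra structures given by the diagonals are the original ones. -/
def diagonalUnderlyingIso :
    letI := underlyingBraided F h₁ h₂
    diagonal (F ⋙ forgetCommComon A) ≅ F :=
  letI := underlyingBraided F h₁ h₂
  have e (X : S) : @IsComonHom _ _ _ (diagonalCommComon (F ⋙ forgetCommComon A) X).X (F.obj X).X
      _ _ (𝟙 (F.obj X).X) :=
    { hom_counit := by
        refine (Category.id_comp _).trans ?_
        exact (IsComonHom.hom_counit (und (F.map (toUnit X)))).symm
      hom_comul := by
        refine (Category.id_comp _).trans (Eq.trans ?_ (_ ≫= (id_tensorHom_id _ _).symm))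
        refine Eq.trans ?_ (Category.comp_id _).symm
        have h : und (F.map (lift (𝟙 X) (𝟙 X))) ≫ undδ F X X = Δ[(F.obj X).X] := by
          rw [map_comp_undδ, lift_fst, lift_snd, F.map_id, und_id, id_tensorHom_id,
            Category.comp_id]
        exact h.symm }
  NatIso.ofComponents
    (fun X =>
      let f := @mkCommComonHom _ _ _ _ ((diagonal (F ⋙ forgetCommComon A)).obj X) (F.obj X)
        (𝟙 (F.obj X).X) (e X)
      haveI : IsIso (und f) := inferInstanceAs (IsIso (𝟙 (F.obj X).X))
      haveI := isIso_of_und f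
      asIso f)
    fun f => und_injective ((Category.comp_id _).trans (Category.id_comp _).symm)

end Underlying

end Diagonal

/-! ### The equalizer property for good commutative 2-rings -/

section Affine

variable {A : Type v} [Category.{u} A] [MonoidalCategory A] [SymmetricCategory A]

section

variable {G : Type u} [Groupoid.{u} G]

theorem isCocontinuousCartesian_diagonal [HasColimitsOfSize.{u, u} A]
    (α : TwoRingHom.{u} (G ⥤ Type u) A) : IsCocontinuousCartesian (diagonal α.functor) where
  cocontinuous := by
    have : PreservesColimitsOfSize.{u, u} (diagonal α.functor ⋙ forgetCommComon A) :=
      α.cocontinuous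
    exact preservesColimits_of_reflects_of_preserves (diagonal α.functor) (forgetCommComon A)
  terminal := isIso_toUnit_diagonal α.functor
  prod := isIso_prodComparison_diagonal α.functor

variable [HasColimitsOfSize.{u, u} A]

variable (A G) in
/-- A 1-morphism from left `G`-sets to `A`, as a cocontinuous functor to the cocommutative
coalgebras of `A` that preserves finite products. -/
def toCocontinuousCartesian :
    TwoRingHom.{u} (G ⥤ Type u) A ⥤ CocontinuousCartesian (CommComon A) G where
  obj α := ⟨diagonal α.functor, isCocontinuousCartesian_diagonal α⟩
  map χ := ObjectProperty.homMk (diagonalMap χ.natTrans)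

instance : (toCocontinuousCartesian A G).Faithful where
  map_injective {α β f g} h := by
    ext S
    exact congr(und (($h).hom.app S))

/-- A natural transformation whose components are maps of coalgebras is monoidal. -/
instance : (toCocontinuousCartesian A G).Full where
  map_surjective {α β} f := by
    let τ : α.functor ⟶ β.functor :=
      { app := fun S => und (f.hom.app S)
        naturality := fun _ _ k => congr(und $(f.hom.naturality k)) }
    have : NatTrans.IsMonoidal τ := isMonoidal_of_diagonal τ
      (fun S => IsComonHom.hom_counit (und (f.hom.app S)))
      (fun S => IsComonHom.hom_comul (und (f.hom.app S)))
    exact ⟨⟨τ⟩, rfl⟩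

/-- The underlying functor of a functor to coalgebras that preserves finite products is symmetric
monoidal, because the tensor product of coalgebras is their product. -/
instance : (toCocontinuousCartesian A G).EssSurj where
  mem_essImage F := by
    have hF : IsCocontinuousCartesian F.obj := F.property
    have := hF.cocontinuous
    let := underlyingBraided F.obj hF.terminal hF.prod
    have : PreservesColimitsOfSize.{u, u} (F.obj ⋙ forgetCommComon A) := inferInstance
    exact ⟨{ functor := F.obj ⋙ forgetCommComon A }, ⟨(ObjectProperty.fullyFaithfulι _).preimageIso
      (diagonalUnderlyingIso F.obj hF.terminal hF.prod)⟩⟩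

instance : (toCocontinuousCartesian A G).IsEquivalence where

end

variable {K G H : Type u} [Groupoid.{u} K] [Groupoid.{u} G] [Groupoid.{u} H]

/-- Precomposition with `φ^*` commutes with the passage to functors to coalgebras. -/
def precompRestrictionIso [HasColimitsOfSize.{u, u} A] (φ : G ⥤ H) :
    TwoRingHom.precomp A (restriction φ) ⋙ toCocontinuousCartesian A H ≅
      toCocontinuousCartesian A G ⋙ precompRes φ :=
  NatIso.ofComponents
    (fun α => (ObjectProperty.fullyFaithfulι _).preimageIso
      (diagonalCompIso (restriction φ).functor α.functor))
    fun f => by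
      apply ObjectProperty.hom_ext
      ext S
      exact (Category.comp_id (f.natTrans.app (φ ⋙ S))).trans (Category.id_comp _).symm

/-- Under `toCocontinuousCartesian`, composition with `ξ^*`, `φ^*` and `ψ^*` becomes the diagram of
`IsConcreteEqualizer.isEqualizing` for the category of cocommutative coalgebras of `A`. -/
theorem isGoodAffineSchemeEqualizer_restriction {ξ : K ⥤ G} {φ ψ : G ⥤ H} {p : ξ ⋙ φ ≅ ξ ⋙ ψ}
    (hE : IsConcreteEqualizer ξ φ ψ p) :
    IsGoodAffineSchemeEqualizer.{u, u + 1, v} (restriction φ) (restriction ψ) (restriction ξ)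
      (restrictionIso ξ φ ψ p) := by
  intro A _ _ _ _
  refine IsEqualizing.isEquivalence_isoInserter_lift
    (hE.isEqualizing.of_equivalence (toCocontinuousCartesian A K) (toCocontinuousCartesian A G)
      (toCocontinuousCartesian A H) (precompRestrictionIso ξ) (precompRestrictionIso φ)
      (precompRestrictionIso ψ) fun α => ?_)
  apply ObjectProperty.hom_ext
  ext S
  change (𝟙 _ ≫ α.functor.map (Functor.whiskerRight p.hom S) ≫ 𝟙 _) ≫ 𝟙 _ ≫ 𝟙 _ =
    𝟙 _ ≫ 𝟙 _ ≫ α.functor.map (Functor.whiskerRight p.hom S)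
  simp

end Affine

end TwoRing

end

open TwoRing in
/-- For an equalizer `(K, ξ, p)` of `φ, ψ : G ⥤ H` in the 2-category of small groupoids: over
every good cartesian 2-ring `A` the pushforward of a torsor is a torsor and the functor
`T : Tors(K, A) ⥤ Tors(G, A; φ, ψ)` is an equivalence; moreover `^K Set`, `^G Set`, `^H Set` are
good commutative 2-rings, and `^K Set` with `ξ^*` and `p^*` is an equalizer of `φ^*` and `ψ^*` in
the 2-category of good affine 2-schemes. -/
theorem mainTheorem7 {K G H : Type u} [Groupoid.{u} K] [Groupoid.{u} G] [Groupoid.{u} H]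
    (ξ : K ⥤ G) (φ ψ : G ⥤ H) (p : ξ ⋙ φ ≅ ξ ⋙ ψ) (hK : IsGroupoidEqualizer ξ φ ψ p) :
    (∀ (A : Type v) [Category.{u} A] [CartesianMonoidalCategory A] [BraidedCategory A]
        [IsGoodCartesianTwoRing.{u} A],
      ∃ hA : PushforwardPreservesTorsors.{u} A, (Tors.T hA ξ φ ψ p).IsEquivalence) ∧
    (IsGoodTwoRing.{u} (K ⥤ Type u) ∧ IsGoodTwoRing.{u} (G ⥤ Type u) ∧
      IsGoodTwoRing.{u} (H ⥤ Type u)) ∧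
    IsGoodAffineSchemeEqualizer.{u, u + 1, v'} (restriction φ) (restriction ψ) (restriction ξ)
      (restrictionIso ξ φ ψ p) := by
  have hE := hK.isConcreteEqualizer
  refine ⟨fun A _ _ _ _ => ?_, ⟨isGoodTwoRing_functorToType K, isGoodTwoRing_functorToType G,
    isGoodTwoRing_functorToType H⟩, isGoodAffineSchemeEqualizer_restriction hE⟩
  have : IsGoodCartesian A := ⟨inferInstance, IsTwoRing.tensorLeft_cocontinuous,
    IsTwoRing.tensorRight_cocontinuous, IsGoodCartesianTwoRing.good⟩
  exact ⟨pushforwardPreservesTorsors A, isEquivalence_torsT _ hE⟩
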